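/- **Setting.** Let $(M^3,J,\theta)$ be a three-dimensional pseudohermitian manifold: $J$ is a smooth complex structure on a smooth plane field $H\subset TM$, and $\theta$ is a real one-form with $\ker\theta=H$ such that $d\theta(\cdot,J\cdot)$ is positive definite on $H$; let $M$ be oriented by $\theta\wedge d\theta$. Let $T$ be the Reeb field ($\theta(T)=1$, $d\theta(T,\cdot)=0$), let $Z_1$ be a local frame of the $+i$-eigenbundle $T^{1,0}$ of $J$, and let $\{\theta,\theta^1,\theta^{\bar1}\}$ be the coframe dual to $\{T,Z_1,Z_{\bar1}\}$, $Z_{\bar 1}=\overline{Z_1}$, so that $d\theta=ih_{1\bar1}\theta^1\wedge\theta^{\bar1}$ with $h_{1\bar1}>0$. The Tanaka–Webster connection form $\omega_1{}^1$ and torsion $A_{11}$ are defined by $$d\theta^1=\theta^1\wedge\omega_1{}^1+\theta\wedge (h^{1\bar1}\overline{A_{11}}\,\theta^{\bar1}),\qquad h_{1\bar1}\big(\omega_1{}^1+\overline{\omega_1{}^1}\big)=dh_{1\bar1},$$ and the scalar curvature $R$ by $d\omega_1{}^1\equiv R\,h_{1\bar1}\,\theta^1\wedge\theta^{\bar1}$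 mod $\theta$. Let $\nabla$ be the induced connection, raise and lower indices with $h_{\alpha\bar\beta}$, let $\nabla_0$ be the derivative along $T$ (in $\nabla_\alpha\nabla_{\bar\beta}f$ the derivative $\nabla_{\bar\beta}$ acts first), and put $$\Delta_b f=-(\nabla^\alpha\nabla_\alpha f+\nabla_\alpha\nabla^\alpha f),\qquad W_\alpha=\nabla_\alpha R-i\nabla^\beta A_{\alpha\beta},\qquad P_\alpha f=\nabla_\alpha\nabla_\beta\nabla^\beta f+iA_{\alpha\beta}\nabla^\beta f,$$ $$P_4f=\Delta_b^2f+\nabla_0^2f-4\,\mathrm{Im}\,\nabla^\alpha\big(A_{\alpha\beta}\nabla^\beta f\big),$$ $$P_4'f=4\Delta_b^2f-8\,\mathrm{Im}\,\nabla^\alpha\big(A_{\alpha\beta}\nabla^\beta f\big)-4\,\mathrm{Re}\,\nabla^\alpha\big(R\nabla_\alpha f\big)+\tfrac83\mathrm{Re}\big(W_\alpha\nabla^\alpha f\big)+\tfrac23\big(\Delta_bR-2\,\mathrm{Im}\,\nabla^\alpha\nabla^\beta A_{\alpha\beta}\big)f$$ for all $f\in C^\infty(M)$. Let $Q=P_4'(1)$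 be Hirachi's $Q$-curvature and let $$Q_4'=2\Delta_bR-4|A_{\alpha\beta}|^2+R^2,\qquad |A_{\alpha\beta}|^2=A_{\alpha\beta}A^{\alpha\beta}.$$ **Proposition.** Let $\sigma\in C^\infty(M)$ be real-valued, and let $\hat Q_4'$ be the scalar $Q_4'$ defined in terms of the contact form $\hat\theta=e^\sigma\theta$. Then $$e^{2\sigma}\hat Q_4'=Q_4'+P_4'(\sigma)+\tfrac{16}{3}\,\mathrm{Re}\,\nabla^\alpha(\sigma W_\alpha)+3Q\sigma+\tfrac12P_4(\sigma^2)-\sigma P_4(\sigma)-16\,\mathrm{Re}\big((\nabla^\alpha\sigma)(P_\alpha\sigma)\big).$$ In particular, if $M$ is compact, then $$\int_M\hat Q_4'\,\hat\theta\wedge d\hat\theta=\int_MQ_4'\,\theta\wedge d\theta+3\int_M\big(\sigma P_4\sigma+2Q\sigma\big)\,\theta\wedge d\theta .$$ -/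

import Mathlib

open scoped Manifold ContDiff
open Bundle MeasureTheory

namespace CR

noncomputable section

/-- The model space of three-dimensional manifolds. -/
abbrev E3 : Type := EuclideanSpace ℝ (Fin 3)

/-! ### Vector fields and one-forms on a 3-manifold -/

/-- Real vector fields (no regularity imposed). -/
abbrev VField (M : Type*) [TopologicalSpace M] [ChartedSpace E3 M] : Type _ :=
  ∀ x : M, TangentSpace (𝓡 3) x

/-- One-forms with values in a real normed space `F` (here `F = ℝ` or `F = ℂ`). -/
abbrev OneForm (M : Type*) [TopologicalSpace M] [ChartedSpace E3 M]
    (F : Type*) [NormedAddCommGroup F] [NormedSpace ℝ F] : Type _ :=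
  ∀ x : M, TangentSpace (𝓡 3) x →L[ℝ] F

/-- The derivative `V f` of a function along a real vector field. -/
def dir {M : Type*} [TopologicalSpace M] [ChartedSpace E3 M]
    {F : Type*} [NormedAddCommGroup F] [NormedSpace ℝ F]
    (V : VField M) (f : M → F) (x : M) : F :=
  mfderiv (𝓡 3) 𝓘(ℝ, F) f x (V x)

/-- The exterior derivative of a one-form,
`dα(V, W) = V (α(W)) - W (α(V)) - α([V, W])`. -/
def d {M : Type*} [TopologicalSpace M] [ChartedSpace E3 M]
    {F : Type*} [NormedAddCommGroup F] [NormedSpace ℝ F]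
    (α : OneForm M F) (V W : VField M) (x : M) : F :=
  dir V (fun y => α y (W y)) x - dir W (fun y => α y (V y)) x
    - α x (VectorField.mlieBracket (𝓡 3) V W x)

/-- Complex vector fields `re + i im`, i.e. sections of the complexified tangent bundle. -/
@[ext]
structure CField (M : Type*) [TopologicalSpace M] [ChartedSpace E3 M] where
  re : VField M
  im : VField M

/-- A real vector field as a complex one. -/
def CField.ofReal {M : Type*} [TopologicalSpace M] [ChartedSpace E3 M] (V : VField M) :
    CField M := ⟨V, fun _ => 0⟩

/-- The derivative `W f = (re W) f + i (im W) f` of a complex function along a complex field. -/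
def dirC {M : Type*} [TopologicalSpace M] [ChartedSpace E3 M]
    (W : CField M) (f : M → ℂ) (x : M) : ℂ :=
  dir W.re f x + Complex.I * dir W.im f x

/-- The complex-bilinear extension of `dα` to complex vector fields. -/
def dC {M : Type*} [TopologicalSpace M] [ChartedSpace E3 M]
    (α : OneForm M ℂ) (V W : CField M) (x : M) : ℂ :=
  d α V.re W.re x - d α V.im W.im x
    + Complex.I * (d α V.re W.im x + d α V.im W.re x)

/-- Smoothness of a real vector field on a set. -/
def SmoothFieldOn {M : Type*} [TopologicalSpace M] [ChartedSpace E3 M]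
    [IsManifold (𝓡 3) ∞ M] (V : VField M) (U : Set M) : Prop :=
  ContMDiffOn (𝓡 3) (𝓡 3).tangent ∞ (fun x => (⟨x, V x⟩ : TangentBundle (𝓡 3) M)) U

/-! ### CR structures and contact forms -/

/-- A smooth local frame `X, Y = J X` of a plane field `H` with a complex structure `J`, on an open
set `U`.  It is the same thing as a smooth nowhere vanishing local section `Z = X - i J X` of the
`+i`-eigenbundle `T^{1,0}`. -/
structure LocalFrame {M : Type*} [TopologicalSpace M] [ChartedSpace E3 M] [IsManifold (𝓡 3) ∞ M]
    (H : ∀ x : M, Submodule ℝ (TangentSpace (𝓡 3) x)) (J : ∀ x : M, H x →ₗ[ℝ] H x) where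
  U : Set M
  isOpen_U : IsOpen U
  X : VField M
  Y : VField M
  smooth_X : SmoothFieldOn X U
  smooth_Y : SmoothFieldOn Y U
  X_ne_zero : ∀ x ∈ U, X x ≠ 0
  X_mem : ∀ x ∈ U, X x ∈ H x
  Y_eq : ∀ x (hx : x ∈ U), Y x = J x ⟨X x, X_mem x hx⟩

/-- An (abstract) CR structure on a 3-manifold: a smooth plane field `H ⊂ TM` with a smooth
complex structure `J : H → H`.  Formal integrability is automatic since `T^{1,0}` is a line bundle.
Strict pseudoconvexity (hence nonintegrability of `H`) is part of `ContactForm`. -/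
structure CRStructure (M : Type*) [TopologicalSpace M] [ChartedSpace E3 M]
    [IsManifold (𝓡 3) ∞ M] where
  H : ∀ x : M, Submodule ℝ (TangentSpace (𝓡 3) x)
  J : ∀ x : M, H x →ₗ[ℝ] H x
  finrank_H : ∀ x, Module.finrank ℝ (H x) = 2
  J_sq : ∀ x (v : H x), J x (J x v) = -v
  exists_frame : ∀ x, ∃ F : LocalFrame H J, x ∈ F.U

/-- Local frames of `T^{1,0}` for a CR structure. -/
abbrev CRStructure.Frame {M : Type*} [TopologicalSpace M] [ChartedSpace E3 M]
    [IsManifold (𝓡 3) ∞ M] (S : CRStructure M) : Type _ := LocalFrame S.H S.J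

/-- A contact form for `(M, J)`: a smooth real one-form `θ` with kernel `H` such that
`dθ(·, J ·)` is positive definite on `H`. -/
structure ContactForm {M : Type*} [TopologicalSpace M] [ChartedSpace E3 M]
    [IsManifold (𝓡 3) ∞ M] (S : CRStructure M) where
  form : OneForm M ℝ
  smooth_form : ContMDiff (𝓡 3) ((𝓡 3).prod 𝓘(ℝ, E3 →L[ℝ] ℝ)) ∞
    (fun x => (TotalSpace.mk' (E3 →L[ℝ] ℝ) x (form x) :
      TotalSpace (E3 →L[ℝ] ℝ) (fun x : M => TangentSpace (𝓡 3) x →L[ℝ] Trivial M ℝ x)))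
  ker_form : ∀ x (v : TangentSpace (𝓡 3) x), form x v = 0 ↔ v ∈ S.H x
  levi_pos : ∀ (F : S.Frame), ∀ x ∈ F.U, 0 < d form F.X F.Y x

section Frame

variable {M : Type*} [TopologicalSpace M] [ChartedSpace E3 M] [IsManifold (𝓡 3) ∞ M]
  {S : CRStructure M}

/-- The section `Z = X - i J X` of `T^{1,0}` given by a local frame. -/
def LocalFrame.Z (F : S.Frame) : CField M := ⟨F.X, fun x => -F.Y x⟩

/-- The conjugate section `Z̄ = X + i J X` of `T^{0,1}`. -/
def LocalFrame.Zbar (F : S.Frame) : CField M := ⟨F.X, F.Y⟩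

namespace ContactForm

/-- `T` is the Reeb field of `θ`: it is smooth, `θ(T) = 1` and `dθ(T, ·) = 0`. -/
def IsReeb (θ : ContactForm S) (T : VField M) : Prop :=
  SmoothFieldOn T Set.univ ∧ (∀ x, θ.form x (T x) = 1) ∧
    ∀ (U : Set M) (W : VField M), IsOpen U → SmoothFieldOn W U → ∀ x ∈ U, d θ.form T W x = 0

/-- The Reeb vector field (the unique field satisfying `IsReeb`). -/
def reeb (θ : ContactForm S) : VField M :=
  haveI : Nonempty (VField M) := ⟨fun _ => 0⟩
  Classical.epsilon θ.IsReeb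

/-- The Reeb field as a complex vector field. -/
def T (θ : ContactForm S) : CField M := CField.ofReal θ.reeb

/-- `θ` as a complex-valued one-form. -/
def formC (θ : ContactForm S) : OneForm M ℂ := fun x => Complex.ofRealCLM.comp (θ.form x)

/-- The admissible coframe `θ¹` dual to the frame `(T, Z, Z̄)`: the form with
`θ¹(Z) = 1`, `θ¹(Z̄) = 0`, `θ¹(T) = 0`. -/
def coframe (θ : ContactForm S) (F : S.Frame) : OneForm M ℂ := fun x =>
  Classical.epsilon fun α : TangentSpace (𝓡 3) x →L[ℝ] ℂ =>
    α (F.Z.re x) + Complex.I * α (F.Z.im x) = 1 ∧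
    α (F.Zbar.re x) + Complex.I * α (F.Zbar.im x) = 0 ∧
    α (θ.reeb x) = 0

/-- The conjugate coframe. -/
def coframeBar (θ : ContactForm S) (F : S.Frame) : OneForm M ℂ := fun x =>
  (Complex.conjCLE : ℂ →L[ℝ] ℂ).comp (θ.coframe F x)

/-- The Levi form component `h = h_{1 1̄}`, defined by `dθ = i h θ¹ ∧ θ^{1̄}`. -/
def h (θ : ContactForm S) (F : S.Frame) (x : M) : ℂ :=
  -Complex.I * dC θ.formC F.Z F.Zbar x

/-! The Tanaka–Webster connection form `ω = ω₁¹` and torsion `A = A₁₁` are the solutions of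
`dθ¹ = θ¹ ∧ ω + θ ∧ τ¹` with `τ¹ = h⁻¹ Ā θ^{1̄}`, and `h ω + h ω̄ = dh`.  Evaluating the first
equation on `(Z, Z̄)`, `(T, Z)`, `(T, Z̄)` and the second one on `Z` gives the components below. -/

/-- `ω(Z̄) = dθ¹(Z, Z̄)`. -/
def omegaZbar (θ : ContactForm S) (F : S.Frame) (x : M) : ℂ :=
  dC (θ.coframe F) F.Z F.Zbar x

/-- `ω(T) = -dθ¹(T, Z)`. -/
def omegaT (θ : ContactForm S) (F : S.Frame) (x : M) : ℂ :=
  -dC (θ.coframe F) θ.T F.Z x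

/-- `ω(Z) = h⁻¹ Z h - conj (ω(Z̄))`. -/
def omegaZ (θ : ContactForm S) (F : S.Frame) (x : M) : ℂ :=
  (θ.h F x)⁻¹ * dirC F.Z (θ.h F) x - star (θ.omegaZbar F x)

/-- The torsion component `A₁₁`; `h⁻¹ conj(A₁₁) = dθ¹(T, Z̄)`. -/
def A (θ : ContactForm S) (F : S.Frame) (x : M) : ℂ :=
  star (θ.h F x * dC (θ.coframe F) θ.T F.Zbar x)

/-- The connection form `ω₁¹`. -/
def omega (θ : ContactForm S) (F : S.Frame) : OneForm M ℂ := fun x =>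
  θ.omegaT F x • θ.formC x + θ.omegaZ F x • θ.coframe F x
    + θ.omegaZbar F x • θ.coframeBar F x

/-- The pseudohermitian scalar curvature `R = h⁻¹ R_{1 1̄}`, where
`dω₁¹ = R_{1 1̄} θ¹ ∧ θ^{1̄}` modulo `θ` (`R_{1 1̄}` is real). -/
def R (θ : ContactForm S) (F : S.Frame) (x : M) : ℝ :=
  ((θ.h F x)⁻¹ * dC (θ.omega F) F.Z F.Zbar x).re

/-! ### Covariant derivatives in a frame

A tensor with `a` lower indices `1` and `b` lower indices `1̄` is represented by its component `t`
in the frame; `∇₁ t = Z t - (a ω(Z) + b ω̄(Z)) t` and `∇_{1̄} t = Z̄ t - (a ω(Z̄) + b ω̄(Z̄)) t`, with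
`ω̄ = ω_{1̄}^{1̄}` the conjugate of `ω`.  Indices are raised with `h⁻¹`, e.g. `∇¹ = h⁻¹ ∇_{1̄}`. -/

/-- The component of `∇₁ t`. -/
def nabla (θ : ContactForm S) (F : S.Frame) (a b : ℕ) (t : M → ℂ) (x : M) : ℂ :=
  dirC F.Z t x - (a * θ.omegaZ F x + b * star (θ.omegaZbar F x)) * t x

/-- The component of `∇_{1̄} t`. -/
def nablaBar (θ : ContactForm S) (F : S.Frame) (a b : ℕ) (t : M → ℂ) (x : M) : ℂ :=
  dirC F.Zbar t x - (a * θ.omegaZbar F x + b * star (θ.omegaZ F x)) * t x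

/-- `∇¹ f = h⁻¹ ∇_{1̄} f` for a function `f`. -/
def gradUp (θ : ContactForm S) (F : S.Frame) (f : M → ℂ) (x : M) : ℂ :=
  (θ.h F x)⁻¹ * θ.nablaBar F 0 0 f x

/-- The divergence `∇^α τ_α` of a `(1,0)`-form with component `τ₁`. -/
def div (θ : ContactForm S) (F : S.Frame) (τ : M → ℂ) (x : M) : ℂ :=
  (θ.h F x)⁻¹ * θ.nablaBar F 1 0 τ x

/-- `∇_β ∇^β f = h⁻¹ ∇₁ ∇_{1̄} f`. -/
def box (θ : ContactForm S) (F : S.Frame) (f : M → ℂ) (x : M) : ℂ :=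
  (θ.h F x)⁻¹ * θ.nabla F 0 1 (θ.nablaBar F 0 0 f) x

/-- `∇^β ∇_β f = h⁻¹ ∇_{1̄} ∇₁ f`. -/
def boxBar (θ : ContactForm S) (F : S.Frame) (f : M → ℂ) (x : M) : ℂ :=
  θ.div F (θ.nabla F 0 0 f) x

/-- The sublaplacian `Δ_b u = -(∇^α ∇_α u + ∇_α ∇^α u)` of a real function (the sum is real). -/
def sublaplacian (θ : ContactForm S) (F : S.Frame) (u : M → ℝ) (x : M) : ℝ :=
  -(θ.boxBar F (fun y => (u y : ℂ)) x + θ.box F (fun y => (u y : ℂ)) x).re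

/-- The component of the `(1,0)`-form `∇^β A_{αβ}`. -/
def divA (θ : ContactForm S) (F : S.Frame) (x : M) : ℂ :=
  (θ.h F x)⁻¹ * θ.nablaBar F 2 0 (θ.A F) x

/-- The norm `|A_{αβ}|² = A_{αβ} A^{αβ} = h⁻² A₁₁ conj(A₁₁)`. -/
def normSqA (θ : ContactForm S) (F : S.Frame) (x : M) : ℝ :=
  ((θ.h F x)⁻¹ ^ 2 * θ.A F x * star (θ.A F x)).re

/-- The component of `W_α = ∇_α R - i ∇^β A_{αβ}`. -/
def W (θ : ContactForm S) (F : S.Frame) (x : M) : ℂ :=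
  θ.nabla F 0 0 (fun y => (θ.R F y : ℂ)) x - Complex.I * θ.divA F x

/-- The component of `P_α f = ∇_α ∇_β ∇^β f + i A_{αβ} ∇^β f`. -/
def PForm (θ : ContactForm S) (F : S.Frame) (f : M → ℝ) (x : M) : ℂ :=
  θ.nabla F 0 0 (θ.box F (fun y => (f y : ℂ))) x
    + Complex.I * θ.A F x * θ.gradUp F (fun y => (f y : ℂ)) x

/-- `∇^α (A_{αβ} ∇^β f)`. -/
def divAGrad (θ : ContactForm S) (F : S.Frame) (f : M → ℝ) (x : M) : ℂ :=
  θ.div F (fun y => θ.A F y * θ.gradUp F (fun z => (f z : ℂ)) y) x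

/-- The CR Paneitz operator in dimension three,
`P₄ f = Δ_b² f + ∇₀² f - 4 Im ∇^α (A_{αβ} ∇^β f)`. -/
def P4 (θ : ContactForm S) (F : S.Frame) (f : M → ℝ) (x : M) : ℝ :=
  θ.sublaplacian F (θ.sublaplacian F f) x + dir θ.reeb (dir θ.reeb f) x
    - 4 * (θ.divAGrad F f x).im

/-- The operator
`P₄' f = 4 Δ_b² f - 8 Im ∇^α (A_{αβ} ∇^β f) - 4 Re ∇^α (R ∇_α f) + (8/3) Re (W_α ∇^α f)
  + (2/3) (Δ_b R - 2 Im ∇^α ∇^β A_{αβ}) f`, acting on arbitrary functions. -/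
def P4' (θ : ContactForm S) (F : S.Frame) (f : M → ℝ) (x : M) : ℝ :=
  4 * θ.sublaplacian F (θ.sublaplacian F f) x
    - 8 * (θ.divAGrad F f x).im
    - 4 * (θ.div F (fun y => (θ.R F y : ℂ) * θ.nabla F 0 0 (fun z => (f z : ℂ)) y) x).re
    + 8 / 3 * (θ.W F x * θ.gradUp F (fun y => (f y : ℂ)) x).re
    + 2 / 3 * (θ.sublaplacian F (θ.R F) x - 2 * (θ.div F (θ.divA F) x).im) * f x

/-- Hirachi's `Q`-curvature `Q = P₄'(1)`. -/
def Q (θ : ContactForm S) (F : S.Frame) : M → ℝ := θ.P4' F (fun _ => 1)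

/-- The scalar `Q₄' = 2 Δ_b R - 4 |A_{αβ}|² + R²`. -/
def Q4' (θ : ContactForm S) (F : S.Frame) (x : M) : ℝ :=
  2 * θ.sublaplacian F (θ.R F) x - 4 * θ.normSqA F x + θ.R F x ^ 2

/-! ### Integration against `θ ∧ dθ` -/

/-- The components `θ(∂ₖ)` of `θ` in the chart centred at `c`, as functions on the chart's target. -/
def coord (θ : ContactForm S) (c : M) (k : Fin 3) (y : E3) : ℝ :=
  θ.form ((extChartAt (𝓡 3) c).symm y)
    (mfderiv 𝓘(ℝ, E3) (𝓡 3) (extChartAt (𝓡 3) c).symm y (EuclideanSpace.single k (1 : ℝ)))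

/-- `∂ⱼ (θ(∂ₖ))` in the chart centred at `c`. -/
def dcoord (θ : ContactForm S) (c : M) (j k : Fin 3) (y : E3) : ℝ :=
  fderiv ℝ (θ.coord c k) y (EuclideanSpace.single j (1 : ℝ))

/-- The coefficient `(θ ∧ dθ)(∂₀, ∂₁, ∂₂)` of `θ ∧ dθ` in the chart centred at `c`. -/
def volCoeff (θ : ContactForm S) (c : M) (y : E3) : ℝ :=
  θ.coord c 0 y * (θ.dcoord c 1 2 y - θ.dcoord c 2 1 y)
    + θ.coord c 1 y * (θ.dcoord c 2 0 y - θ.dcoord c 0 2 y)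
    + θ.coord c 2 y * (θ.dcoord c 0 1 y - θ.dcoord c 1 0 y)

end ContactForm

end Frame

/-- A smooth partition of unity subordinate to the chart domains. -/
def chartPartition (M : Type*) [TopologicalSpace M] [T2Space M] [SigmaCompactSpace M]
    [ChartedSpace E3 M] [IsManifold (𝓡 3) ∞ M] :
    SmoothPartitionOfUnity M (𝓡 3) M Set.univ :=
  (SmoothPartitionOfUnity.exists_isSubordinate_chartAt_source (𝓡 3) M).choose

/-- The integral `∫_M f θ ∧ dθ` over a compact manifold, oriented by the nowhere vanishing 3-form
`θ ∧ dθ` (so that in each chart `θ ∧ dθ` is `|(θ ∧ dθ)(∂₀, ∂₁, ∂₂)|` times Lebesgue measure),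
computed with a partition of unity subordinate to the charts. -/
def ContactForm.integral {M : Type*} [TopologicalSpace M] [T2Space M] [SigmaCompactSpace M]
    [ChartedSpace E3 M] [IsManifold (𝓡 3) ∞ M] {S : CRStructure M}
    (θ : ContactForm S) (f : M → ℝ) : ℝ :=
  ∑ᶠ c : M, ∫ y in (extChartAt (𝓡 3) c).target,
    chartPartition M c ((extChartAt (𝓡 3) c).symm y) * f ((extChartAt (𝓡 3) c).symm y)
      * |θ.volCoeff c y|

end

end CR

/-! ### Abstract moving frames: structure equations, curvature, change of frame. -/

namespace CR

/-! The pointwise law is local, so it becomes an identity in differential algebra. The smooth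
functions on a small open set form a star algebra with derivations `T`, `Z`, `Zb`. The
pseudohermitian data (`h`, connection, torsion) are the coefficients of the commutators `[Zb, Z]`
and `[T, Z]`, and `FrameAlgebra` records exactly this. Since the three derivations are independent
over the functions, comparing coefficients of commutators gives the Bianchi-type identities
(`jacobi`), and also shows how the data change under Z ↦ λZ (`FrameChange`) and under θ ↦ e^σ θ
(`ConformalChange`).

All scalars in the theorem are independent of the frame, so the computation may be done where h = 1.
There e^σ R̂ = R + 2Δ_bσ - 2|Zσ|² and Â = A + i(∇₁∇₁σ - (∇₁σ)²). Substituted in Q₄', these give a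
polynomial in σ whose cubic and quartic parts cancel. The linear part is `linear_terms`: it contains
no derivative of the torsion, because Q = -(4/3) Re ∇^α W_α makes the corresponding terms of the
claimed law cancel as well. The quadratic part is the Bochner-type identity `quadratic_terms`.
Together they give `ConformalChange.Q4'_eq`. The bridge to the manifold is `frameAlg`, the algebra
of an actual frame, and the relation `Rep`, which says that a concrete function is the value of an
algebraic expression.

For the integral, θ̂ ∧ dθ̂ = e^{2σ} θ ∧ dθ absorbs the factor on the left. Since P₄f = 4 Re ∇^α P_α
f (`P4_eq_div`) and Q is itself a divergence (`Q3_eq_div`), the right side minus Q₄' and minus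
3(σP₄σ + 2Qσ) is Re ∇^α τ_α for an explicit (1,0)-form τ (`div_exactForm`). Its integral vanishes by
`integral_div_eq_zero`: the real form α = Im(τ₁θ¹) satisfies dθ ∧ α = 0 and θ ∧ dα = Re(∇^α τ_α) θ ∧
dθ, so the integrand is -d(θ ∧ α). Stokes is carried out by a partition of unity and integration by
parts in charts. -/

/-- A complexified moving frame on an abstract algebra of functions. -/
structure FrameAlgebra (A : Type*) [CommRing A] [StarRing A] [Algebra ℂ A] [StarModule ℂ A] where
  T : Derivation ℂ A A
  Z : Derivation ℂ A A
  Zb : Derivation ℂ A A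
  h : A
  hi : A
  p : A
  q : A
  a : A
  star_T : ∀ f, star (T f) = T (star f)
  star_Z : ∀ f, star (Z f) = Zb (star f)
  star_h : star h = h
  h_mul_hi : h * hi = 1
  Zb_Z : ∀ f, Zb (Z f) = Z (Zb f) + algebraMap ℂ A Complex.I * h * T f + p * Z f - star p * Zb f
  T_Z : ∀ f, T (Z f) = Z (T f) + q * Z f - hi * a * Zb f
  indep : ∀ u v w, (∀ f, u * T f + v * Z f + w * Zb f = 0) → u = 0 ∧ v = 0 ∧ w = 0

namespace FrameAlgebra

variable {A : Type*} [CommRing A] [StarRing A] [Algebra ℂ A] [StarModule ℂ A]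
  (F : FrameAlgebra A)

/-- The imaginary unit. -/
def i (_ : FrameAlgebra A) : A := algebraMap ℂ A Complex.I

lemma i_sq : F.i * F.i = -1 := by
  simp only [i, ← map_mul, Complex.I_mul_I, map_neg, map_one]

@[simp] lemma star_i : star F.i = -F.i := by
  simp only [i, ← algebraMap_star_comm, ← map_neg]
  simp

@[simp] lemma deriv_i (D : Derivation ℂ A A) : D F.i = 0 := D.map_algebraMap _

lemma star_Zb (f : A) : star (F.Zb f) = F.Z (star f) := by
  rw [← star_inj, F.star_Z, star_star, star_star]

lemma star_hi : star F.hi = F.hi := by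
  have h1 : F.h * star F.hi = 1 := by
    have := congrArg star F.h_mul_hi
    rwa [star_mul', F.star_h, star_one] at this
  linear_combination (F.hi * h1 - star F.hi * F.h_mul_hi)

lemma comm_Zb_Z (f : A) :
    F.Zb (F.Z f) = F.Z (F.Zb f) + F.i * F.h * F.T f + F.p * F.Z f - star F.p * F.Zb f := F.Zb_Z f

lemma comm_T_Zb (f : A) :
    F.T (F.Zb f) = F.Zb (F.T f) + star F.q * F.Zb f - F.hi * star F.a * F.Z f := by
  have := congrArg star (F.T_Z (star f))
  simpa only [star_add, star_sub, star_mul', star_star, F.star_T, F.star_Z, F.star_Zb, F.star_hi]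
    using this

lemma mul_deriv_hi (D : Derivation ℂ A A) : D F.hi = - (F.hi * F.hi * D F.h) := by
  have := congrArg D F.h_mul_hi
  simp only [Derivation.leibniz, smul_eq_mul, Derivation.map_one_eq_zero] at this
  linear_combination F.hi * this - D F.hi * F.h_mul_hi

/-- Apply `T` to the relation for `[Zb, Z] f`, and compare with the result of commuting `T` through
`Zb` and `Z` separately. Second-order terms cancel, and independence of the frame separates the
rest. The first identity is metric compatibility along `T`, which the definition of `oZ` imposes
only along `Z`; the second is a Bianchi identity. -/
lemma jacobi : F.i * F.T F.h = F.i * ((F.q + star F.q) * F.h) ∧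
    F.T F.p = F.Zb F.q + F.p * star F.q + F.Z (F.hi * star F.a) - star F.p * F.hi * star F.a := by
  have key : ∀ f, (F.i * ((F.q + star F.q) * F.h) - F.i * F.T F.h) * F.T f +
      (F.Zb F.q + F.p * star F.q + F.Z (F.hi * star F.a) - star F.p * F.hi * star F.a - F.T F.p)
        * F.Z f + (F.T (star F.p) - F.Zb (F.hi * F.a) - F.Z (star F.q) - star F.p * F.q
        + F.p * F.hi * F.a) * F.Zb f = 0 := by
    intro f
    have e1 := F.comm_T_Zb (F.Z f)
    have e2 := congrArg F.T (F.comm_Zb_Z f)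
    rw [e1] at e2
    simp only [Derivation.leibniz, smul_eq_mul, map_add, map_sub, F.T_Z, F.comm_T_Zb, F.comm_Zb_Z,
      deriv_i] at e2 ⊢
    linear_combination e2
  obtain ⟨h1, h2, -⟩ := F.indep _ _ _ key
  exact ⟨(sub_eq_zero.mp h1).symm, (sub_eq_zero.mp h2).symm⟩

lemma T_h : F.T F.h = (F.q + star F.q) * F.h := by
  linear_combination -F.i * F.jacobi.1 + (F.T F.h - (F.q + star F.q) * F.h) * F.i_sq

lemma T_p : F.T F.p =
    F.Zb F.q + F.p * star F.q + F.Z (F.hi * star F.a) - star F.p * F.hi * star F.a :=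
  F.jacobi.2

/-! ### Covariant derivatives and curvature -/

/-- The component `ω(Z)` of the connection form. -/
def oZ : A := F.hi * F.Z F.h - star F.p

/-- The component of `∇₁ t`. -/
def nabla (m n : ℕ) (t : A) : A := F.Z t - (m * F.oZ + n * star F.p) * t

/-- The component of `∇_{1̄} t`. -/
def nablaBar (m n : ℕ) (t : A) : A := F.Zb t - (m * F.p + n * star F.oZ) * t

/-- The divergence of a `(1,0)`-form. -/
def div (t : A) : A := F.hi * F.nablaBar 1 0 t

/-- The operator `∇_β ∇^β`. -/
def box (f : A) : A := F.hi * F.nabla 0 1 (F.Zb f)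

/-- The sublaplacian of a real function. -/
def lap (u : A) : A := -(F.div (F.Z u) + F.box u)

/-- The scalar curvature. -/
def R : A := F.hi * (F.Z F.p - F.Zb F.oZ + F.i * F.h * F.q + F.p * F.oZ - star F.p * F.p)

/-- The divergence of the torsion. -/
def divA : A := F.hi * F.nablaBar 2 0 F.a

/-- The component of `W_α`. -/
def W : A := F.Z F.R - F.i * F.divA

/-- The component of `P_α f`. -/
def PForm (f : A) : A := F.Z (F.box f) + F.i * F.a * (F.hi * F.Zb f)

/-- The function `∇^α (A_{αβ} ∇^β f)`. -/
def divAGrad (f : A) : A := F.div (F.a * (F.hi * F.Zb f))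

/-- The CR Paneitz operator on real functions. -/
def P4 (f : A) : A :=
  F.lap (F.lap f) + F.T (F.T f) + 2 * F.i * (F.divAGrad f - star (F.divAGrad f))

/-- Three times the zeroth order coefficient of the operator `P₄'`. -/
def Q3 : A := 2 * (F.lap F.R + F.i * (F.div F.divA - star (F.div F.divA)))

/-- Three times the operator `P₄'` on real functions. -/
def P4' (f : A) : A :=
  12 * F.lap (F.lap f) + 12 * F.i * (F.divAGrad f - star (F.divAGrad f))
    - 6 * (F.div (F.R * F.Z f) + star (F.div (F.R * F.Z f)))
    + 4 * (F.W * (F.hi * F.Zb f) + star (F.W * (F.hi * F.Zb f))) + F.Q3 * f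

/-- The scalar `Q₄'`. -/
def Q4' : A := 2 * F.lap F.R - 4 * (F.hi ^ 2 * F.a * star F.a) + F.R ^ 2

/-- The obstruction to reality is the commutator `[Zb, Z]` acting on log h. The commutation relation
evaluates it, with `T_h` supplying the derivative of `h` along `T`. -/
lemma star_R : star F.R = F.R := by
  have hh : F.Zb (F.Z F.h) = _ := F.comm_Zb_Z F.h
  rw [F.T_h] at hh
  simp only [R, oZ, star_add, star_sub, star_neg, star_mul', star_star, F.star_Z, F.star_Zb,
    F.star_hi, F.star_h, star_i, Derivation.leibniz, smul_eq_mul, map_sub, F.mul_deriv_hi] at hh ⊢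
  linear_combination F.hi * F.hi * hh + F.hi * F.i * F.h * (F.q + star F.q) * F.h_mul_hi

lemma star_box (f : A) : star (F.box f) = F.div (F.Z (star f)) := by
  simp only [box, div, nabla, nablaBar, star_add, star_sub, star_mul', star_star, F.star_Z,
    F.star_Zb, F.star_hi]
  simp

lemma star_lap {f : A} (hf : star f = f) : star (F.lap f) = F.lap f := by
  have := F.star_box f
  have h2 := congrArg star this
  simp only [star_star, hf] at this h2
  simp only [lap, star_neg, star_add, this, ← h2]
  ring


/-! ### Change of frame -/

/-- `G` is obtained from `F` by the change of frame `Z ↦ l Z`. -/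
structure FrameChange (F G : FrameAlgebra A) (l li : A) : Prop where
  l_mul_li : l * li = 1
  T_eq : ∀ f, G.T f = F.T f
  Z_eq : ∀ f, G.Z f = l * F.Z f

namespace FrameChange

variable {F} {G : FrameAlgebra A} {l li : A} (C : FrameChange F G l li)

include C

lemma Zb_eq (f : A) : G.Zb f = star l * F.Zb f := by
  have := congrArg star (C.Z_eq (star f))
  simpa only [star_mul', F.star_Z, G.star_Z, star_star] using this

lemma star_l : star l * star li = 1 := by
  rw [← star_mul', C.l_mul_li, star_one]

lemma deriv_li (D : Derivation ℂ A A) : D li = -(li * li * D l) := by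
  have := congrArg D C.l_mul_li
  simp only [Derivation.leibniz, smul_eq_mul, Derivation.map_one_eq_zero] at this
  linear_combination li * this - D li * C.l_mul_li

/-- Expand `[Zb, Z]` for the new frame in terms of the old one. The `T`-coefficient gives the law of
`h`; the `Z`-coefficient gives that of `p`, with the inhomogeneous term coming from the derivative
of `l`. -/
lemma structure_eq : G.h = l * star l * F.h ∧ G.p = star l * (F.p + li * F.Zb l) := by
  have key : ∀ f, (F.i * (G.h - l * star l * F.h)) * F.T f +
      (G.p * l - star l * (l * F.p + F.Zb l)) * F.Z f
      + (- star G.p * star l + l * (star l * star F.p + F.Z (star l))) * F.Zb f = 0 := by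
    intro f
    have e1 := G.comm_Zb_Z f
    simp only [C.Zb_eq, C.Z_eq, C.T_eq, Derivation.leibniz, smul_eq_mul, F.comm_Zb_Z] at e1
    have : G.i = F.i := rfl
    rw [this] at e1
    linear_combination -e1
  obtain ⟨h1, h2, -⟩ := F.indep _ _ _ key
  refine ⟨?_, ?_⟩
  · linear_combination -F.i * h1 + (G.h - l * star l * F.h) * F.i_sq
  · linear_combination li * h2 - (G.p - star l * F.p) * C.l_mul_li

lemma structure_eq' : G.q = F.q + li * F.T l ∧ G.hi * G.a * star l = l * F.hi * F.a := by
  have key : ∀ f, 0 * F.T f + (G.q * l - F.T l - l * F.q) * F.Z f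
      + (l * F.hi * F.a - G.hi * G.a * star l) * F.Zb f = 0 := by
    intro f
    have e1 := G.T_Z f
    simp only [C.Zb_eq, C.Z_eq, C.T_eq, Derivation.leibniz, smul_eq_mul, F.T_Z] at e1
    linear_combination -e1
  obtain ⟨-, h1, h2⟩ := F.indep _ _ _ key
  refine ⟨?_, ?_⟩
  · linear_combination li * h1 - (G.q - F.q) * C.l_mul_li
  · linear_combination -h2

/-- The next laws read off the separate components; with `oZ_eq` they say that the connection form
changes by l⁻¹ dl and that h₁₁̄ and A₁₁ are tensors. -/
lemma h_eq : G.h = l * star l * F.h := C.structure_eq.1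

lemma p_eq : G.p = star l * (F.p + li * F.Zb l) := C.structure_eq.2

lemma q_eq : G.q = F.q + li * F.T l := C.structure_eq'.1

lemma hi_eq : G.hi = li * star li * F.hi := by
  have h1 := G.h_mul_hi
  rw [C.h_eq] at h1
  have h2 := F.h_mul_hi
  have h3 := C.l_mul_li
  have h4 := C.star_l
  calc G.hi = (F.h * F.hi) * (l * li) * (star l * star li) * G.hi := by rw [h2, h3, h4]; ring
    _ = (l * star l * F.h * G.hi) * (li * star li * F.hi) := by ring
    _ = _ := by rw [h1, one_mul]

lemma a_eq : G.a = l * l * F.a := by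
  have h1 := C.structure_eq'.2
  rw [C.hi_eq] at h1
  have h2 := F.h_mul_hi
  have h3 := C.l_mul_li
  have h4 := C.star_l
  calc G.a = (F.h * F.hi) * (l * li) * (star l * star li) * G.a := by rw [h2, h3, h4]; ring
    _ = (li * star li * F.hi * G.a * star l) * l * F.h := by ring
    _ = l * F.hi * F.a * l * F.h := by rw [h1]
    _ = (F.h * F.hi) * (l * l * F.a) := by ring
    _ = _ := by rw [h2, one_mul]

lemma oZ_eq : G.oZ = l * (F.oZ + li * F.Z l) := by
  have h2 := F.h_mul_hi
  have h3 := C.l_mul_li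
  have h4 := C.star_l
  simp only [oZ, C.h_eq, C.hi_eq, C.p_eq, C.Z_eq, Derivation.leibniz, smul_eq_mul, star_mul',
    star_add, F.star_Zb, star_star]
  grind

/-- The component of a (1,0)-form scales by `l`, and the derivative of `l` is absorbed by the
inhomogeneous term of the connection. -/
lemma div_eq (t : A) : G.div (l * t) = F.div t := by
  have h3 := C.l_mul_li
  have h4 := C.star_l
  simp only [div, nablaBar, C.hi_eq, C.p_eq, C.Zb_eq, Derivation.leibniz, smul_eq_mul]
  push_cast
  grind

lemma box_eq (t : A) : G.box t = F.box t := by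
  have := congrArg star (C.div_eq (F.Z (star t)))
  rw [← C.Z_eq, ← F.star_box, ← G.star_box, star_star, star_star] at this
  exact this

lemma lap_eq (t : A) : G.lap t = F.lap t := by
  simp only [lap, C.box_eq, C.Z_eq, C.div_eq]

/-- The connection changes by l⁻¹ dl, which is closed, so its exterior derivative does not change;
`h6` is the symmetry of the second derivatives of `l` that this uses. -/
lemma R_eq : G.R = F.R := by
  have h2 := F.h_mul_hi
  have h3 := C.l_mul_li
  have h4 := C.star_l
  have : G.i = F.i := rfl
  have h5 : F.Z (star l) * star li + star l * F.Z (star li) = 0 := by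
    have := congrArg F.Z C.star_l
    simp only [Derivation.leibniz, smul_eq_mul, Derivation.map_one_eq_zero] at this
    linear_combination this
  have h6 := F.comm_Zb_Z l
  simp only [R, C.hi_eq, C.p_eq, C.Z_eq, C.Zb_eq, C.h_eq, C.q_eq, C.oZ_eq, Derivation.leibniz,
    smul_eq_mul, star_add, star_mul', F.star_Zb, star_star, map_add, C.deriv_li, this]
  rw [h6]
  -- After `h6` only a polynomial identity remains, modulo the inverse relations for `l`, its
  -- conjugate and `F.h`. The derivatives become independent atoms.
  generalize F.Z (F.Zb l) = x1
  generalize F.T l = x2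
  generalize F.Zb l = x3
  generalize F.Z l = x4
  generalize F.Z (star l) = x5 at *
  generalize F.oZ = x6
  generalize F.Zb x6 = x7
  generalize F.Z F.p = x8
  generalize F.p = x9
  generalize star x9 = x10
  generalize F.q = x11
  generalize F.i = x12
  generalize star l = m at *
  generalize star li = n at *
  grind

lemma divA_eq : G.divA = l * F.divA := by
  have h3 := C.l_mul_li
  have h4 := C.star_l
  simp only [divA, nablaBar, C.hi_eq, C.p_eq, C.Zb_eq, C.a_eq, Derivation.leibniz, smul_eq_mul]
  push_cast
  grind

lemma gradUp_eq (f : A) : G.hi * G.Zb f = li * (F.hi * F.Zb f) := by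
  rw [C.hi_eq, C.Zb_eq]
  linear_combination li * F.hi * F.Zb f * C.star_l

lemma W_eq : G.W = l * F.W := by
  have : G.i = F.i := rfl
  rw [W, W, C.R_eq, C.divA_eq, C.Z_eq, this]; ring

lemma PForm_eq (f : A) : G.PForm f = l * F.PForm f := by
  have : G.i = F.i := rfl
  rw [PForm, PForm, C.box_eq, C.Z_eq, this, C.gradUp_eq, C.a_eq]
  linear_combination l * F.i * F.a * (F.hi * F.Zb f) * C.l_mul_li

lemma a_grad_eq (f : A) : G.a * (G.hi * G.Zb f) = l * (F.a * (F.hi * F.Zb f)) := by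
  rw [C.gradUp_eq, C.a_eq]
  linear_combination l * F.a * (F.hi * F.Zb f) * C.l_mul_li

lemma divAGrad_eq (f : A) : G.divAGrad f = F.divAGrad f := by
  rw [divAGrad, C.a_grad_eq, C.div_eq, divAGrad]

lemma P4_eq (f : A) : G.P4 f = F.P4 f := by
  have : G.i = F.i := rfl
  simp only [P4, C.lap_eq, C.T_eq, C.divAGrad_eq, this]

lemma Q3_eq : G.Q3 = F.Q3 := by
  have : G.i = F.i := rfl
  simp only [Q3, C.lap_eq, C.R_eq, C.divA_eq, C.div_eq, this]

lemma grad_mul_eq (t f : A) : l * t * (G.hi * G.Zb f) = t * (F.hi * F.Zb f) := by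
  rw [C.gradUp_eq]
  linear_combination t * (F.hi * F.Zb f) * C.l_mul_li

lemma P4'_eq (f : A) : G.P4' f = F.P4' f := by
  have : G.i = F.i := rfl
  have h2 : F.R * (l * F.Z f) = l * (F.R * F.Z f) := by ring
  simp only [P4', C.lap_eq, C.divAGrad_eq, this, C.R_eq, C.W_eq, C.Z_eq, h2, C.div_eq, C.Q3_eq,
    C.grad_mul_eq]

lemma Q4'_eq : G.Q4' = F.Q4' := by
  have h1 : G.hi ^ 2 * G.a * star G.a = F.hi ^ 2 * F.a * star F.a := by
    rw [C.hi_eq, C.a_eq, star_mul', star_mul']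
    have e1 : (l * li) ^ 2 * (star l * star li) ^ 2 = 1 := by rw [C.l_mul_li, C.star_l]; ring
    linear_combination F.hi ^ 2 * F.a * star F.a * e1
  rw [Q4', Q4', C.lap_eq, C.R_eq, h1]

end FrameChange

end FrameAlgebra
end CR

/-! ### Unitary frames and conformal change: the transformation law as an algebraic identity. -/

namespace CR
namespace FrameAlgebra

set_option linter.unusedSimpArgs false
set_option linter.unusedSectionVars false

variable {A : Type*} [CommRing A] [StarRing A] [Algebra ℂ A] [StarModule ℂ A]
  {F : FrameAlgebra A}

@[simp] lemma deriv_two (D : Derivation ℂ A A) : D (2 : A) = 0 := D.map_natCast 2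

lemma star_two : star (2 : A) = 2 := star_ofNat 2

lemma hi_eq_one (h1 : F.h = 1) : F.hi = 1 := by
  have := F.h_mul_hi
  rwa [h1, one_mul] at this

lemma oZ_unitary (h1 : F.h = 1) : F.oZ = -star F.p := by
  simp [oZ, h1, hi_eq_one h1]

/-- The definition of the scalar curvature solved for ω(T). This is how curvature enters when `T` is
commuted past `Z`. -/
lemma q_unitary (h1 : F.h = 1) :
    F.i * F.q = F.R - F.Z F.p - F.Zb (star F.p) + 2 * F.p * star F.p := by
  simp only [R, oZ_unitary h1, hi_eq_one h1, h1, map_neg]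
  ring

/-- The connection form of a unitary frame is purely imaginary. -/
lemma star_q_unitary (h1 : F.h = 1) : star F.q = -F.q := by
  have := F.T_h
  rw [h1, Derivation.map_one_eq_zero] at this
  linear_combination -this

lemma T_p_unitary (h1 : F.h = 1) :
    F.T F.p = F.Zb F.q - F.p * F.q + F.Z (star F.a) - star F.p * star F.a := by
  rw [F.T_p, hi_eq_one h1, star_q_unitary h1, one_mul]
  ring

lemma T_star_p_unitary (h1 : F.h = 1) :
    F.T (star F.p) = -F.Z F.q + star F.p * F.q + F.Zb F.a - F.p * F.a := by
  have := congrArg star (T_p_unitary h1)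
  simp only [star_add, star_sub, star_mul', star_star, F.star_Z, F.star_Zb, F.star_T,
    star_q_unitary h1, map_neg] at this
  rw [this]; ring

/-- The Paneitz operator is 4 Re ∇^α P_α. Once all words in `T`, `Z`, `Zb` are put in one order, the
two sides differ only in T²f, which is settled by i² = -1, and in the derivatives of `p` and `star
p` along `T`, which the Bianchi identities evaluate. -/
lemma P4_eq_div (h1 : F.h = 1) {f : A} (hf : star f = f) :
    F.P4 f = 2 * (F.div (F.PForm f) + star (F.div (F.PForm f))) := by
  have hq := star_q_unitary h1
  have hi2 := F.i_sq
  have hTp := T_p_unitary h1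
  have hTpb := T_star_p_unitary h1
  simp only [P4, PForm, divAGrad, lap, box, div, nabla, nablaBar, oZ_unitary h1, hi_eq_one h1,
    Derivation.leibniz, smul_eq_mul, map_add, map_sub, map_neg, star_add, star_sub, star_neg,
    star_mul', star_star, F.star_Z, F.star_Zb, F.star_T, star_i, hf, one_mul, hq,
    F.comm_Zb_Z, F.comm_T_Zb, F.T_Z, h1, deriv_i, deriv_two, mul_one, Nat.cast_one, Nat.cast_zero, zero_mul,
    mul_zero, add_zero, zero_add]
  linear_combination F.T (F.T f) * hi2 - 2 * F.i * F.Z f * hTp + 2 * F.i * F.Zb f * hTpb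

/-- `G` is obtained from the unitary frame `F` by a conformal change `θ ↦ e^s θ` of the contact
form, with `E = e^s` and `Ei = e^{-s}`. -/
structure ConformalChange (F G : FrameAlgebra A) (s E Ei b : A) : Prop where
  h_eq_one : F.h = 1
  star_s : star s = s
  star_E : star E = E
  E_mul_Ei : E * Ei = 1
  Z_E : F.Z E = E * F.Z s
  T_eq : ∀ f, G.T f = Ei * F.T f + b * F.Z f + star b * F.Zb f
  Z_eq : ∀ f, G.Z f = F.Z f

namespace ConformalChange

variable {G : FrameAlgebra A} {s E Ei b : A} (C : ConformalChange F G s E Ei b)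

include C

lemma star_Ei : star Ei = Ei := by
  have h1 : E * star Ei = 1 := by
    have := congrArg star C.E_mul_Ei
    rwa [star_mul', C.star_E, star_one] at this
  linear_combination Ei * h1 - star Ei * C.E_mul_Ei

lemma Z_Ei : F.Z Ei = -(Ei * F.Z s) := by
  have := congrArg F.Z C.E_mul_Ei
  simp only [Derivation.leibniz, smul_eq_mul, Derivation.map_one_eq_zero, C.Z_E] at this
  linear_combination Ei * this - (F.Z Ei + Ei * F.Z s) * C.E_mul_Ei

lemma Zb_eq (f : A) : G.Zb f = F.Zb f := by
  have := congrArg star (C.Z_eq (star f))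
  simpa only [F.star_Z, G.star_Z, star_star] using this

lemma Zb_Ei : F.Zb Ei = -(Ei * F.Zb s) := by
  have := congrArg star C.Z_Ei
  simpa only [star_neg, star_mul', F.star_Z, C.star_s, C.star_Ei] using this

/-- The section `Z` is the same for both contact forms, so `[Zb, Z]` is one operator expanded in two
frames that differ only in the Reeb direction. -/
lemma structure_eq : G.h = E ∧ G.p = F.p - F.i * G.h * b := by
  have h1 := C.h_eq_one
  have key : ∀ f, (F.i * (1 - G.h * Ei)) * F.T f +
      (F.p - F.i * G.h * b - G.p) * F.Z f
      + (star G.p - F.i * G.h * star b - star F.p) * F.Zb f = 0 := by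
    intro f
    have e1 := G.comm_Zb_Z f
    simp only [C.Zb_eq, C.Z_eq, C.T_eq, F.comm_Zb_Z, h1] at e1
    have : G.i = F.i := rfl
    rw [this] at e1
    linear_combination e1
  obtain ⟨h1, h2, -⟩ := F.indep _ _ _ key
  refine ⟨?_, ?_⟩
  · linear_combination E * F.i * h1 + (E * G.h * Ei - E) * F.i_sq - G.h * C.E_mul_Ei
  · linear_combination -h2

lemma h_eq : G.h = E := C.structure_eq.1

lemma hi_eq : G.hi = Ei := by
  have h1 := G.h_mul_hi
  rw [C.h_eq] at h1
  linear_combination Ei * h1 - G.hi * C.E_mul_Ei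

/-- Compare `[T, Z]` in the two frames. It has no component along the Reeb field; for the new frame
this condition is the `T`-coefficient and determines `b`. The other two coefficients give the new
connection along `T` and the new torsion. -/
lemma structure_eq' : star b = F.i * Ei * F.Z s ∧
    G.q = Ei * F.q - F.Z b + star b * F.p ∧
    Ei * G.a = Ei * F.a + F.Z (star b) + star b * star F.p := by
  have h1 := C.h_eq_one
  have key : ∀ f, (Ei * F.Z s + F.i * star b) * F.T f
      + (Ei * F.q - F.Z b + star b * F.p - G.q) * F.Z f
      + (Ei * G.a - Ei * F.a - F.Z (star b) - star b * star F.p) * F.Zb f = 0 := by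
    intro f
    have e1 := G.T_Z f
    simp only [C.Zb_eq, C.Z_eq, C.T_eq, Derivation.leibniz, smul_eq_mul, F.T_Z, h1, C.hi_eq,
      F.comm_Zb_Z, map_add, hi_eq_one h1, C.Z_Ei] at e1
    linear_combination e1
  obtain ⟨h1, h2, h3⟩ := F.indep _ _ _ key
  refine ⟨?_, ?_, ?_⟩
  · linear_combination -F.i * h1 + star b * F.i_sq
  · linear_combination -h2
  · linear_combination h3

lemma star_b_eq : star b = F.i * Ei * F.Z s := C.structure_eq'.1

lemma b_eq : b = -(F.i * Ei * F.Zb s) := by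
  have := congrArg star C.star_b_eq
  simp only [star_star, star_mul', star_i, C.star_Ei, F.star_Z, C.star_s] at this
  rw [this]; ring

lemma p_eq : G.p = F.p - F.Zb s := by
  rw [C.structure_eq.2, C.h_eq, C.b_eq]
  linear_combination E * Ei * F.Zb s * F.i_sq - F.Zb s * C.E_mul_Ei

lemma oZ_eq : G.oZ = 2 * F.Z s - star F.p := by
  rw [oZ, C.hi_eq, C.h_eq, C.Z_eq, C.Z_E, C.p_eq, star_sub, F.star_Zb, C.star_s]
  linear_combination F.Z s * C.E_mul_Ei

lemma a_eq : G.a = F.a + F.i * (F.Z (F.Z s) + star F.p * F.Z s - F.Z s * F.Z s) := by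
  have := C.structure_eq'.2.2
  simp only [C.star_b_eq, Derivation.leibniz, smul_eq_mul, deriv_i, C.Z_Ei] at this
  linear_combination E * this - (G.a - F.a - F.i * (F.Z (F.Z s) + star F.p * F.Z s
    - F.Z s * F.Z s)) * C.E_mul_Ei

lemma q_eq : G.q = Ei * (F.q + F.i * (F.Z (F.Zb s) - F.Z s * F.Zb s + F.p * F.Z s)) := by
  rw [C.structure_eq'.2.1, C.star_b_eq, C.b_eq]
  simp only [Derivation.leibniz, smul_eq_mul, deriv_i, C.Z_Ei, map_neg]
  ring

/-- This is the equation behind the CR Yamabe problem. The frame kept here is no longer unitary for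
the new contact form, where h = e^σ, so the connection component along `Z` gains 2Zσ, against -Zbσ
for `p`. -/
lemma R_eq : G.R = Ei * (F.R + 2 * F.lap s - 2 * F.Z s * F.Zb s) := by
  have : G.i = F.i := rfl
  have h1 := C.h_eq_one
  have hi2 := F.i_sq
  have h2 := C.E_mul_Ei
  have h3 := q_unitary h1
  simp only [R, lap, div, box, nabla, nablaBar, C.hi_eq, C.h_eq, C.p_eq, C.Z_eq, C.Zb_eq, C.oZ_eq,
    C.q_eq, this, oZ_unitary h1, hi_eq_one h1, star_sub, F.star_Zb, C.star_s, map_sub,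
    Derivation.leibniz, smul_eq_mul, h1, F.comm_Zb_Z, map_neg, Nat.cast_one, Nat.cast_zero, deriv_two]
  linear_combination Ei ^ 2 * E * (F.Z (F.Zb s) + F.p * F.Z s - F.Z s * F.Zb s) * hi2
    + (Ei * F.i * F.q - Ei * (F.Z (F.Zb s) + F.p * F.Z s - F.Z s * F.Zb s)) * h2

lemma lap_eq (f : A) :
    G.lap f = Ei * (F.lap f - (F.Z s * F.Zb f + F.Zb s * F.Z f)) := by
  have h1 := C.h_eq_one
  simp only [lap, div, box, nabla, nablaBar, C.hi_eq, C.p_eq, C.Z_eq, C.Zb_eq, C.oZ_eq,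
    oZ_unitary h1, hi_eq_one h1, star_sub, F.star_Zb, C.star_s]
  push_cast
  ring

end ConformalChange

section Unitary

lemma lap_unitary (h1 : F.h = 1) (f : A) :
    F.lap f = -(2 * F.Z (F.Zb f) + F.i * F.T f + 2 * (- star F.p * F.Zb f)) := by
  simp only [lap, div, box, nabla, nablaBar, oZ_unitary h1, hi_eq_one h1, F.comm_Zb_Z, h1]
  push_cast
  ring

lemma lap_mul (h1 : F.h = 1) (u v : A) : F.lap (u * v) =
    u * F.lap v + v * F.lap u - 2 * (F.Z u * F.Zb v + F.Zb u * F.Z v) := by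
  simp only [lap_unitary h1, Derivation.leibniz, smul_eq_mul, map_add]
  ring

/-- The part of the law linear in s, multiplied by 6 to avoid fractions. Since `Q3` is -4 Re ∇^α
W_α, the zeroth-order terms 2·Q3·s + 6·Q3·s cancel against those of the divergence of `s * W`. The
remaining terms W_α∇^αs remove the divergence of the torsion produced by `divAGrad` and leave the
gradient of R. -/
lemma linear_terms (h1 : F.h = 1) {s : A} (hs : star s = s) :
    2 * F.P4' s + 16 * (F.div (s * F.W) + star (F.div (s * F.W))) + 6 * F.Q3 * s =
    6 * (4 * F.lap (F.lap s) + 2 * F.R * F.lap s + 2 * (F.Z s * F.Zb F.R + F.Zb s * F.Z F.R)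
      + 4 * F.i * (F.a * (F.Zb (F.Zb s) + F.p * F.Zb s)
        - star F.a * (F.Z (F.Z s) + star F.p * F.Z s))) := by
  have hR := F.star_R
  have h2 := F.i_sq
  -- The squared sublaplacian has the same coefficient 24 on both sides, so it need not be expanded.
  generalize h3 : F.lap (F.lap s) = x
  simp only [P4', h3, Q3]
  simp only [lap, divAGrad, divA, W, div, box, nabla, nablaBar, oZ_unitary h1, hi_eq_one h1,
    Derivation.leibniz, smul_eq_mul, map_add, map_sub, map_neg, star_add, star_sub, star_neg,
    star_mul', star_star, F.star_Z, F.star_Zb, F.star_T, star_i, hs, one_mul, hR,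
    F.comm_Zb_Z, h1, deriv_i, mul_one, Nat.cast_one, Nat.cast_zero, zero_mul,
    mul_zero, add_zero, zero_add]
  push_cast
  rw [star_two]
  ring

/-- A polarised Bochner formula. The undifferentiated factor s drops out of P₄(s²)/2 - sP₄(s),
leaving products of derivatives of s. Reordering derivatives produces ω(T), which `q_unitary` trades
for the term R|Zs|²; the square (Ts)² needs only i² = -1. -/
lemma quadratic_terms (h1 : F.h = 1) {s : A} (hs : star s = s) :
    3 * F.P4 (s * s) - 6 * (s * F.P4 s)
      - 48 * (F.hi * F.Zb s * F.PForm s + star (F.hi * F.Zb s * F.PForm s)) =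
    6 * (-4 * F.lap (F.Z s * F.Zb s) + 4 * (F.Z s * F.Zb (F.lap s) + F.Zb s * F.Z (F.lap s))
      - 4 * F.i * (F.a * F.Zb s ^ 2 - star F.a * F.Z s ^ 2)
      - 4 * (F.Z (F.Z s) + star F.p * F.Z s) * (F.Zb (F.Zb s) + F.p * F.Zb s)
      - 4 * F.R * F.Z s * F.Zb s) := by
  have hR := F.star_R
  have hq := star_q_unitary h1
  have h2 := F.i_sq
  have h3 := q_unitary h1
  simp only [P4, PForm, divAGrad, box, lap_mul h1, div, nabla, nablaBar, oZ_unitary h1, hi_eq_one h1,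
    Derivation.leibniz, smul_eq_mul, map_add, map_sub, map_neg, star_add, star_sub, star_neg,
    star_mul', star_star, F.star_Z, F.star_Zb, star_i, hs, one_mul, hq,
    F.comm_Zb_Z, F.comm_T_Zb, F.T_Z, h1, deriv_i, deriv_two, mul_one, Nat.cast_one, Nat.cast_zero, zero_mul,
    mul_zero, add_zero, zero_add]
  simp only [lap_unitary h1, Derivation.leibniz, smul_eq_mul, map_add, map_sub, map_neg,
    F.comm_Zb_Z, F.comm_T_Zb, F.T_Z, h1, hi_eq_one h1, hq, deriv_i, deriv_two, mul_one, mul_zero, add_zero, zero_add]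
  linear_combination -24 * F.Zb s * F.Z s * h3 + 6 * F.T s ^ 2 * h2

end Unitary

/-- The transformation law of `Q₄'`. -/
theorem ConformalChange.Q4'_eq {G : FrameAlgebra A} {s E Ei b : A}
    (C : ConformalChange F G s E Ei b) : 6 * (E ^ 2 * G.Q4') = 6 * F.Q4' + 2 * F.P4' s
    + 16 * (F.div (s * F.W) + star (F.div (s * F.W))) + 6 * F.Q3 * s + 3 * F.P4 (s * s)
    - 6 * (s * F.P4 s)
    - 48 * (F.hi * F.Zb s * F.PForm s + star (F.hi * F.Zb s * F.PForm s)) := by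
  have h1 := C.h_eq_one
  have h2 := C.E_mul_Ei
  have h3 := F.i_sq
  have hl := linear_terms h1 C.star_s
  have hq := quadratic_terms h1 C.star_s
  -- The new sublaplacian of the product e^{-s}·(…): the derivatives of `Ei` give the term with Δs
  -- and reverse the sign of the gradient pairing.
  have e1 : G.lap G.R = Ei * (Ei * (F.lap (F.R + 2 * F.lap s - 2 * F.Z s * F.Zb s)
      - (F.R + 2 * F.lap s - 2 * F.Z s * F.Zb s) * F.lap s
      + (F.Z s * F.Zb (F.R + 2 * F.lap s - 2 * F.Z s * F.Zb s)
      + F.Zb s * F.Z (F.R + 2 * F.lap s - 2 * F.Z s * F.Zb s)))) := by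
    have e2 : F.lap Ei = Ei * (-F.lap s - 2 * F.Z s * F.Zb s) := by
      simp only [lap, div, box, nabla, nablaBar, oZ_unitary h1, hi_eq_one h1, C.Z_Ei, C.Zb_Ei,
        Derivation.leibniz, smul_eq_mul, map_neg]
      ring
    rw [C.lap_eq, C.R_eq, lap_mul h1, e2, Derivation.leibniz, Derivation.leibniz, C.Z_Ei, C.Zb_Ei]
    simp only [smul_eq_mul]
    ring
  have e3 : F.lap (F.R + 2 * F.lap s - 2 * F.Z s * F.Zb s) =
      F.lap F.R + 2 * F.lap (F.lap s) - 2 * F.lap (F.Z s * F.Zb s) := by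
    simp only [lap_unitary h1, Derivation.leibniz, smul_eq_mul, map_add, map_sub, deriv_two, map_zero]
    ring
  -- Each of the three terms of Q₄' has conformal weight -2, so `E ^ 2` removes the exponentials
  -- altogether.
  have e4 : E ^ 2 * G.Q4' = 2 * (F.lap (F.R + 2 * F.lap s - 2 * F.Z s * F.Zb s)
      - (F.R + 2 * F.lap s - 2 * F.Z s * F.Zb s) * F.lap s
      + (F.Z s * F.Zb (F.R + 2 * F.lap s - 2 * F.Z s * F.Zb s)
      + F.Zb s * F.Z (F.R + 2 * F.lap s - 2 * F.Z s * F.Zb s))) - 4 * (G.a * star G.a)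
      + (F.R + 2 * F.lap s - 2 * F.Z s * F.Zb s) ^ 2 := by
    have h4 : E ^ 2 * Ei ^ 2 = 1 := by rw [← mul_pow, h2, one_pow]
    rw [Q4', e1, C.R_eq, C.hi_eq]
    linear_combination (2 * (F.lap (F.R + 2 * F.lap s - 2 * F.Z s * F.Zb s)
      - (F.R + 2 * F.lap s - 2 * F.Z s * F.Zb s) * F.lap s
      + (F.Z s * F.Zb (F.R + 2 * F.lap s - 2 * F.Z s * F.Zb s)
      + F.Zb s * F.Z (F.R + 2 * F.lap s - 2 * F.Z s * F.Zb s))) - 4 * (G.a * star G.a)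
      + (F.R + 2 * F.lap s - 2 * F.Z s * F.Zb s) ^ 2) * h4
  rw [e4, e3, C.a_eq, FrameAlgebra.Q4', hi_eq_one h1]
  rw [hi_eq_one h1] at hq
  simp only [one_mul] at hq ⊢
  have e5 : F.lap s = -(2 * F.Z (F.Zb s) + F.i * F.T s + 2 * (- star F.p * F.Zb s)) :=
    lap_unitary h1 s
  have e6 := F.comm_Zb_Z s
  rw [h1] at e6
  simp only [Derivation.leibniz, smul_eq_mul, map_add, map_sub, deriv_two, one_mul, star_add, star_sub,
    star_mul', star_i, F.star_Z, F.star_Zb, star_star, C.star_s] at hq ⊢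
  rw [e6]
  -- The parts of degree one and two are `hl` and `hq`. In degree four |Zs|⁴ cancels between |Â|²
  -- and R̂²; in degree three |Zs|²Δs survives with coefficient -24, and `e5` rewrites it to cancel
  -- the other cubic terms.
  linear_combination 24 * (F.Z (F.Z s) + star F.p * F.Z s - F.Z s * F.Z s)
    * (F.Zb (F.Zb s) + F.p * F.Zb s - F.Zb s * F.Zb s) * h3 - 24 * F.Z s * F.Zb s * e5 - hl - hq

end FrameAlgebra
end CR

/-! ### Calculus of vector fields and one-forms on a 3-manifold. -/

namespace CR

open Set Filter Topology

noncomputable section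

set_option linter.unusedSectionVars false

variable {M : Type*} [TopologicalSpace M] [ChartedSpace E3 M]
  {F : Type*} [NormedAddCommGroup F] [NormedSpace ℝ F]

/-- Smoothness of a function on a set. -/
abbrev SmoothOn (f : M → F) (U : Set M) : Prop := ContMDiffOn (𝓡 3) 𝓘(ℝ, F) ∞ f U

lemma SmoothOn.mdifferentiableAt {f : M → F} {U : Set M} (hf : SmoothOn f U) (hU : IsOpen U)
    {x : M} (hx : x ∈ U) : MDifferentiableAt (𝓡 3) 𝓘(ℝ, F) f x :=
  (hf.contMDiffAt (hU.mem_nhds hx)).mdifferentiableAt (by simp)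

lemma dir_congr {V : VField M} {f g : M → F} {x : M} (h : f =ᶠ[𝓝 x] g) :
    dir V f x = dir V g x := by
  unfold dir
  rw [h.mfderiv_eq]
  rfl

lemma dir_const (V : VField M) (c : F) (x : M) : dir V (fun _ => c) x = 0 := by
  unfold dir
  rw [mfderiv_const]
  rfl

lemma dir_add (V : VField M) {f g : M → F} {x : M} (hf : MDifferentiableAt (𝓡 3) 𝓘(ℝ, F) f x)
    (hg : MDifferentiableAt (𝓡 3) 𝓘(ℝ, F) g x) :
    dir V (fun y => f y + g y) x = dir V f x + dir V g x := by
  have := (hf.hasMFDerivAt.add hg.hasMFDerivAt).mfderiv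
  unfold dir
  erw [this]
  rfl

lemma dir_mul {𝔸 : Type*} [NormedCommRing 𝔸] [NormedAlgebra ℝ 𝔸] (V : VField M) {f g : M → 𝔸}
    {x : M} (hf : MDifferentiableAt (𝓡 3) 𝓘(ℝ, 𝔸) f x)
    (hg : MDifferentiableAt (𝓡 3) 𝓘(ℝ, 𝔸) g x) :
    dir V (fun y => f y * g y) x = f x * dir V g x + g x * dir V f x := by
  have := (hf.hasMFDerivAt.mul hg.hasMFDerivAt).mfderiv
  unfold dir
  erw [this]
  rfl

lemma dir_clm_comp {G : Type*} [NormedAddCommGroup G] [NormedSpace ℝ G] (L : F →L[ℝ] G)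
    (V : VField M) {f : M → F} {x : M} (hf : MDifferentiableAt (𝓡 3) 𝓘(ℝ, F) f x) :
    dir V (fun y => L (f y)) x = L (dir V f x) := by
  have h1 : HasMFDerivAt 𝓘(ℝ, F) 𝓘(ℝ, G) L (f x) L := L.hasMFDerivAt
  have := (h1.comp x hf.hasMFDerivAt).mfderiv
  unfold dir
  erw [this]
  rfl

lemma dir_field_add (V W : VField M) (f : M → F) (x : M) :
    dir (fun y => V y + W y) f x = dir V f x + dir W f x := by
  unfold dir
  exact map_add (mfderiv (𝓡 3) 𝓘(ℝ, F) f x) (V x) (W x)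

lemma dir_field_smul (c : M → ℝ) (V : VField M) (f : M → F) (x : M) :
    dir (fun y => c y • V y) f x = c x • dir V f x := by
  unfold dir
  exact map_smul (mfderiv (𝓡 3) 𝓘(ℝ, F) f x) (c x) (V x)

lemma dir_field_neg (V : VField M) (f : M → F) (x : M) :
    dir (fun y => -V y) f x = -dir V f x := by
  unfold dir
  exact map_neg (mfderiv (𝓡 3) 𝓘(ℝ, F) f x) (V x)

variable [IsManifold (𝓡 3) ∞ M]

/-- The function V f is the fibre component of the tangent map of f composed with the section V. -/
lemma SmoothFieldOn.dir {V : VField M} {U : Set M} (hV : SmoothFieldOn V U) (hU : IsOpen U)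
    {f : M → F} (hf : SmoothOn f U) : SmoothOn (dir V f) U := by
  have h1 := hf.contMDiffOn_tangentMapWithin (m := ∞) (by simp) hU.uniqueMDiffOn
  have h2 := h1.comp hV (fun x hx => hx)
  have h3 := (contMDiff_snd_tangentBundle_modelSpace (n := ∞) F 𝓘(ℝ, F)).comp_contMDiffOn h2
  refine h3.congr fun x hx => ?_
  simp only [Function.comp, tangentMapWithin, CR.dir]
  rw [mfderivWithin_of_isOpen hU hx]

lemma SmoothFieldOn.smul {V : VField M} {U : Set M} (hV : SmoothFieldOn V U) {f : M → ℝ}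
    (hf : SmoothOn f U) : SmoothFieldOn (fun x => f x • V x) U :=
  ContMDiffOn.smul_section hf hV

lemma SmoothFieldOn.add {V W : VField M} {U : Set M} (hV : SmoothFieldOn V U)
    (hW : SmoothFieldOn W U) : SmoothFieldOn (fun x => V x + W x) U :=
  ContMDiffOn.add_section hV hW

lemma SmoothFieldOn.neg {V : VField M} {U : Set M} (hV : SmoothFieldOn V U) :
    SmoothFieldOn (fun x => -V x) U :=
  ContMDiffOn.neg_section hV

lemma SmoothFieldOn.mono {V : VField M} {U U' : Set M} (hV : SmoothFieldOn V U) (h : U' ⊆ U) :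
    SmoothFieldOn V U' := ContMDiffOn.mono hV h

lemma SmoothFieldOn.mdiffAt {V : VField M} {U : Set M} (hV : SmoothFieldOn V U) (hU : IsOpen U)
    {x : M} (hx : x ∈ U) :
    MDifferentiableAt (𝓡 3) (𝓡 3).tangent (fun x => (⟨x, V x⟩ : TangentBundle (𝓡 3) M)) x :=
  (ContMDiffOn.contMDiffAt hV (hU.mem_nhds hx)).mdifferentiableAt (by simp)

lemma SmoothFieldOn.bracket {V W : VField M} {U : Set M} (hV : SmoothFieldOn V U)
    (hW : SmoothFieldOn W U) (hU : IsOpen U) :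
    SmoothFieldOn (VectorField.mlieBracket (𝓡 3) V W) U := by
  have : IsManifold (𝓡 3) (minSmoothness ℝ 2) M :=
    IsManifold.of_le (n := ∞) (by rw [minSmoothness_of_isRCLikeNormedField]; norm_cast)
  have : IsManifold (𝓡 3) (((⊤ : ℕ∞) : WithTop ℕ∞) + 1) M := by
    simpa using (inferInstance : IsManifold (𝓡 3) ∞ M)
  intro x hx
  refine ContMDiffAt.contMDiffWithinAt ?_
  exact ContMDiffAt.mlieBracket_vectorField (n := ⊤) (m := ⊤)
    (ContMDiffOn.contMDiffAt hV (hU.mem_nhds hx)) (ContMDiffOn.contMDiffAt hW (hU.mem_nhds hx))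
    (by simp)

lemma dir_eq_fderiv {V : VField M} {f : M → F} {c x : M}
    (hx : x ∈ (extChartAt (𝓡 3) c).source) (hf : MDifferentiableAt (𝓡 3) 𝓘(ℝ, F) f x) :
    dir V f x = fderiv ℝ (f ∘ (extChartAt (𝓡 3) c).symm) (extChartAt (𝓡 3) c x)
      (mfderiv (𝓡 3) 𝓘(ℝ, E3) (extChartAt (𝓡 3) c) x (V x)) := by
  have hx' : x ∈ (chartAt E3 c).source := by rwa [extChartAt_source] at hx
  have h1 : f =ᶠ[𝓝 x] (f ∘ (extChartAt (𝓡 3) c).symm) ∘ extChartAt (𝓡 3) c := by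
    filter_upwards [extChartAt_source_mem_nhds' hx] with y hy
    simp only [Function.comp, (extChartAt (𝓡 3) c).left_inv hy]
  have h2 : MDifferentiableAt 𝓘(ℝ, E3) 𝓘(ℝ, F) (f ∘ (extChartAt (𝓡 3) c).symm)
      (extChartAt (𝓡 3) c x) := by
    refine MDifferentiableAt.comp (I' := 𝓡 3) _ ?_ ?_
    · rwa [(extChartAt (𝓡 3) c).left_inv hx]
    · have := mdifferentiableWithinAt_extChartAt_symm (I := 𝓡 3)
        ((extChartAt (𝓡 3) c).map_source hx)
      simpa [mdifferentiableWithinAt_univ] using this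
  have h3 := mfderiv_comp x h2 (mdifferentiableAt_extChartAt (I := 𝓡 3) hx')
  unfold dir
  rw [h1.mfderiv_eq, h3, mfderiv_eq_fderiv]
  rfl

lemma SmoothOn.contDiffOn_chart {f : M → F} {U : Set M} (hf : SmoothOn f U) (c : M) :
    ContDiffOn ℝ ∞ (f ∘ (extChartAt (𝓡 3) c).symm)
      ((extChartAt (𝓡 3) c).target ∩ (extChartAt (𝓡 3) c).symm ⁻¹' U) := by
  rw [← contMDiffOn_iff_contDiffOn]
  exact hf.comp ((contMDiffOn_extChartAt_symm c).mono inter_subset_left) (fun x hx => hx.2)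

/-- The bracket is defined by pulling back to a chart, so the claim is transported to E3: `key`
computes the pulled-back fields, and `rep` identifies derivatives along a field near x with flat
directional derivatives. The flat identity rests on symmetry of second derivatives. -/
lemma dir_bracket {V W : VField M} {U : Set M} (hV : SmoothFieldOn V U)
    (hW : SmoothFieldOn W U) (hU : IsOpen U) {f : M → F} (hf : SmoothOn f U) {x : M} (hx : x ∈ U) :
    dir (VectorField.mlieBracket (𝓡 3) V W) f x = dir V (dir W f) x - dir W (dir V f) x := by
  set φ := extChartAt (𝓡 3) x with hφ
  have hxs : x ∈ φ.source := mem_extChartAt_source x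
  have key : ∀ X : VField M, ∀ z ∈ φ.target,
      VectorField.mpullbackWithin 𝓘(ℝ, E3) (𝓡 3) φ.symm X (range (𝓡 3)) z =
        mfderiv (𝓡 3) 𝓘(ℝ, E3) φ (φ.symm z) (X (φ.symm z)) := by
    intro X z hz
    rw [VectorField.mpullbackWithin_apply]
    congr 1
    exact ContinuousLinearMap.inverse_eq
      (mfderivWithin_extChartAt_symm_comp_mfderiv_extChartAt hz)
      (mfderiv_extChartAt_comp_mfderivWithin_extChartAt_symm hz)
  have hO : IsOpen (φ.target ∩ φ.symm ⁻¹' U) :=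
    (continuousOn_extChartAt_symm x).isOpen_inter_preimage (isOpen_extChartAt_target x) hU
  have hxO : φ x ∈ φ.target ∩ φ.symm ⁻¹' U :=
    ⟨φ.map_source hxs, by simpa [φ.left_inv hxs] using hx⟩
  have hfO := SmoothOn.contDiffOn_chart hf x
  have rep : ∀ X : VField M, dir X f ∘ φ.symm =ᶠ[𝓝 (φ x)] fun z => fderiv ℝ (f ∘ φ.symm) z
      (VectorField.mpullbackWithin 𝓘(ℝ, E3) (𝓡 3) φ.symm X (range (𝓡 3)) z) := by
    intro X
    filter_upwards [hO.mem_nhds hxO] with z hz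
    simp only [Function.comp]
    rw [key X z hz.1, dir_eq_fderiv (φ.map_target hz.1) (hf.mdifferentiableAt hU hz.2),
      φ.right_inv hz.1]
  have smooth : ∀ X : VField M, SmoothFieldOn X U → DifferentiableAt ℝ
      (VectorField.mpullbackWithin 𝓘(ℝ, E3) (𝓡 3) φ.symm X (range (𝓡 3))) (φ x) := by
    intro X hX
    have h1 := (SmoothFieldOn.mdiffAt hX hU hx).mdifferentiableWithinAt (s := univ)
    have := h1.differentiableWithinAt_mpullbackWithin_vectorField
    exact this.differentiableAt (by simp)
  have h1 := VectorField.fderiv_apply_lieBracket (n := 2)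
    ((hfO.contDiffAt (hO.mem_nhds hxO)).of_le (by norm_cast)) (by simp)
    (smooth W hW) (smooth V hV)
  rw [dir_eq_fderiv hxs (hf.mdifferentiableAt hU hx),
    dir_eq_fderiv hxs ((hW.dir hU hf).mdifferentiableAt hU hx),
    dir_eq_fderiv hxs ((hV.dir hU hf).mdifferentiableAt hU hx), (rep W).fderiv_eq,
    (rep V).fderiv_eq]
  have k1 := key V (φ x) (φ.map_source hxs)
  have k2 := key W (φ x) (φ.map_source hxs)
  rw [k1, k2, φ.left_inv hxs] at h1
  rw [← h1]
  congr 1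
  rw [← VectorField.mlieBracketWithin_univ, VectorField.mlieBracketWithin_apply]
  have hinv : (mfderiv (𝓡 3) 𝓘(ℝ, E3) (extChartAt (𝓡 3) x) x).IsInvertible :=
    isInvertible_mfderiv_extChartAt hxs
  refine (hinv.inverse_apply_eq.mp rfl).symm.trans ?_
  rw [show (extChartAt (𝓡 3) x).symm ⁻¹' univ ∩ range (𝓡 3) = univ by simp]
  have e : ∀ (V W : E3 → E3) (z : E3), VectorField.lieBracketWithin ℝ V W univ z =
      VectorField.lieBracket ℝ V W z := fun V W z => by rw [VectorField.lieBracketWithin_univ]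
  exact e _ _ _

/-! ### Coordinate fields -/

/-- The coordinate vector fields of the chart at `c`. -/
def coordField (c : M) (k : Fin 3) : VField M := fun x =>
  mfderiv 𝓘(ℝ, E3) (𝓡 3) (extChartAt (𝓡 3) c).symm (extChartAt (𝓡 3) c x)
    (EuclideanSpace.single k (1 : ℝ))

/-- The components of a tangent vector in the chart at `c`. -/
def chartVec (c x : M) : TangentSpace (𝓡 3) x →L[ℝ] E3 :=
  mfderiv (𝓡 3) 𝓘(ℝ, E3) (extChartAt (𝓡 3) c) x

/-- The coordinate functions of the chart at `c`. -/
def coordFn (c : M) (k : Fin 3) (x : M) : ℝ := extChartAt (𝓡 3) c x k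

lemma isOpen_source (c : M) : IsOpen (extChartAt (𝓡 3) c).source := isOpen_extChartAt_source c

lemma smoothOn_extChartAt (c : M) :
    SmoothOn (F := E3) (extChartAt (𝓡 3) c) (extChartAt (𝓡 3) c).source := by
  rw [extChartAt_source]
  exact contMDiffOn_extChartAt

lemma smoothOn_coordFn (c : M) (k : Fin 3) :
    SmoothOn (coordFn c k) (extChartAt (𝓡 3) c).source :=
  (EuclideanSpace.proj k : E3 →L[ℝ] ℝ).contMDiff.comp_contMDiffOn
    (smoothOn_extChartAt c)

lemma smoothFieldOn_coordField (c : M) (k : Fin 3) :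
    SmoothFieldOn (coordField c k) (extChartAt (𝓡 3) c).source := by
  set φ := extChartAt (𝓡 3) c with hφ
  have hT : IsOpen φ.target := isOpen_extChartAt_target c
  have h1 := (contMDiffOn_extChartAt_symm (I := 𝓡 3) (n := ∞) c).contMDiffOn_tangentMapWithin
    (m := ∞) (by simp) hT.uniqueMDiffOn
  have h2 : ContMDiff 𝓘(ℝ, E3) 𝓘(ℝ, E3).tangent ∞
      (fun z : E3 => (⟨z, EuclideanSpace.single k (1 : ℝ)⟩ : TangentBundle 𝓘(ℝ, E3) E3)) :=
    contMDiff_vectorSpace_iff_contDiff.mpr contDiff_const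
  have h3 := h1.comp (h2.comp_contMDiffOn (smoothOn_extChartAt c))
    (fun x hx => φ.map_source hx)
  refine h3.congr fun x hx => ?_
  have aux : ∀ (y : M) (v : E3), y = x →
      (⟨x, v⟩ : TangentBundle (𝓡 3) M) = ⟨y, v⟩ := by
    rintro _ _ rfl; rfl
  simp only [Function.comp, tangentMapWithin, coordField]
  rw [mfderivWithin_of_isOpen hT (φ.map_source hx)]
  exact aux _ _ (φ.left_inv hx)

lemma mfderiv_symm_eq (c : M) (z : E3) :
    mfderiv 𝓘(ℝ, E3) (𝓡 3) (extChartAt (𝓡 3) c).symm z =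
    mfderivWithin 𝓘(ℝ, E3) (𝓡 3) (extChartAt (𝓡 3) c).symm (range (𝓡 3)) z := by
  have : range (𝓡 3) = univ := by simp
  rw [this, mfderivWithin_univ]

lemma chartVec_coordField {c x : M} (hx : x ∈ (extChartAt (𝓡 3) c).source) (k : Fin 3) :
    chartVec c x (coordField c k x) =
      EuclideanSpace.single k (1 : ℝ) := by
  have hz := (extChartAt (𝓡 3) c).map_source hx
  have h := mfderiv_extChartAt_comp_mfderivWithin_extChartAt_symm (I := 𝓡 3) hz
  rw [← mfderiv_symm_eq, (extChartAt (𝓡 3) c).left_inv hx] at h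
  exact DFunLike.congr_fun h (EuclideanSpace.single k (1 : ℝ))

lemma dir_coordField {f : M → F} {c x : M} (hx : x ∈ (extChartAt (𝓡 3) c).source)
    (hf : MDifferentiableAt (𝓡 3) 𝓘(ℝ, F) f x) (k : Fin 3) :
    dir (coordField c k) f x = fderiv ℝ (f ∘ (extChartAt (𝓡 3) c).symm) (extChartAt (𝓡 3) c x)
      (EuclideanSpace.single k (1 : ℝ)) := by
  rw [dir_eq_fderiv hx hf]
  exact congrArg _ (chartVec_coordField hx k)

lemma dir_coordFn (V : VField M) {c x : M} (hx : x ∈ (extChartAt (𝓡 3) c).source) (k : Fin 3) :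
    dir V (coordFn c k) x =
      chartVec c x (V x) k :=
  dir_clm_comp (EuclideanSpace.proj k : E3 →L[ℝ] ℝ) V
    ((smoothOn_extChartAt c).mdifferentiableAt (isOpen_source c) hx)

lemma dir_coordField_coordFn {c x : M} (hx : x ∈ (extChartAt (𝓡 3) c).source) (j k : Fin 3) :
    dir (coordField c j) (coordFn c k) x = if k = j then 1 else 0 := by
  rw [dir_coordFn _ hx, chartVec_coordField hx]
  simp

lemma eq_sum_coordField {c x : M} (hx : x ∈ (extChartAt (𝓡 3) c).source)
    (v : TangentSpace (𝓡 3) x) :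
    v = ∑ k, chartVec c x v k • coordField c k x := by
  set w : E3 := chartVec c x v with hw
  have hz := (extChartAt (𝓡 3) c).map_source hx
  have h := mfderivWithin_extChartAt_symm_comp_mfderiv_extChartAt' (I := 𝓡 3) hx
  rw [← mfderiv_symm_eq] at h
  have h2 : mfderiv 𝓘(ℝ, E3) (𝓡 3) (extChartAt (𝓡 3) c).symm (extChartAt (𝓡 3) c x) w = v :=
    DFunLike.congr_fun h v
  have h3 : w = ∑ k, w k • EuclideanSpace.single k (1 : ℝ) := by
    ext i
    fin_cases i <;> simp [Fin.sum_univ_three]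
  rw [← h2]
  conv_lhs => rw [h3]
  erw [map_sum]
  exact Finset.sum_congr rfl fun k _ => map_smul (mfderiv 𝓘(ℝ, E3) (𝓡 3)
    (extChartAt (𝓡 3) c).symm (extChartAt (𝓡 3) c x)) (w k) (EuclideanSpace.single k (1 : ℝ))

lemma field_eq_sum (V : VField M) {c x : M} (hx : x ∈ (extChartAt (𝓡 3) c).source) :
    V x = ∑ k, dir V (coordFn c k) x • coordField c k x := by
  simp only [dir_coordFn V hx]
  exact eq_sum_coordField hx (V x)

/-- A tangent vector is determined by its action on the coordinate functions, and the first
derivatives of these along coordinate fields are constant. -/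
lemma bracket_coordField {c x : M} (hx : x ∈ (extChartAt (𝓡 3) c).source) (j k : Fin 3) :
    VectorField.mlieBracket (𝓡 3) (coordField c j) (coordField c k) x = 0 := by
  rw [field_eq_sum (VectorField.mlieBracket (𝓡 3) (coordField c j) (coordField c k)) hx]
  refine Finset.sum_eq_zero fun l _ => ?_
  rw [dir_bracket (smoothFieldOn_coordField c j) (smoothFieldOn_coordField c k) (isOpen_source c)
    (smoothOn_coordFn c l) hx]
  have : ∀ i j : Fin 3, dir (coordField c i) (dir (coordField c j) (coordFn c l)) x = 0 := by
    intro i j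
    have h1 : dir (coordField c j) (coordFn c l) =ᶠ[𝓝 x] fun _ => if l = j then 1 else 0 := by
      filter_upwards [(isOpen_source c).mem_nhds hx] with y hy using dir_coordField_coordFn hy j l
    rw [dir_congr h1, dir_const]
  rw [this, this, sub_zero, zero_smul]

/-! ### Exterior derivatives -/

/-- A one-form is smooth if it maps smooth vector fields to smooth functions. -/
def SmoothForm (α : OneForm M ℝ) : Prop :=
  ∀ ⦃U : Set M⦄ ⦃V : VField M⦄, IsOpen U → SmoothFieldOn V U → SmoothOn (fun x => α x (V x)) U

lemma eventuallyEq_bracket {V V' W W' : VField M} {x : M} (hV : V =ᶠ[𝓝 x] V')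
    (hW : W =ᶠ[𝓝 x] W') : VectorField.mlieBracket (𝓡 3) V W x =
      VectorField.mlieBracket (𝓡 3) V' W' x :=
  hV.mlieBracket_vectorField_eq hW

lemma d_congr (α : OneForm M F) {V V' W W' : VField M} {x : M} (hV : V =ᶠ[𝓝 x] V')
    (hW : W =ᶠ[𝓝 x] W') : d α V W x = d α V' W' x := by
  have h1 : (fun y => α y (W y)) =ᶠ[𝓝 x] fun y => α y (W' y) := hW.mono fun y hy => by simp [hy]
  have h2 : (fun y => α y (V y)) =ᶠ[𝓝 x] fun y => α y (V' y) := hV.mono fun y hy => by simp [hy]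
  unfold d
  rw [dir_congr h1, dir_congr h2, eventuallyEq_bracket hV hW]
  simp only [dir, hV.self_of_nhds, hW.self_of_nhds]

lemma d_swap (α : OneForm M F) (V W : VField M) (x : M) : d α V W x = -d α W V x := by
  unfold d
  rw [VectorField.mlieBracket_swap_apply, map_neg]
  abel

lemma d_self (α : OneForm M F) (V : VField M) (x : M) : d α V V x = 0 := by
  simp [d]

lemma SmoothForm.d_smooth {α : OneForm M ℝ} (hα : SmoothForm α) {U : Set M} (hU : IsOpen U)
    {V W : VField M} (hV : SmoothFieldOn V U) (hW : SmoothFieldOn W U) :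
    SmoothOn (d α V W) U :=
  ((hV.dir hU (hα hU hW)).sub (hW.dir hU (hα hU hV))).sub (hα hU (hV.bracket hW hU))

lemma SmoothForm.d_add_left {α : OneForm M ℝ} (hα : SmoothForm α) {U : Set M} (hU : IsOpen U)
    {V V' W : VField M} (hV : SmoothFieldOn V U) (hV' : SmoothFieldOn V' U) {x : M} (hx : x ∈ U) :
    d α (fun y => V y + V' y) W x = d α V W x + d α V' W x := by
  have h1 := VectorField.mlieBracket_add_left (W := W) (hV.mdiffAt hU hx) (hV'.mdiffAt hU hx)
  have h2 := dir_add W ((hα hU hV).mdifferentiableAt hU hx) ((hα hU hV').mdifferentiableAt hU hx)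
  unfold d
  simp only [map_add]
  rw [dir_field_add, h2]
  erw [h1]
  rw [map_add]
  ring

lemma SmoothForm.d_smul_left {α : OneForm M ℝ} (hα : SmoothForm α) {U : Set M} (hU : IsOpen U)
    {V W : VField M} {f : M → ℝ} (hf : SmoothOn f U) (hV : SmoothFieldOn V U) {x : M}
    (hx : x ∈ U) : d α (fun y => f y • V y) W x = f x * d α V W x := by
  have h1 := VectorField.mlieBracket_smul_left (W := W) (hf.mdifferentiableAt hU hx)
    (hV.mdiffAt hU hx)
  have h2 := dir_mul W (hf.mdifferentiableAt hU hx) ((hα hU hV).mdifferentiableAt hU hx)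
  unfold d
  simp only [map_smul, smul_eq_mul]
  rw [dir_field_smul, h2]
  erw [h1]
  rw [map_add, map_smul, map_smul]
  have h3 : mvfderiv (𝓡 3) f x (W x) = dir W f x := rfl
  simp only [smul_eq_mul, h3]
  ring

/-- The exterior derivative of a one-form as a bilinear form on a tangent space. -/
def dAt (α : OneForm M ℝ) (x : M) (v w : TangentSpace (𝓡 3) x) : ℝ :=
  ∑ j, ∑ k, chartVec x x v j * chartVec x x w k * d α (coordField x j) (coordField x k) x

lemma dAt_add_left (α : OneForm M ℝ) (x : M) (v v' w : TangentSpace (𝓡 3) x) :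
    dAt α x (v + v') w = dAt α x v w + dAt α x v' w := by
  simp only [dAt, map_add, PiLp.add_apply, add_mul, Finset.sum_add_distrib]

lemma dAt_smul_left (α : OneForm M ℝ) (x : M) (c : ℝ) (v w : TangentSpace (𝓡 3) x) :
    dAt α x (c • v) w = c * dAt α x v w := by
  simp only [dAt, map_smul, PiLp.smul_apply, smul_eq_mul, Finset.mul_sum, mul_assoc]

lemma dAt_swap (α : OneForm M ℝ) (x : M) (v w : TangentSpace (𝓡 3) x) :
    dAt α x v w = -dAt α x w v := by
  simp only [dAt, ← Finset.sum_neg_distrib]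
  rw [Finset.sum_comm]
  refine Finset.sum_congr rfl fun j _ => Finset.sum_congr rfl fun k _ => ?_
  rw [d_swap]; ring

lemma dAt_add_right (α : OneForm M ℝ) (x : M) (v w w' : TangentSpace (𝓡 3) x) :
    dAt α x v (w + w') = dAt α x v w + dAt α x v w' := by
  rw [dAt_swap, dAt_add_left, dAt_swap, dAt_swap α x w' v]; ring

lemma dAt_smul_right (α : OneForm M ℝ) (x : M) (c : ℝ) (v w : TangentSpace (𝓡 3) x) :
    dAt α x v (c • w) = c * dAt α x v w := by
  rw [dAt_swap, dAt_smul_left, dAt_swap]; ring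

lemma dAt_self (α : OneForm M ℝ) (x : M) (v : TangentSpace (𝓡 3) x) : dAt α x v v = 0 := by
  have := dAt_swap α x v v
  linarith

/-- Expand `V` in coordinate fields near x; `d` is local and linear over functions in its first
slot, so only the values of the coefficients at x matter. -/
lemma SmoothForm.d_eq_sum_left {α : OneForm M ℝ} (hα : SmoothForm α) {U : Set M} (hU : IsOpen U)
    {V W : VField M} (hV : SmoothFieldOn V U) {x : M} (hx : x ∈ U) :
    d α V W x = ∑ j, chartVec x x (V x) j * d α (coordField x j) W x := by
  have hs := mem_extChartAt_source (I := 𝓡 3) x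
  have hO : IsOpen (U ∩ (extChartAt (𝓡 3) x).source) := hU.inter (isOpen_source x)
  have hxO : x ∈ U ∩ (extChartAt (𝓡 3) x).source := ⟨hx, hs⟩
  have hc : ∀ k, SmoothOn (dir V (coordFn x k)) (U ∩ (extChartAt (𝓡 3) x).source) := fun k =>
    (hV.mono inter_subset_left).dir hO ((smoothOn_coordFn x k).mono inter_subset_right)
  have hE : ∀ k, SmoothFieldOn (coordField x k) (U ∩ (extChartAt (𝓡 3) x).source) := fun k =>
    (smoothFieldOn_coordField x k).mono inter_subset_right
  have h1 : V =ᶠ[𝓝 x] fun y => dir V (coordFn x 0) y • coordField x 0 y +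
      dir V (coordFn x 1) y • coordField x 1 y + dir V (coordFn x 2) y • coordField x 2 y := by
    filter_upwards [(isOpen_source x).mem_nhds hs] with y hy
    rw [field_eq_sum V hy, Fin.sum_univ_three]
  have hcE : ∀ k, SmoothFieldOn (fun y => dir V (coordFn x k) y • coordField x k y)
      (U ∩ (extChartAt (𝓡 3) x).source) := fun k => (hE k).smul (hc k)
  rw [d_congr α h1 (EventuallyEq.refl _ W), hα.d_add_left hO ((hcE 0).add (hcE 1)) (hcE 2) hxO,
    hα.d_add_left hO (hcE 0) (hcE 1) hxO, hα.d_smul_left hO (hc 0) (hE 0) hxO,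
    hα.d_smul_left hO (hc 1) (hE 1) hxO, hα.d_smul_left hO (hc 2) (hE 2) hxO]
  simp only [dir_coordFn V hs, Fin.sum_univ_three]

/-- The exterior derivative of a smooth one-form is a tensor. -/
lemma SmoothForm.d_eq_dAt {α : OneForm M ℝ} (hα : SmoothForm α) {U : Set M} (hU : IsOpen U)
    {V W : VField M} (hV : SmoothFieldOn V U) (hW : SmoothFieldOn W U) {x : M} (hx : x ∈ U) :
    d α V W x = dAt α x (V x) (W x) := by
  rw [hα.d_eq_sum_left hU hV hx, dAt]
  refine Finset.sum_congr rfl fun j _ => ?_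
  rw [d_swap, hα.d_eq_sum_left hU hW hx, ← Finset.sum_neg_distrib, Finset.mul_sum]
  refine Finset.sum_congr rfl fun k _ => ?_
  rw [d_swap α (coordField x k)]
  ring

end
end CR

/-! ### Horizontal frames and the Reeb field. -/

namespace CR

open Set Filter Topology

noncomputable section

set_option linter.unusedSectionVars false

variable {M : Type*} [TopologicalSpace M] [ChartedSpace E3 M] [IsManifold (𝓡 3) ∞ M]
  {S : CRStructure M}

namespace ContactForm

variable (θ : ContactForm S) (F : S.Frame)

lemma smoothForm : SmoothForm θ.form := by
  intro U V hU hV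
  have h := (θ.smooth_form.contMDiffOn (s := U)).clm_bundle_apply hV
  intro x hx
  have h2 := (Bundle.contMDiffWithinAt_totalSpace.mp (h x hx)).2
  exact h2

lemma Y_mem {x : M} (hx : x ∈ F.U) : F.Y x ∈ S.H x := by
  rw [F.Y_eq x hx]
  exact Subtype.property _

lemma form_X {x : M} (hx : x ∈ F.U) : θ.form x (F.X x) = 0 :=
  (θ.ker_form x _).mpr (F.X_mem x hx)

lemma form_Y {x : M} (hx : x ∈ F.U) : θ.form x (F.Y x) = 0 :=
  (θ.ker_form x _).mpr (Y_mem F hx)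

/-- The Levi form `dθ(X, Y)`. -/
def levi (x : M) : ℝ := dAt θ.form x (F.X x) (F.Y x)

lemma levi_eq {x : M} (hx : x ∈ F.U) : d θ.form F.X F.Y x = θ.levi F x :=
  θ.smoothForm.d_eq_dAt F.isOpen_U F.smooth_X F.smooth_Y hx

lemma levi_pos' {x : M} (hx : x ∈ F.U) : 0 < θ.levi F x := by
  rw [← θ.levi_eq F hx]
  exact θ.levi_pos F x hx

lemma smoothOn_levi : SmoothOn (θ.levi F) F.U :=
  (θ.smoothForm.d_smooth F.isOpen_U F.smooth_X F.smooth_Y).congr fun _ hx => (θ.levi_eq F hx).symm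

/-- Pairing a linear relation between X and Y with Y, respectively X, under dθ isolates each
coefficient times the Levi form, which is positive. Hence X, Y are independent in a plane. -/
lemma exists_of_mem (θ : ContactForm S) (F : S.Frame) {x : M} (hx : x ∈ F.U) {v : TangentSpace (𝓡 3) x} (hv : v ∈ S.H x) :
    ∃ a b : ℝ, v = a • F.X x + b • F.Y x := by
  have hl := (θ.levi_pos' F hx).ne'
  let e : Fin 2 → S.H x := ![⟨F.X x, F.X_mem x hx⟩, ⟨F.Y x, Y_mem F hx⟩]
  have hli : LinearIndependent ℝ e := by
    rw [LinearIndependent.pair_iff]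
    intro s t hst
    have h1 : s • F.X x + t • F.Y x = 0 := congrArg Subtype.val hst
    have h2 := congrArg (fun u => dAt θ.form x u (F.Y x)) h1
    have h3 := congrArg (fun u => dAt θ.form x (F.X x) u) h1
    simp only [dAt_add_left, dAt_smul_left, dAt_self, dAt_add_right, dAt_smul_right] at h2 h3
    have z1 : dAt θ.form x 0 (F.Y x) = 0 := by simp [dAt]
    have z2 : dAt θ.form x (F.X x) 0 = 0 := by simp [dAt]
    rw [z1] at h2
    rw [z2] at h3
    change s * θ.levi F x + t * 0 = 0 at h2
    change s * 0 + t * θ.levi F x = 0 at h3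
    constructor
    · exact (mul_eq_zero.mp (by linarith : s * θ.levi F x = 0)).resolve_right hl
    · exact (mul_eq_zero.mp (by linarith : t * θ.levi F x = 0)).resolve_right hl
  have hspan := hli.span_eq_top_of_card_eq_finrank (by rw [S.finrank_H x]; rfl)
  have hv' : (⟨v, hv⟩ : S.H x) ∈ Submodule.span ℝ (range e) := by rw [hspan]; trivial
  rw [show range e = {⟨F.X x, F.X_mem x hx⟩, ⟨F.Y x, Y_mem F hx⟩} by
    simp [e, Matrix.range_cons, Set.pair_comm], Submodule.mem_span_pair] at hv'
  obtain ⟨a, b, h⟩ := hv'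
  exact ⟨a, b, (congrArg Subtype.val h).symm⟩

/-- The `X`-component of a tangent vector. -/
def cX (x : M) (v : TangentSpace (𝓡 3) x) : ℝ := dAt θ.form x v (F.Y x) / θ.levi F x

/-- The `Y`-component of a tangent vector. -/
def cY (x : M) (v : TangentSpace (𝓡 3) x) : ℝ := dAt θ.form x (F.X x) v / θ.levi F x

lemma eq_of_mem {x : M} (hx : x ∈ F.U) {v : TangentSpace (𝓡 3) x} (hv : v ∈ S.H x) :
    v = θ.cX F x v • F.X x + θ.cY F x v • F.Y x := by
  obtain ⟨a, b, h⟩ := θ.exists_of_mem F hx hv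
  have hl := (θ.levi_pos' F hx).ne'
  have h1 : θ.cX F x v = a := by
    rw [cX, h, dAt_add_left, dAt_smul_left, dAt_smul_left, dAt_self]
    change (a * θ.levi F x + b * 0) / θ.levi F x = a
    field_simp
    ring
  have h2 : θ.cY F x v = b := by
    rw [cY, h, dAt_add_right, dAt_smul_right, dAt_smul_right, dAt_self]
    change (a * 0 + b * θ.levi F x) / θ.levi F x = b
    field_simp
    ring
  rw [h1, h2]
  exact h

lemma exists_transverse (x : M) : ∃ v : TangentSpace (𝓡 3) x, θ.form x v ≠ 0 := by
  by_contra! h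
  have h1 : S.H x = ⊤ := by
    rw [eq_top_iff]
    exact fun v _ => (θ.ker_form x v).mp (h v)
  have h2 := S.finrank_H x
  rw [h1, finrank_top] at h2
  have h3 : Module.finrank ℝ (TangentSpace (𝓡 3) x) = 3 := by
    change Module.finrank ℝ E3 = 3
    simp
  omega

/-- The characterization of the Reeb vector at a point. -/
def IsReebAt (x : M) (v : TangentSpace (𝓡 3) x) : Prop :=
  θ.form x v = 1 ∧ ∀ w, dAt θ.form x v w = 0

/-- Such a v is transverse to H, so v, X, Y span the tangent space, and dθ(v, v) = 0. -/
lemma isReebAt_of_frame {x : M} (hx : x ∈ F.U) {v : TangentSpace (𝓡 3) x}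
    (h : θ.form x v = 1) (hX : dAt θ.form x v (F.X x) = 0) (hY : dAt θ.form x v (F.Y x) = 0) :
    θ.IsReebAt x v := by
  refine ⟨h, fun w => ?_⟩
  have hw : w - θ.form x w • v ∈ S.H x := by
    rw [← θ.ker_form]
    simp [h]
  have e := θ.eq_of_mem F hx hw
  rw [sub_eq_iff_eq_add] at e
  rw [e]
  simp only [dAt_add_right, dAt_smul_right, hX, hY, dAt_self]
  ring

variable {θ} in
lemma IsReebAt.unique {x : M} {v w : TangentSpace (𝓡 3) x} (hv : θ.IsReebAt x v)
    (hw : θ.IsReebAt x w) : v = w := by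
  obtain ⟨F, hx⟩ := S.exists_frame x
  have h : v - w ∈ S.H x := by
    rw [← θ.ker_form, map_sub, hv.1, hw.1, sub_self]
  have e := θ.eq_of_mem F hx h
  have h1 : ∀ u, dAt θ.form x (v - w) u = 0 := by
    intro u
    have : v - w = v + (-1 : ℝ) • w := by rw [neg_one_smul, sub_eq_add_neg]
    rw [this, dAt_add_left, dAt_smul_left, hv.2, hw.2]
    ring
  have h2 : θ.cX F x (v - w) = 0 := by rw [cX, h1, zero_div]
  have h3 : θ.cY F x (v - w) = 0 := by rw [cY, dAt_swap, h1, neg_zero, zero_div]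
  rw [h2, h3, zero_smul, zero_smul, add_zero, sub_eq_zero] at e
  exact e

/-- Some coordinate field is transverse to H near x. Normalise it by θ, then add the horizontal
field that cancels its dθ-pairings with X and Y; nondegeneracy of the Levi form makes this possible
with smooth coefficients. -/
lemma exists_local_reeb (x : M) : ∃ (U : Set M) (T : VField M), IsOpen U ∧ x ∈ U ∧
    SmoothFieldOn T U ∧ ∀ y ∈ U, θ.IsReebAt y (T y) := by
  obtain ⟨F, hxF⟩ := S.exists_frame x
  obtain ⟨v, hv⟩ := θ.exists_transverse x
  have hs := mem_extChartAt_source (I := 𝓡 3) x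
  obtain ⟨k, hk⟩ : ∃ k, θ.form x (coordField x k x) ≠ 0 := by
    by_contra! h
    apply hv
    rw [eq_sum_coordField hs v, map_sum]
    exact Finset.sum_eq_zero fun k _ => by rw [map_smul, h k, smul_zero]
  set U₀ := F.U ∩ (extChartAt (𝓡 3) x).source with hU₀
  have hO : IsOpen U₀ := F.isOpen_U.inter (isOpen_source x)
  have hE : SmoothFieldOn (coordField x k) U₀ :=
    (smoothFieldOn_coordField x k).mono inter_subset_right
  have hf := θ.smoothForm hO hE
  set U := U₀ ∩ (fun y => θ.form y (coordField x k y)) ⁻¹' {0}ᶜ with hU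
  have hOU : IsOpen U := hf.continuousOn.isOpen_inter_preimage hO isOpen_compl_singleton
  have hUF : U ⊆ F.U := inter_subset_left.trans inter_subset_left
  have hX : SmoothFieldOn F.X U := SmoothFieldOn.mono F.smooth_X hUF
  have hY : SmoothFieldOn F.Y U := SmoothFieldOn.mono F.smooth_Y hUF
  have hlevi : SmoothOn (θ.levi F) U := (θ.smoothOn_levi F).mono hUF
  have hl : ∀ y ∈ U, θ.levi F y ≠ 0 := fun y hy => (θ.levi_pos' F (hUF hy)).ne'
  let T₁ : VField M := fun y => (θ.form y (coordField x k y))⁻¹ • coordField x k y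
  have hT₁ : SmoothFieldOn T₁ U :=
    (hE.mono inter_subset_left).smul ((hf.mono inter_subset_left).inv₀ fun y hy => hy.2)
  let T : VField M := fun y => T₁ y + ((-(d θ.form T₁ F.Y y / θ.levi F y)) • F.X y +
    (d θ.form T₁ F.X y / θ.levi F y) • F.Y y)
  refine ⟨U, T, hOU, ⟨⟨hxF, hs⟩, hk⟩, ?_, ?_⟩
  · refine hT₁.add ((hX.smul ?_).add (hY.smul ?_))
    · exact ((θ.smoothForm.d_smooth hOU hT₁ hY).div₀ hlevi hl).neg
    · exact (θ.smoothForm.d_smooth hOU hT₁ hX).div₀ hlevi hl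
  · intro y hy
    have hyF := hUF hy
    refine θ.isReebAt_of_frame F hyF ?_ ?_ ?_
    · simp only [T, T₁, map_add, map_smul, θ.form_X F hyF, θ.form_Y F hyF, smul_eq_mul]
      rw [inv_mul_cancel₀ hy.2]
      ring
    · simp only [T, dAt_add_left, dAt_smul_left, dAt_self]
      rw [θ.smoothForm.d_eq_dAt hOU hT₁ hX hy, dAt_swap _ _ (F.Y y)]
      change _ + (_ + dAt θ.form y (T₁ y) (F.X y) / θ.levi F y * -θ.levi F y) = 0
      field_simp [hl y hy]
      ring
    · simp only [T, dAt_add_left, dAt_smul_left, dAt_self]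
      rw [θ.smoothForm.d_eq_dAt hOU hT₁ hY hy]
      change _ + (-(dAt θ.form y (T₁ y) (F.Y y) / θ.levi F y) * θ.levi F y + _) = 0
      field_simp [hl y hy]
      ring

/-- Local Reeb fields agree by pointwise uniqueness, so they glue to a global smooth one; existence
is what makes the `epsilon` choice meaningful. -/
lemma isReeb_reeb : θ.IsReeb θ.reeb := by
  have hex : ∃ T, θ.IsReeb T := by
    choose U T hU hxU hT hR using θ.exists_local_reeb
    have hTR : ∀ x, θ.IsReebAt x (T x x) := fun x => hR x x (hxU x)
    have hsm : SmoothFieldOn (fun x => T x x) univ := by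
      intro x _
      refine ContMDiffAt.contMDiffWithinAt ?_
      have h1 := ContMDiffOn.contMDiffAt (hT x) ((hU x).mem_nhds (hxU x))
      refine h1.congr_of_eventuallyEq ?_
      filter_upwards [(hU x).mem_nhds (hxU x)] with y hy
      rw [(hTR y).unique (hR x y hy)]
    refine ⟨fun x => T x x, hsm, fun x => (hTR x).1, fun V W hV hW x hx => ?_⟩
    rw [θ.smoothForm.d_eq_dAt hV (hsm.mono (subset_univ _)) hW hx]
    exact (hTR x).2 _
  unfold reeb
  exact @Classical.epsilon_spec _ θ.IsReeb hex

lemma smooth_reeb (U : Set M) : SmoothFieldOn θ.reeb U :=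
  SmoothFieldOn.mono θ.isReeb_reeb.1 (subset_univ _)

lemma form_reeb (x : M) : θ.form x (θ.reeb x) = 1 := θ.isReeb_reeb.2.1 x

lemma isReebAt_reeb (x : M) : θ.IsReebAt x (θ.reeb x) := by
  obtain ⟨F, hx⟩ := S.exists_frame x
  refine θ.isReebAt_of_frame F hx (θ.form_reeb x) ?_ ?_
  · rw [← θ.smoothForm.d_eq_dAt F.isOpen_U (θ.smooth_reeb _) F.smooth_X hx]
    exact θ.isReeb_reeb.2.2 _ _ F.isOpen_U F.smooth_X x hx
  · rw [← θ.smoothForm.d_eq_dAt F.isOpen_U (θ.smooth_reeb _) F.smooth_Y hx]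
    exact θ.isReeb_reeb.2.2 _ _ F.isOpen_U F.smooth_Y x hx

lemma dAt_reeb (x : M) (w : TangentSpace (𝓡 3) x) : dAt θ.form x (θ.reeb x) w = 0 :=
  (θ.isReebAt_reeb x).2 w

lemma decomp {x : M} (hx : x ∈ F.U) (v : TangentSpace (𝓡 3) x) :
    v = θ.form x v • θ.reeb x + (θ.cX F x v • F.X x + θ.cY F x v • F.Y x) := by
  have h : v - θ.form x v • θ.reeb x ∈ S.H x := by
    rw [← θ.ker_form]
    simp [θ.form_reeb]
  have e := θ.eq_of_mem F hx h
  have hT : v - θ.form x v • θ.reeb x = v + (-θ.form x v) • θ.reeb x := by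
    rw [neg_smul, sub_eq_add_neg]
  have h1 : θ.cX F x (v - θ.form x v • θ.reeb x) = θ.cX F x v := by
    rw [cX, cX, hT, dAt_add_left, dAt_smul_left, dAt_reeb]
    ring
  have h2 : θ.cY F x (v - θ.form x v • θ.reeb x) = θ.cY F x v := by
    rw [cY, cY, hT, dAt_add_right, dAt_smul_right, dAt_swap _ _ _ (θ.reeb x), dAt_reeb]
    ring
  rw [h1, h2, sub_eq_iff_eq_add] at e
  rw [add_comm]
  exact e

lemma smoothOn_cX {U : Set M} (hU : IsOpen U) (hUF : U ⊆ F.U) {V : VField M}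
    (hV : SmoothFieldOn V U) : SmoothOn (fun x => θ.cX F x (V x)) U := by
  have hY := SmoothFieldOn.mono F.smooth_Y hUF
  refine ((θ.smoothForm.d_smooth hU hV hY).congr fun x hx => ?_).div₀
    ((θ.smoothOn_levi F).mono hUF) fun y hy => (θ.levi_pos' F (hUF hy)).ne'
  exact (θ.smoothForm.d_eq_dAt hU hV hY hx).symm

lemma smoothOn_cY {U : Set M} (hU : IsOpen U) (hUF : U ⊆ F.U) {V : VField M}
    (hV : SmoothFieldOn V U) : SmoothOn (fun x => θ.cY F x (V x)) U := by
  have hX := SmoothFieldOn.mono F.smooth_X hUF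
  refine ((θ.smoothForm.d_smooth hU hX hV).congr fun x hx => ?_).div₀
    ((θ.smoothOn_levi F).mono hUF) fun y hy => (θ.levi_pos' F (hUF hy)).ne'
  exact (θ.smoothForm.d_eq_dAt hU hX hV hx).symm

end ContactForm

end
end CR

/-! ### Smooth complex functions on an open set, and their derivations. -/

namespace CR

open Set Filter Topology

noncomputable section

set_option linter.unusedSectionVars false

variable {M : Type*} [TopologicalSpace M] [ChartedSpace E3 M]

lemma SmoothOn.mul {𝔸 : Type*} [NormedCommRing 𝔸] [NormedAlgebra ℝ 𝔸] {f g : M → 𝔸} {U : Set M}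
    (hf : SmoothOn f U) (hg : SmoothOn g U) : SmoothOn (fun x => f x * g x) U :=
  ContMDiffOn.clm_apply
    ((ContinuousLinearMap.mul ℝ 𝔸).contMDiff.comp_contMDiffOn hf) hg

/-! ### The algebra of smooth functions on an open set -/

/-- Extension by zero. -/
def extendZero {U : Set M} (f : U → ℂ) (x : M) : ℂ :=
  open scoped Classical in if h : x ∈ U then f ⟨x, h⟩ else 0

lemma extendZero_apply {U : Set M} (f : U → ℂ) {x : M} (hx : x ∈ U) :
    extendZero f x = f ⟨x, hx⟩ := by
  simp [extendZero, hx]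

/-- The algebra of smooth complex functions on a set. -/
def SmoothAlg (U : Set M) : StarSubalgebra ℂ (U → ℂ) where
  carrier := {f | SmoothOn (extendZero f) U}
  mul_mem' {f g} hf hg := (SmoothOn.mul hf hg).congr fun x hx => by
    simp [extendZero_apply _ hx]
  add_mem' {f g} hf hg := (ContMDiffOn.add hf hg).congr fun x hx => by
    simp [extendZero_apply _ hx]
  algebraMap_mem' c := (contMDiffOn_const (c := c)).congr fun x hx => by
    simp [extendZero_apply _ hx, Pi.algebraMap_apply]
  star_mem' {f} hf := (Complex.conjCLE.toContinuousLinearMap.contMDiff.comp_contMDiffOn hf).congr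
    fun x hx => by simp [extendZero_apply _ hx]

namespace SmoothAlg

variable {U : Set M}

/-- Restriction of a smooth function. -/
def mk (g : M → ℂ) (hg : SmoothOn g U) : SmoothAlg U :=
  ⟨fun x => g x, hg.congr fun x hx => by simp [extendZero_apply _ hx]⟩

/-- The values of an element of the algebra, extended by zero. -/
def ev (a : SmoothAlg U) : M → ℂ := extendZero a.1

lemma smooth_ev (a : SmoothAlg U) : SmoothOn (ev a) U := a.2

lemma ev_mk (g : M → ℂ) (hg : SmoothOn g U) {x : M} (hx : x ∈ U) : ev (mk g hg) x = g x := by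
  simp [ev, mk, extendZero_apply _ hx]

/-- Differential operators act on functions on all of M, and the extension by zero is arbitrary off
U; every identity in the algebra is therefore checked on values at points of U. -/
lemma ext_ev {a b : SmoothAlg U} (h : ∀ x ∈ U, ev a x = ev b x) : a = b := by
  refine Subtype.ext (funext fun x => ?_)
  have := h x x.2
  simpa [ev, extendZero_apply _ x.2] using this

lemma ev_add (a b : SmoothAlg U) {x : M} (hx : x ∈ U) :
    ev (a + b) x = ev a x + ev b x := by simp [ev, extendZero_apply _ hx]

lemma ev_sub (a b : SmoothAlg U) {x : M} (hx : x ∈ U) :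
    ev (a - b) x = ev a x - ev b x := by simp [ev, extendZero_apply _ hx]

lemma ev_neg (a : SmoothAlg U) {x : M} (hx : x ∈ U) :
    ev (-a) x = -ev a x := by simp [ev, extendZero_apply _ hx]

lemma ev_mul (a b : SmoothAlg U) {x : M} (hx : x ∈ U) :
    ev (a * b) x = ev a x * ev b x := by simp [ev, extendZero_apply _ hx]

lemma ev_star (a : SmoothAlg U) {x : M} (hx : x ∈ U) :
    ev (star a) x = star (ev a x) := by simp [ev, extendZero_apply _ hx]

lemma ev_algebraMap (c : ℂ) {x : M} (hx : x ∈ U) :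
    ev (algebraMap ℂ (SmoothAlg U) c) x = c := by
  simp [ev, extendZero_apply _ hx, Pi.algebraMap_apply]

lemma ev_one {x : M} (hx : x ∈ U) : ev (1 : SmoothAlg U) x = 1 := by
  simp [ev, extendZero_apply _ hx]

lemma ev_zero {x : M} (hx : x ∈ U) : ev (0 : SmoothAlg U) x = 0 := by
  simp [ev, extendZero_apply _ hx]

lemma ev_smul (c : ℂ) (a : SmoothAlg U) {x : M} (hx : x ∈ U) :
    ev (c • a) x = c * ev a x := by
  simp [ev, extendZero_apply _ hx]

lemma ev_natCast (n : ℕ) {x : M} (hx : x ∈ U) : ev (n : SmoothAlg U) x = n := by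
  simp [ev, extendZero_apply _ hx]

lemma ev_ofNat (n : ℕ) [n.AtLeastTwo] {x : M} (hx : x ∈ U) :
    ev (OfNat.ofNat n : SmoothAlg U) x = OfNat.ofNat n := by
  rw [← Nat.cast_ofNat, ev_natCast _ hx, Nat.cast_ofNat]

lemma ev_pow (a : SmoothAlg U) (n : ℕ) {x : M} (hx : x ∈ U) : ev (a ^ n) x = ev a x ^ n := by
  simp [ev, extendZero_apply _ hx]

end SmoothAlg

lemma dirC_congr {W : CField M} {f g : M → ℂ} {x : M} (h : f =ᶠ[𝓝 x] g) :
    dirC W f x = dirC W g x := by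
  unfold dirC
  rw [dir_congr h, dir_congr h]

lemma dirC_congr_on {W : CField M} {f g : M → ℂ} {U : Set M} (hU : IsOpen U)
    (h : ∀ y ∈ U, f y = g y) {x : M} (hx : x ∈ U) : dirC W f x = dirC W g x :=
  dirC_congr (by filter_upwards [hU.mem_nhds hx] with y hy using h y hy)

lemma dirC_add (W : CField M) {f g : M → ℂ} {x : M}
    (hf : MDifferentiableAt (𝓡 3) 𝓘(ℝ, ℂ) f x) (hg : MDifferentiableAt (𝓡 3) 𝓘(ℝ, ℂ) g x) :
    dirC W (fun y => f y + g y) x = dirC W f x + dirC W g x := by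
  unfold dirC
  rw [dir_add _ hf hg, dir_add _ hf hg]
  ring

lemma dirC_mul (W : CField M) {f g : M → ℂ} {x : M}
    (hf : MDifferentiableAt (𝓡 3) 𝓘(ℝ, ℂ) f x) (hg : MDifferentiableAt (𝓡 3) 𝓘(ℝ, ℂ) g x) :
    dirC W (fun y => f y * g y) x = f x * dirC W g x + g x * dirC W f x := by
  unfold dirC
  rw [dir_mul _ hf hg, dir_mul _ hf hg]
  ring

lemma dirC_const (W : CField M) (c : ℂ) (x : M) : dirC W (fun _ => c) x = 0 := by
  simp [dirC, dir_const]

lemma dir_star (V : VField M) {f : M → ℂ} {x : M} (hf : MDifferentiableAt (𝓡 3) 𝓘(ℝ, ℂ) f x) :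
    dir V (fun y => star (f y)) x = star (dir V f x) :=
  dir_clm_comp Complex.conjCLE.toContinuousLinearMap V hf

lemma dir_ofReal (V : VField M) {f : M → ℝ} {x : M} (hf : MDifferentiableAt (𝓡 3) 𝓘(ℝ, ℝ) f x) :
    dir V (fun y => (f y : ℂ)) x = ((dir V f x : ℝ) : ℂ) :=
  dir_clm_comp Complex.ofRealCLM V hf

lemma SmoothOn.ofReal {f : M → ℝ} {U : Set M} (hf : SmoothOn f U) :
    SmoothOn (fun x => (f x : ℂ)) U := Complex.ofRealCLM.contMDiff.comp_contMDiffOn hf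

lemma SmoothOn.star {f : M → ℂ} {U : Set M} (hf : SmoothOn f U) :
    SmoothOn (fun x => Star.star (f x)) U :=
  Complex.conjCLE.toContinuousLinearMap.contMDiff.comp_contMDiffOn hf

lemma SmoothOn.re {f : M → ℂ} {U : Set M} (hf : SmoothOn f U) :
    SmoothOn (fun x => (f x).re) U := Complex.reCLM.contMDiff.comp_contMDiffOn hf

variable [IsManifold (𝓡 3) ∞ M]

/-- Smoothness of a complex vector field. -/
structure CField.SmoothOn (W : CField M) (U : Set M) : Prop where
  isOpen : IsOpen U
  re : SmoothFieldOn W.re U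
  im : SmoothFieldOn W.im U

lemma CField.SmoothOn.smooth_dirC {W : CField M} {U : Set M} (hW : W.SmoothOn U) {f : M → ℂ}
    (hf : CR.SmoothOn f U) : CR.SmoothOn (dirC W f) U :=
  (hW.re.dir hW.isOpen hf).add (SmoothOn.mul contMDiffOn_const (hW.im.dir hW.isOpen hf))

/-- The derivation of the algebra of smooth functions given by a complex vector field. -/
def CField.SmoothOn.derivation {W : CField M} {U : Set M} (hW : W.SmoothOn U) :
    Derivation ℂ (SmoothAlg U) (SmoothAlg U) :=
  have hd : ∀ (a : SmoothAlg U) {x : M}, x ∈ U → MDifferentiableAt (𝓡 3) 𝓘(ℝ, ℂ) (SmoothAlg.ev a) x :=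
    fun a _ hx => (SmoothAlg.smooth_ev a).mdifferentiableAt hW.isOpen hx
  Derivation.mk'
    { toFun := fun a => SmoothAlg.mk (dirC W (SmoothAlg.ev a))
        (hW.smooth_dirC (SmoothAlg.smooth_ev a))
      map_add' := fun a b => SmoothAlg.ext_ev fun x hx => by
        rw [SmoothAlg.ev_add _ _ hx, SmoothAlg.ev_mk _ _ hx, SmoothAlg.ev_mk _ _ hx,
          SmoothAlg.ev_mk _ _ hx, ← dirC_add W (hd a hx) (hd b hx)]
        exact dirC_congr_on hW.isOpen (fun y hy => SmoothAlg.ev_add a b hy) hx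
      map_smul' := fun c a => SmoothAlg.ext_ev fun x hx => by
        rw [RingHom.id_apply, SmoothAlg.ev_smul _ _ hx, SmoothAlg.ev_mk _ _ hx,
          SmoothAlg.ev_mk _ _ hx, dirC_congr_on hW.isOpen (fun y hy => SmoothAlg.ev_smul c a hy) hx,
          dirC_mul W mdifferentiableAt_const (hd a hx), dirC_const]
        ring }
    fun a b => SmoothAlg.ext_ev fun x hx => by
      have hmk : ∀ (c : SmoothAlg U), SmoothAlg.ev (SmoothAlg.mk (dirC W (SmoothAlg.ev c))
          (hW.smooth_dirC (SmoothAlg.smooth_ev c))) x = dirC W (SmoothAlg.ev c) x :=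
        fun c => SmoothAlg.ev_mk _ (hW.smooth_dirC (SmoothAlg.smooth_ev c)) hx
      rw [smul_eq_mul, smul_eq_mul, SmoothAlg.ev_add _ _ hx, SmoothAlg.ev_mul _ _ hx,
        SmoothAlg.ev_mul _ _ hx]
      refine (hmk (a * b)).trans (Eq.trans ?_ (congrArg₂ (· + ·)
        (congrArg (SmoothAlg.ev a x * ·) (hmk b).symm)
        (congrArg (SmoothAlg.ev b x * ·) (hmk a).symm)))
      rw [← dirC_mul W (hd a hx) (hd b hx)]
      exact dirC_congr_on hW.isOpen (fun y hy => SmoothAlg.ev_mul a b hy) hx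

lemma CField.SmoothOn.ev_derivation {W : CField M} {U : Set M} (hW : W.SmoothOn U)
    (a : SmoothAlg U) {x : M} (hx : x ∈ U) :
    SmoothAlg.ev (hW.derivation a) x = CR.dirC W (SmoothAlg.ev a) x :=
  SmoothAlg.ev_mk (dirC W (SmoothAlg.ev a)) (hW.smooth_dirC (SmoothAlg.smooth_ev a)) hx

end
end CR

/-! ### Brackets of a local frame and the frame algebra they define. -/

namespace CR

open Set Filter Topology

noncomputable section

set_option linter.unusedSectionVars false

variable {M : Type*} [TopologicalSpace M] [ChartedSpace E3 M] [IsManifold (𝓡 3) ∞ M]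

section d

variable {F : Type*} [NormedAddCommGroup F] [NormedSpace ℝ F]

lemma d_neg_left (α : OneForm M F) {V : VField M} (W : VField M) {U : Set M} (hU : IsOpen U)
    (hV : SmoothFieldOn V U) {x : M} (hx : x ∈ U) :
    d α (fun y => -V y) W x = -d α V W x := by
  have h1 := VectorField.mlieBracket_const_smul_left (W := W) (c := (-1 : ℝ)) (hV.mdiffAt hU hx)
  have e : ((-1 : ℝ) • V) = fun y => -V y := by
    funext y
    exact neg_one_smul ℝ (V y)
  rw [e, neg_one_smul] at h1
  have h2 : dir W (fun y => α y (-V y)) x = -dir W (fun y => α y (V y)) x := by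
    simp only [map_neg]
    unfold dir
    rw [show (fun y => -α y (V y)) = -(fun y => α y (V y)) from rfl, mfderiv_neg]
    rfl
  unfold d
  rw [h1, h2, dir_field_neg, map_neg]
  abel

lemma d_zero_left (α : OneForm M F) (W : VField M) (x : M) : d α (fun _ => 0) W x = 0 := by
  have h := congrFun (VectorField.mlieBracket_zero_left (I := 𝓡 3) (W := W)) x
  change VectorField.mlieBracket (𝓡 3) (fun _ => 0) W x = 0 at h
  unfold d
  rw [h]
  simp only [map_zero]
  rw [dir_const]
  have h0 : dir (fun _ => 0) (fun y => α y (W y)) x = 0 :=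
    map_zero (mfderiv (𝓡 3) 𝓘(ℝ, F) (fun y => α y (W y)) x)
  rw [h0]
  abel

lemma d_of_const (α : OneForm M F) {V W : VField M} {U : Set M} (hU : IsOpen U) {a b : F}
    (hV : ∀ x ∈ U, α x (V x) = a) (hW : ∀ x ∈ U, α x (W x) = b) {x : M} (hx : x ∈ U) :
    d α V W x = -α x (VectorField.mlieBracket (𝓡 3) V W x) := by
  have h1 : (fun y => α y (V y)) =ᶠ[𝓝 x] fun _ => a := by
    filter_upwards [hU.mem_nhds hx] with y hy using hV y hy
  have h2 : (fun y => α y (W y)) =ᶠ[𝓝 x] fun _ => b := by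
    filter_upwards [hU.mem_nhds hx] with y hy using hW y hy
  unfold d
  rw [dir_congr h1, dir_congr h2, dir_const, dir_const]
  abel

end d

variable {S : CRStructure M}

namespace ContactForm

variable (θ : ContactForm S) (F : S.Frame)

lemma dC_Z_Zbar (α : OneForm M ℂ) {x : M} (hx : x ∈ F.U) :
    dC α F.Z F.Zbar x = 2 * Complex.I * d α F.X F.Y x := by
  simp only [dC, LocalFrame.Z, LocalFrame.Zbar, d_self]
  rw [d_neg_left α _ F.isOpen_U F.smooth_Y hx, d_neg_left α _ F.isOpen_U F.smooth_Y hx, d_self,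
    d_swap α F.Y F.X]
  ring

lemma dC_T_Z (α : OneForm M ℂ) {x : M} (hx : x ∈ F.U) :
    dC α θ.T F.Z x = d α θ.reeb F.X x - Complex.I * d α θ.reeb F.Y x := by
  simp only [dC, LocalFrame.Z, T, CField.ofReal]
  rw [d_swap α θ.reeb (fun y => -F.Y y), d_neg_left α _ F.isOpen_U F.smooth_Y hx,
    d_swap α F.Y, d_zero_left, d_zero_left]
  ring

lemma dC_T_Zbar (α : OneForm M ℂ) (x : M) :
    dC α θ.T F.Zbar x = d α θ.reeb F.X x + Complex.I * d α θ.reeb F.Y x := by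
  simp only [dC, LocalFrame.Zbar, T, CField.ofReal]
  rw [d_zero_left, d_zero_left]
  ring

/-- The coframe in terms of the real frame. -/
def coframeAux (x : M) : TangentSpace (𝓡 3) x →L[ℝ] ℂ :=
  haveI : FiniteDimensional ℝ (TangentSpace (𝓡 3) x) := inferInstanceAs (FiniteDimensional ℝ E3)
  haveI : T2Space (TangentSpace (𝓡 3) x) := inferInstanceAs (T2Space E3)
  LinearMap.toContinuousLinearMap
  { toFun := fun v => ((θ.cX F x v : ℂ) + Complex.I * (θ.cY F x v : ℂ)) / 2
    map_add' := fun v w => by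
      simp only [cX, cY, dAt_add_left, dAt_add_right]
      push_cast
      ring
    map_smul' := fun c v => by
      simp only [cX, cY, dAt_smul_left, dAt_smul_right, RingHom.id_apply, Complex.real_smul]
      push_cast
      ring }

lemma coframeAux_apply (x : M) (v : TangentSpace (𝓡 3) x) : θ.coframeAux F x v =
    ((θ.cX F x v : ℂ) + Complex.I * (θ.cY F x v : ℂ)) / 2 := rfl

lemma cX_X {x : M} (hx : x ∈ F.U) : θ.cX F x (F.X x) = 1 := div_self (θ.levi_pos' F hx).ne'

lemma cX_Y (x : M) : θ.cX F x (F.Y x) = 0 := by rw [cX, dAt_self, zero_div]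

lemma cX_reeb (x : M) : θ.cX F x (θ.reeb x) = 0 := by rw [cX, dAt_reeb, zero_div]

lemma cY_Y {x : M} (hx : x ∈ F.U) : θ.cY F x (F.Y x) = 1 := div_self (θ.levi_pos' F hx).ne'

lemma cY_X (x : M) : θ.cY F x (F.X x) = 0 := by rw [cY, dAt_self, zero_div]

lemma cY_reeb (x : M) : θ.cY F x (θ.reeb x) = 0 := by
  rw [cY, dAt_swap, dAt_reeb, neg_zero, zero_div]

/-- `coframeAux` witnesses the three duality conditions, so the chosen form satisfies them; solving
the first two linear equations gives its values on X and Y. -/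
lemma coframe_spec {x : M} (hx : x ∈ F.U) :
    θ.coframe F x (F.X x) = 1 / 2 ∧ θ.coframe F x (F.Y x) = Complex.I / 2 ∧
      θ.coframe F x (θ.reeb x) = 0 := by
  have hex : ∃ α : TangentSpace (𝓡 3) x →L[ℝ] ℂ,
    α (F.Z.re x) + Complex.I * α (F.Z.im x) = 1 ∧
    α (F.Zbar.re x) + Complex.I * α (F.Zbar.im x) = 0 ∧
    α (θ.reeb x) = 0 := by
    refine ⟨θ.coframeAux F x, ?_, ?_, ?_⟩
    · simp only [LocalFrame.Z, map_neg]
      simp only [coframeAux_apply, θ.cX_X F hx, θ.cY_Y F hx, cX_Y, cY_X]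
      push_cast
      linear_combination (-1/2 : ℂ) * Complex.I_mul_I
    · simp only [LocalFrame.Zbar]
      simp only [coframeAux_apply, θ.cX_X F hx, θ.cY_Y F hx, cX_Y, cY_X]
      push_cast
      linear_combination (1/2 : ℂ) * Complex.I_mul_I
    · simp [coframeAux_apply, cX_reeb, cY_reeb]
  obtain ⟨h1, h2, h3⟩ := Classical.epsilon_spec hex
  change θ.coframe F x _ + Complex.I * θ.coframe F x _ = 1 at h1
  change θ.coframe F x _ + Complex.I * θ.coframe F x _ = 0 at h2
  refine ⟨?_, ?_, h3⟩
  · simp only [LocalFrame.Z, LocalFrame.Zbar, map_neg] at h1 h2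
    linear_combination (h1 + h2) / 2
  · simp only [LocalFrame.Z, LocalFrame.Zbar, map_neg] at h1 h2
    linear_combination Complex.I * (h1 - h2) / 2 + θ.coframe F x (F.Y x) * Complex.I_mul_I

lemma coframe_eq {x : M} (hx : x ∈ F.U) (v : TangentSpace (𝓡 3) x) :
    θ.coframe F x v = ((θ.cX F x v : ℂ) + Complex.I * (θ.cY F x v : ℂ)) / 2 := by
  obtain ⟨h1, h2, h3⟩ := θ.coframe_spec F hx
  conv_lhs => rw [θ.decomp F hx v]
  rw [map_add, map_add, map_smul, map_smul, map_smul, h1, h2, h3]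
  simp only [Complex.real_smul]
  ring

lemma smoothOn_coframe {U : Set M} (hU : IsOpen U) (hUF : U ⊆ F.U) {V : VField M}
    (hV : SmoothFieldOn V U) : SmoothOn (fun x => θ.coframe F x (V x)) U := by
  have h1 := (θ.smoothOn_cX F hU hUF hV).ofReal
  have h2 := (θ.smoothOn_cY F hU hUF hV).ofReal
  have hc : ∀ c : ℂ, SmoothOn (fun _ : M => c) U := fun c => contMDiffOn_const
  refine (SmoothOn.mul (hc (1 / 2)) (ContMDiffOn.add h1 (SmoothOn.mul (hc Complex.I) h2))).congr
    fun x hx => ?_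
  rw [θ.coframe_eq F (hUF hx)]
  simp only [Pi.add_apply]
  ring

/-- This is df = (Tf) θ + (Zf) θ¹ + (Z̄f) θ^{1̄}. It will be applied to Lie brackets, and to the
Reeb field of another contact form. -/
lemma dir_eq {x : M} (hx : x ∈ F.U) (V : VField M) (f : M → ℂ) :
    dir V f x = θ.form x (V x) * dir θ.reeb f x + θ.coframe F x (V x) * dirC F.Z f x +
      star (θ.coframe F x (V x)) * dirC F.Zbar f x := by
  have h : dir V f x = θ.form x (V x) * dir θ.reeb f x + (θ.cX F x (V x) * dir F.X f x +
      θ.cY F x (V x) * dir F.Y f x) := by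
    unfold dir
    conv_lhs => rw [θ.decomp F hx (V x)]
    refine (map_add (mfderiv (𝓡 3) 𝓘(ℝ, ℂ) f x) _ _).trans ?_
    refine congrArg₂ (· + ·) (map_smul (mfderiv (𝓡 3) 𝓘(ℝ, ℂ) f x) _ _) ?_
    refine (map_add (mfderiv (𝓡 3) 𝓘(ℝ, ℂ) f x) _ _).trans ?_
    exact congrArg₂ (· + ·) (map_smul (mfderiv (𝓡 3) 𝓘(ℝ, ℂ) f x) _ _)
      (map_smul (mfderiv (𝓡 3) 𝓘(ℝ, ℂ) f x) _ _)
  rw [h, θ.coframe_eq F hx]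
  simp only [dirC, LocalFrame.Z, LocalFrame.Zbar]
  rw [dir_field_neg]
  simp only [Complex.star_def, map_div₀, map_add, map_mul, Complex.conj_I, Complex.conj_ofReal,
    map_ofNat]
  linear_combination (θ.cY F x (V x) * dir F.Y f x : ℂ) * Complex.I_mul_I

/-- The Lie bracket `[X, Y]`. -/
abbrev brXY : VField M := VectorField.mlieBracket (𝓡 3) F.X F.Y

/-- The Lie bracket `[T, X]`. -/
abbrev brTX : VField M := VectorField.mlieBracket (𝓡 3) θ.reeb F.X

/-- The Lie bracket `[T, Y]`. -/
abbrev brTY : VField M := VectorField.mlieBracket (𝓡 3) θ.reeb F.Y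

lemma form_brXY {x : M} (hx : x ∈ F.U) : θ.form x (brXY F x) = -θ.levi F x := by
  rw [← θ.levi_eq F hx, d_of_const θ.form F.isOpen_U (fun y hy => θ.form_X F hy)
    (fun y hy => θ.form_Y F hy) hx, neg_neg]

lemma form_brTX {x : M} (hx : x ∈ F.U) : θ.form x (θ.brTX F x) = 0 := by
  have h := d_of_const θ.form F.isOpen_U (fun y _ => θ.form_reeb y)
    (fun y hy => θ.form_X F hy) hx
  rw [θ.smoothForm.d_eq_dAt F.isOpen_U (θ.smooth_reeb _) F.smooth_X hx, dAt_reeb] at h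
  exact neg_eq_zero.mp h.symm

lemma form_brTY {x : M} (hx : x ∈ F.U) : θ.form x (θ.brTY F x) = 0 := by
  have h := d_of_const θ.form F.isOpen_U (fun y _ => θ.form_reeb y)
    (fun y hy => θ.form_Y F hy) hx
  rw [θ.smoothForm.d_eq_dAt F.isOpen_U (θ.smooth_reeb _) F.smooth_Y hx, dAt_reeb] at h
  exact neg_eq_zero.mp h.symm

lemma h_eq {x : M} (hx : x ∈ F.U) : θ.h F x = 2 * (θ.levi F x : ℂ) := by
  have h1 : ∀ (V : VField M) (y : M), θ.formC y (V y) = (θ.form y (V y) : ℂ) := fun _ _ => rfl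
  rw [h, dC_Z_Zbar F _ hx, d_of_const θ.formC F.isOpen_U (a := 0) (b := 0)
    (fun y hy => by rw [h1, θ.form_X F hy, Complex.ofReal_zero])
    (fun y hy => by rw [h1, θ.form_Y F hy, Complex.ofReal_zero]) hx, h1, θ.form_brXY F hx]
  push_cast
  linear_combination (-2 * (θ.levi F x : ℂ)) * Complex.I_mul_I

lemma omegaZbar_eq {x : M} (hx : x ∈ F.U) :
    θ.omegaZbar F x = -2 * Complex.I * θ.coframe F x (brXY F x) := by
  rw [omegaZbar, dC_Z_Zbar F _ hx, d_of_const (θ.coframe F) F.isOpen_U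
    (fun y hy => (θ.coframe_spec F hy).1) (fun y hy => (θ.coframe_spec F hy).2.1) hx]
  ring

lemma omegaT_eq {x : M} (hx : x ∈ F.U) : θ.omegaT F x =
    θ.coframe F x (θ.brTX F x) - Complex.I * θ.coframe F x (θ.brTY F x) := by
  rw [omegaT, dC_T_Z θ F _ hx, d_of_const (θ.coframe F) F.isOpen_U
    (fun y hy => (θ.coframe_spec F hy).2.2) (fun y hy => (θ.coframe_spec F hy).1) hx,
    d_of_const (θ.coframe F) F.isOpen_U
    (fun y hy => (θ.coframe_spec F hy).2.2) (fun y hy => (θ.coframe_spec F hy).2.1) hx]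
  ring

lemma A_eq {x : M} (hx : x ∈ F.U) : θ.A F x = -(star (θ.h F x) *
    (star (θ.coframe F x (θ.brTX F x)) - Complex.I * star (θ.coframe F x (θ.brTY F x)))) := by
  rw [A, dC_T_Zbar, d_of_const (θ.coframe F) F.isOpen_U
    (fun y hy => (θ.coframe_spec F hy).2.2) (fun y hy => (θ.coframe_spec F hy).1) hx,
    d_of_const (θ.coframe F) F.isOpen_U
    (fun y hy => (θ.coframe_spec F hy).2.2) (fun y hy => (θ.coframe_spec F hy).2.1) hx]
  simp only [Complex.star_def, map_add, map_mul, map_neg, Complex.conj_I]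
  ring

lemma star_h {x : M} (hx : x ∈ F.U) : star (θ.h F x) = θ.h F x := by
  rw [θ.h_eq F hx]
  simp

lemma h_ne_zero {x : M} (hx : x ∈ F.U) : θ.h F x ≠ 0 := by
  rw [θ.h_eq F hx]
  have := (θ.levi_pos' F hx).ne'
  simp [this]

section smooth

variable {U : Set M}

lemma smoothOn_h (hUF : U ⊆ F.U) : SmoothOn (θ.h F) U :=
  (SmoothOn.mul (contMDiffOn_const (c := (2 : ℂ))) (SmoothOn.ofReal ((θ.smoothOn_levi F).mono hUF))).congr
    fun _ hx => θ.h_eq F (hUF hx)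

lemma smoothOn_h_inv (hUF : U ⊆ F.U) : SmoothOn (fun x => (θ.h F x)⁻¹) U :=
  (SmoothOn.mul (contMDiffOn_const (c := (2⁻¹ : ℂ)))
    ((SmoothOn.ofReal (((θ.smoothOn_levi F).mono hUF).inv₀
      fun y hy => (θ.levi_pos' F (hUF hy)).ne')))).congr
    fun x hx => by rw [θ.h_eq F (hUF hx), mul_inv]; simp

lemma smooth_X_on (hUF : U ⊆ F.U) : SmoothFieldOn F.X U := SmoothFieldOn.mono F.smooth_X hUF

lemma smooth_Y_on (hUF : U ⊆ F.U) : SmoothFieldOn F.Y U := SmoothFieldOn.mono F.smooth_Y hUF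

lemma smoothOn_omegaZbar (hU : IsOpen U) (hUF : U ⊆ F.U) : SmoothOn (θ.omegaZbar F) U :=
  (SmoothOn.mul contMDiffOn_const (θ.smoothOn_coframe F hU hUF
    ((smooth_X_on F hUF).bracket (smooth_Y_on F hUF) hU))).congr
    fun _ hx => θ.omegaZbar_eq F (hUF hx)

lemma smoothOn_omegaT (hU : IsOpen U) (hUF : U ⊆ F.U) : SmoothOn (θ.omegaT F) U :=
  (ContMDiffOn.sub (θ.smoothOn_coframe F hU hUF ((θ.smooth_reeb U).bracket (smooth_X_on F hUF) hU))
    (SmoothOn.mul contMDiffOn_const (θ.smoothOn_coframe F hU hUF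
      ((θ.smooth_reeb U).bracket (smooth_Y_on F hUF) hU)))).congr
    fun _ hx => θ.omegaT_eq F (hUF hx)

lemma smoothOn_A (hU : IsOpen U) (hUF : U ⊆ F.U) : SmoothOn (θ.A F) U :=
  (SmoothOn.mul (contMDiffOn_const (c := (-1 : ℂ))) (SmoothOn.mul (θ.smoothOn_h F hUF).star
    (ContMDiffOn.sub
    (θ.smoothOn_coframe F hU hUF ((θ.smooth_reeb U).bracket (smooth_X_on F hUF) hU)).star
    (SmoothOn.mul contMDiffOn_const (θ.smoothOn_coframe F hU hUF
      ((θ.smooth_reeb U).bracket (smooth_Y_on F hUF) hU)).star)))).congr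
    fun _ hx => (θ.A_eq F (hUF hx)).trans (neg_one_mul _).symm

lemma smooth_Z (hU : IsOpen U) (hUF : U ⊆ F.U) : F.Z.SmoothOn U :=
  ⟨hU, smooth_X_on F hUF, (smooth_Y_on F hUF).neg⟩

lemma smooth_Zbar (hU : IsOpen U) (hUF : U ⊆ F.U) : F.Zbar.SmoothOn U :=
  ⟨hU, smooth_X_on F hUF, smooth_Y_on F hUF⟩

lemma smooth_T (hU : IsOpen U) : θ.T.SmoothOn U :=
  ⟨hU, θ.smooth_reeb U, (contMDiff_zeroSection ℝ (TangentSpace (𝓡 3) : M → Type _)).contMDiffOn⟩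

end smooth

lemma dirC_T (f : M → ℂ) (x : M) : dirC θ.T f x = dir θ.reeb f x := by
  have h : dir (fun _ => 0) f x = 0 := map_zero (mfderiv (𝓡 3) 𝓘(ℝ, ℂ) f x)
  simp only [dirC, T, CField.ofReal]
  rw [h, mul_zero, add_zero]

lemma dirC_Z (f : M → ℂ) (x : M) : dirC F.Z f x = dir F.X f x - Complex.I * dir F.Y f x := by
  simp only [dirC, LocalFrame.Z]
  rw [dir_field_neg]
  ring

lemma dirC_Zbar (f : M → ℂ) (x : M) : dirC F.Zbar f x = dir F.X f x + Complex.I * dir F.Y f x := rfl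

end ContactForm

lemma dir_lincomb (V : VField M) {f g : M → ℂ} {x : M} (c : ℂ)
    (hf : MDifferentiableAt (𝓡 3) 𝓘(ℝ, ℂ) f x) (hg : MDifferentiableAt (𝓡 3) 𝓘(ℝ, ℂ) g x) :
    dir V (fun y => f y + c * g y) x = dir V f x + c * dir V g x := by
  have hc : MDifferentiableAt (𝓡 3) 𝓘(ℝ, ℂ) (fun _ : M => c) x := mdifferentiableAt_const
  have hm : MDifferentiableAt (𝓡 3) 𝓘(ℝ, ℂ) (fun y => c * g y) x := hc.mul hg
  rw [dir_add V hf hm, dir_mul V hc hg, dir_const]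
  ring

namespace ContactForm

variable (θ : ContactForm S) (F : S.Frame)

/-- Here [Z̄, Z] = -2i[X, Y], and the components of [X, Y] in T, Z, Z̄ are given by the Levi form
and by ω(Z̄). -/
lemma Zbar_Z {f : M → ℂ} {U : Set M} (hU : IsOpen U) (hUF : U ⊆ F.U) (hf : SmoothOn f U) {x : M}
    (hx : x ∈ U) : dirC F.Zbar (dirC F.Z f) x = dirC F.Z (dirC F.Zbar f) x +
      Complex.I * θ.h F x * dirC θ.T f x + θ.omegaZbar F x * dirC F.Z f x -
      star (θ.omegaZbar F x) * dirC F.Zbar f x := by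
  have hX := smooth_X_on F hUF
  have hY := smooth_Y_on F hUF
  have dX := (hX.dir hU hf).mdifferentiableAt hU hx
  have dY := (hY.dir hU hf).mdifferentiableAt hU hx
  have hb := dir_bracket hX hY hU hf hx
  have hd := θ.dir_eq F (hUF hx) (brXY F) f
  have e1 : dirC F.Z f = fun y => dir F.X f y + (-Complex.I) * dir F.Y f y := by
    funext y; rw [dirC_Z]; ring
  have e2 : dirC F.Zbar f = fun y => dir F.X f y + Complex.I * dir F.Y f y := rfl
  rw [dirC_T, θ.h_eq F (hUF hx), θ.omegaZbar_eq F (hUF hx)]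
  rw [hb, θ.form_brXY F (hUF hx)] at hd
  rw [dirC_Zbar F (dirC F.Z f), dirC_Z F (dirC F.Zbar f), e1, e2, dir_lincomb _ _ dX dY,
    dir_lincomb _ _ dX dY, dir_lincomb _ _ dX dY, dir_lincomb _ _ dX dY, ← e2, ← e1]
  simp only [Complex.star_def, map_mul, map_neg, Complex.conj_I, map_ofNat] at hd ⊢
  push_cast at hd
  linear_combination -2 * Complex.I * hd

/-- The bracket [T, Z] = [T, X] - i[T, Y] is horizontal because dθ(T, ·) = 0; its Z- and
Z̄-components are ω(T) and the torsion up to sign and h. -/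
lemma T_Z {f : M → ℂ} {U : Set M} (hU : IsOpen U) (hUF : U ⊆ F.U) (hf : SmoothOn f U) {x : M}
    (hx : x ∈ U) : dirC θ.T (dirC F.Z f) x = dirC F.Z (dirC θ.T f) x +
      θ.omegaT F x * dirC F.Z f x - (θ.h F x)⁻¹ * θ.A F x * dirC F.Zbar f x := by
  have hX := smooth_X_on F hUF
  have hY := smooth_Y_on F hUF
  have dX := (hX.dir hU hf).mdifferentiableAt hU hx
  have dY := (hY.dir hU hf).mdifferentiableAt hU hx
  have hb1 := dir_bracket (θ.smooth_reeb U) hX hU hf hx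
  have hb2 := dir_bracket (θ.smooth_reeb U) hY hU hf hx
  have hd1 := θ.dir_eq F (hUF hx) (θ.brTX F) f
  have hd2 := θ.dir_eq F (hUF hx) (θ.brTY F) f
  have e1 : dirC F.Z f = fun y => dir F.X f y + (-Complex.I) * dir F.Y f y := by
    funext y; rw [dirC_Z]; ring
  have e2 : dirC θ.T f = dir θ.reeb f := funext fun y => θ.dirC_T f y
  have hA : (θ.h F x)⁻¹ * θ.A F x = -(star (θ.coframe F x (θ.brTX F x)) -
      Complex.I * star (θ.coframe F x (θ.brTY F x))) := by
    rw [θ.A_eq F (hUF hx), θ.star_h F (hUF hx)]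
    field_simp [θ.h_ne_zero F (hUF hx)]
  rw [hb1, θ.form_brTX F (hUF hx)] at hd1
  rw [hb2, θ.form_brTY F (hUF hx)] at hd2
  rw [hA, θ.omegaT_eq F (hUF hx), dirC_T, e2, dirC_Z F (dir θ.reeb f), e1,
    dir_lincomb _ _ dX dY, ← e1]
  push_cast at hd1 hd2
  linear_combination hd1 - Complex.I * hd2

lemma indep_real {x : M} (hx : x ∈ F.U) {a b c : ℝ}
    (h : a • θ.reeb x + (b • F.X x + c • F.Y x) = 0) : a = 0 ∧ b = 0 ∧ c = 0 := by
  have h1 := congrArg (θ.form x) h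
  have h2 := congrArg (θ.cX F x) h
  have h3 := congrArg (θ.cY F x) h
  rw [map_add, map_add, map_smul, map_smul, map_smul, θ.form_reeb, θ.form_X F hx, θ.form_Y F hx,
    map_zero] at h1
  have hl := (θ.levi_pos' F hx).ne'
  simp only [cX, dAt_add_left, dAt_smul_left, dAt_reeb, dAt_self] at h2
  simp only [cY, dAt_add_right, dAt_smul_right, dAt_self, dAt_swap _ _ _ (θ.reeb x), dAt_reeb] at h3
  have z1 : dAt θ.form x 0 (F.Y x) = 0 := by simp [dAt]
  have z2 : dAt θ.form x (F.X x) 0 = 0 := by simp [dAt]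
  rw [z1] at h2
  rw [z2] at h3
  change (a * 0 + (b * θ.levi F x + c * 0)) / θ.levi F x = 0 / θ.levi F x at h2
  change (a * -0 + (b * 0 + c * θ.levi F x)) / θ.levi F x = 0 / θ.levi F x at h3
  field_simp at h2 h3
  simp only [smul_eq_mul] at h1
  refine ⟨by linarith, ?_, ?_⟩
  · simpa [hl] using h2
  · simpa [hl] using h3

/-- The three coordinate functions of a chart detect every tangent vector. Real and imaginary parts
give two relations among T, X, Y with real coefficients. This is why `frameAlg` asks for a set
inside one chart domain. -/
lemma indep_at {x : M} (hx : x ∈ F.U) {c : M} (hc : x ∈ (extChartAt (𝓡 3) c).source) {u v w : ℂ}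
    (h : ∀ k, u * dirC θ.T (fun y => (coordFn c k y : ℂ)) x +
      v * dirC F.Z (fun y => (coordFn c k y : ℂ)) x +
      w * dirC F.Zbar (fun y => (coordFn c k y : ℂ)) x = 0) : u = 0 ∧ v = 0 ∧ w = 0 := by
  have hd : ∀ k, MDifferentiableAt (𝓡 3) 𝓘(ℝ, ℝ) (coordFn c k) x := fun k =>
    (smoothOn_coordFn c k).mdifferentiableAt (isOpen_source c) hc
  have hreal : ∀ a b e : ℝ, (∀ k, a * dir θ.reeb (coordFn c k) x + b * dir F.X (coordFn c k) x +
      e * dir F.Y (coordFn c k) x = 0) → a = 0 ∧ b = 0 ∧ e = 0 := by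
    intro a b e habe
    refine θ.indep_real F hx ?_
    rw [eq_sum_coordField hc (a • θ.reeb x + (b • F.X x + e • F.Y x))]
    refine Finset.sum_eq_zero fun k _ => ?_
    have hk := habe k
    rw [dir_coordFn _ hc, dir_coordFn _ hc, dir_coordFn _ hc] at hk
    rw [map_add, map_add, map_smul, map_smul, map_smul]
    simp only [PiLp.add_apply, PiLp.smul_apply, smul_eq_mul]
    rw [← add_assoc, hk, zero_smul]
  simp only [dirC_T, dirC_Z, dirC_Zbar] at h
  simp only [dir_ofReal _ (hd _)] at h
  have hre := hreal u.re (v.re + w.re) (v.im - w.im) fun k => by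
    have := congrArg Complex.re (h k)
    simp at this
    linarith
  have him := hreal u.im (v.im + w.im) (w.re - v.re) fun k => by
    have := congrArg Complex.im (h k)
    simp at this
    linarith
  obtain ⟨a1, a2, a3⟩ := hre
  obtain ⟨b1, b2, b3⟩ := him
  refine ⟨Complex.ext a1 b1, Complex.ext ?_ ?_, Complex.ext ?_ ?_⟩ <;> simp <;> linarith

/-- The algebra of a local frame on an open set that lies in a chart domain. -/
def frameAlg {U : Set M} (hU : IsOpen U) (hUF : U ⊆ F.U) {c : M}
    (hUc : U ⊆ (extChartAt (𝓡 3) c).source) : FrameAlgebra (SmoothAlg U) where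
  T := (θ.smooth_T hU).derivation
  Z := (smooth_Z F hU hUF).derivation
  Zb := (smooth_Zbar F hU hUF).derivation
  h := SmoothAlg.mk (θ.h F) (θ.smoothOn_h F hUF)
  hi := SmoothAlg.mk (fun x => (θ.h F x)⁻¹) (θ.smoothOn_h_inv F hUF)
  p := SmoothAlg.mk (θ.omegaZbar F) (θ.smoothOn_omegaZbar F hU hUF)
  q := SmoothAlg.mk (θ.omegaT F) (θ.smoothOn_omegaT F hU hUF)
  a := SmoothAlg.mk (θ.A F) (θ.smoothOn_A F hU hUF)
  star_T f := SmoothAlg.ext_ev fun x hx => by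
    rw [SmoothAlg.ev_star _ hx, CField.SmoothOn.ev_derivation _ _ hx,
      CField.SmoothOn.ev_derivation _ _ hx, dirC_T, dirC_T,
      ← dir_star _ ((SmoothAlg.smooth_ev f).mdifferentiableAt hU hx)]
    exact dir_congr (by filter_upwards [hU.mem_nhds hx] with y hy using (SmoothAlg.ev_star f hy).symm)
  star_Z f := SmoothAlg.ext_ev fun x hx => by
    have hd := (SmoothAlg.smooth_ev f).mdifferentiableAt hU hx
    rw [SmoothAlg.ev_star _ hx, CField.SmoothOn.ev_derivation _ _ hx,
      CField.SmoothOn.ev_derivation _ _ hx, dirC_Z,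
      dirC_congr_on hU (fun y hy => SmoothAlg.ev_star f hy) hx, dirC_Zbar,
      dir_star _ hd, dir_star _ hd]
    simp
  star_h := SmoothAlg.ext_ev fun x hx => by
    rw [SmoothAlg.ev_star _ hx, SmoothAlg.ev_mk _ _ hx, θ.star_h F (hUF hx)]
  h_mul_hi := SmoothAlg.ext_ev fun x hx => by
    rw [SmoothAlg.ev_mul _ _ hx, SmoothAlg.ev_mk _ _ hx, SmoothAlg.ev_mk _ _ hx,
      SmoothAlg.ev_one hx, mul_inv_cancel₀ (θ.h_ne_zero F (hUF hx))]
  Zb_Z f := SmoothAlg.ext_ev fun x hx => by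
    simp only [SmoothAlg.ev_add _ _ hx, SmoothAlg.ev_sub _ _ hx, SmoothAlg.ev_mul _ _ hx,
      SmoothAlg.ev_star _ hx, SmoothAlg.ev_mk _ _ hx, SmoothAlg.ev_algebraMap _ hx,
      CField.SmoothOn.ev_derivation _ _ hx]
    rw [dirC_congr_on hU (fun y hy => CField.SmoothOn.ev_derivation _ f hy) hx,
      dirC_congr_on hU (fun y hy => CField.SmoothOn.ev_derivation _ f hy) hx]
    exact θ.Zbar_Z F hU hUF (SmoothAlg.smooth_ev f) hx
  T_Z f := SmoothAlg.ext_ev fun x hx => by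
    simp only [SmoothAlg.ev_add _ _ hx, SmoothAlg.ev_sub _ _ hx, SmoothAlg.ev_mul _ _ hx,
      SmoothAlg.ev_mk _ _ hx, CField.SmoothOn.ev_derivation _ _ hx]
    rw [dirC_congr_on hU (fun y hy => CField.SmoothOn.ev_derivation _ f hy) hx,
      dirC_congr_on hU (fun y hy => CField.SmoothOn.ev_derivation _ f hy) hx]
    exact θ.T_Z F hU hUF (SmoothAlg.smooth_ev f) hx
  indep u v w huvw := by
    have key : ∀ x ∈ U, SmoothAlg.ev u x = 0 ∧ SmoothAlg.ev v x = 0 ∧ SmoothAlg.ev w x = 0 := by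
      intro x hx
      refine θ.indep_at F (hUF hx) (hUc hx) fun k => ?_
      have hk : SmoothOn (fun y => (coordFn c k y : ℂ)) U :=
        SmoothOn.ofReal ((smoothOn_coordFn c k).mono hUc)
      have h := congrArg (fun g => SmoothAlg.ev g x) (huvw (SmoothAlg.mk _ hk))
      simp only [SmoothAlg.ev_add _ _ hx, SmoothAlg.ev_mul _ _ hx, SmoothAlg.ev_zero hx,
        CField.SmoothOn.ev_derivation _ _ hx] at h
      rw [dirC_congr_on hU (fun y hy => SmoothAlg.ev_mk _ hk hy) hx,
        dirC_congr_on hU (fun y hy => SmoothAlg.ev_mk _ hk hy) hx,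
        dirC_congr_on hU (fun y hy => SmoothAlg.ev_mk _ hk hy) hx] at h
      exact h
    refine ⟨SmoothAlg.ext_ev fun x hx => ?_, SmoothAlg.ext_ev fun x hx => ?_,
      SmoothAlg.ext_ev fun x hx => ?_⟩ <;> rw [SmoothAlg.ev_zero hx]
    exacts [(key x hx).1, (key x hx).2.1, (key x hx).2.2]

end ContactForm

end
end CR

/-! ### Pseudohermitian scalars as expressions in the frame algebra. -/

namespace CR

open Set Filter Topology

noncomputable section

set_option linter.unusedSectionVars false

variable {M : Type*} [TopologicalSpace M] [ChartedSpace E3 M]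

/-- The function `g` agrees on `U` with the element `a` of the algebra of smooth functions. -/
def Rep {U : Set M} (g : M → ℂ) (a : SmoothAlg U) : Prop := ∀ x ∈ U, g x = SmoothAlg.ev a x

namespace Rep

variable {U : Set M} {f g : M → ℂ} {a b : SmoothAlg U}

lemma mk (hg : SmoothOn g U) : Rep g (SmoothAlg.mk g hg) := fun _ hx => (SmoothAlg.ev_mk g hg hx).symm

lemma congr (h : Rep g a) (hf : ∀ x ∈ U, f x = g x) : Rep f a := fun x hx => (hf x hx).trans (h x hx)

lemma add (hf : Rep f a) (hg : Rep g b) : Rep (fun x => f x + g x) (a + b) := fun x hx => by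
  rw [SmoothAlg.ev_add _ _ hx, ← hf x hx, ← hg x hx]

lemma sub (hf : Rep f a) (hg : Rep g b) : Rep (fun x => f x - g x) (a - b) := fun x hx => by
  rw [SmoothAlg.ev_sub _ _ hx, ← hf x hx, ← hg x hx]

lemma neg (hf : Rep f a) : Rep (fun x => -f x) (-a) := fun x hx => by
  rw [SmoothAlg.ev_neg _ hx, ← hf x hx]

lemma mul (hf : Rep f a) (hg : Rep g b) : Rep (fun x => f x * g x) (a * b) := fun x hx => by
  rw [SmoothAlg.ev_mul _ _ hx, ← hf x hx, ← hg x hx]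

lemma pow (hf : Rep f a) (n : ℕ) : Rep (fun x => f x ^ n) (a ^ n) := fun x hx => by
  rw [SmoothAlg.ev_pow _ _ hx, ← hf x hx]

lemma star (hf : Rep f a) : Rep (fun x => star (f x)) (star a) := fun x hx => by
  rw [SmoothAlg.ev_star _ hx, ← hf x hx]

lemma natCast (n : ℕ) : Rep (fun _ => (n : ℂ)) (n : SmoothAlg U) := fun x hx => by
  rw [SmoothAlg.ev_natCast _ hx]

lemma ofNat (n : ℕ) [n.AtLeastTwo] : Rep (fun _ => (OfNat.ofNat n : ℂ))
    (OfNat.ofNat n : SmoothAlg U) := fun x hx => by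
  rw [SmoothAlg.ev_ofNat _ hx]

lemma unique (hf : Rep f a) (hg : Rep f b) : a = b :=
  SmoothAlg.ext_ev fun x hx => by rw [← hf x hx, ← hg x hx]

lemma smooth (hf : Rep f a) : SmoothOn f U := (SmoothAlg.smooth_ev a).congr fun x hx => hf x hx

lemma star_eq {u : M → ℝ} (h : Rep (fun x => (u x : ℂ)) a) : Star.star a = a :=
  Rep.unique (f := fun x => (u x : ℂ)) (h.star.congr fun x _ => by simp) h

/-- The concrete definitions of the real scalars take real parts. A self-adjoint element has real
values, so nothing is lost. -/
lemma re (h : Rep f a) (ha : Star.star a = a) : Rep (fun x => ((f x).re : ℂ)) a := fun x hx => by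
  have := SmoothAlg.ev_star a hx
  rw [ha, ← h x hx] at this
  rw [← h x hx]
  exact Complex.conj_eq_iff_re.mp this.symm

end Rep

lemma re_cast (z : ℂ) : (z.re : ℂ) = (z + star z) / 2 := Complex.re_eq_add_conj z

lemma im_cast (z : ℂ) : (z.im : ℂ) = -(Complex.I * (z - star z)) / 2 := by
  rw [Complex.star_def, Complex.sub_conj]
  push_cast
  linear_combination (z.im : ℂ) * Complex.I_mul_I

variable [IsManifold (𝓡 3) ∞ M] {S : CRStructure M}

namespace ContactForm

variable (θ : ContactForm S) (F : S.Frame)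

/-- `dω(Z, Z̄)` for the connection form. -/
lemma dC_omega {U : Set M} (hU : IsOpen U) (hUF : U ⊆ F.U) {x : M} (hx : x ∈ U)
    (hZ : SmoothOn (θ.omegaZ F) U) :
    dC (θ.omega F) F.Z F.Zbar x = dirC F.Z (θ.omegaZbar F) x - dirC F.Zbar (θ.omegaZ F) x +
      Complex.I * θ.h F x * θ.omegaT F x + θ.omegaZbar F x * θ.omegaZ F x
      - star (θ.omegaZbar F x) * θ.omegaZbar F x := by
  have hp := θ.smoothOn_omegaZbar F hU hUF
  have hω : ∀ (V : VField M) (y : M), θ.omega F y (V y) = θ.omegaT F y * (θ.form y (V y) : ℂ) +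
      θ.omegaZ F y * θ.coframe F y (V y) + θ.omegaZbar F y * star (θ.coframe F y (V y)) :=
    fun _ _ => rfl
  -- Uses X = (Z + Z̄)/2, and next Y = (i/2)(Z - Z̄).
  have hX : ∀ y ∈ U, θ.omega F y (F.X y) = (1 / 2) * (θ.omegaZ F y + 1 * θ.omegaZbar F y) := by
    intro y hy
    rw [hω, θ.form_X F (hUF hy), (θ.coframe_spec F (hUF hy)).1]
    simp
    ring
  have hY : ∀ y ∈ U, θ.omega F y (F.Y y) =
      (Complex.I / 2) * (θ.omegaZ F y + (-1) * θ.omegaZbar F y) := by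
    intro y hy
    rw [hω, θ.form_Y F (hUF hy), (θ.coframe_spec F (hUF hy)).2.1]
    simp
    ring
  have dZ := hZ.mdifferentiableAt hU hx
  have dp := hp.mdifferentiableAt hU hx
  have hs : ∀ c : ℂ, MDifferentiableAt (𝓡 3) 𝓘(ℝ, ℂ)
      (fun y => θ.omegaZ F y + c * θ.omegaZbar F y) x := by
    intro c
    have : SmoothOn (fun y => θ.omegaZ F y + c * θ.omegaZbar F y) U :=
      ContMDiffOn.add hZ (SmoothOn.mul contMDiffOn_const hp)
    exact this.mdifferentiableAt hU hx
  have e1 : dir F.X (fun y => θ.omega F y (F.Y y)) x =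
      Complex.I / 2 * (dir F.X (θ.omegaZ F) x - dir F.X (θ.omegaZbar F) x) := by
    rw [dir_congr (by filter_upwards [hU.mem_nhds hx] with y hy using hY y hy),
      dir_mul _ mdifferentiableAt_const (hs _), dir_const, dir_lincomb _ _ dZ dp]
    ring
  have e2 : dir F.Y (fun y => θ.omega F y (F.X y)) x =
      1 / 2 * (dir F.Y (θ.omegaZ F) x + dir F.Y (θ.omegaZbar F) x) := by
    rw [dir_congr (by filter_upwards [hU.mem_nhds hx] with y hy using hX y hy),
      dir_mul _ mdifferentiableAt_const (hs _), dir_const, dir_lincomb _ _ dZ dp]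
    ring
  have hα := θ.omegaZbar_eq F (hUF hx)
  have hα2 : star (θ.omegaZbar F x) = 2 * Complex.I * star (θ.coframe F x (brXY F x)) := by
    rw [hα]
    simp only [Complex.star_def, map_mul, map_neg, Complex.conj_I, map_ofNat]
    ring
  rw [dC_Z_Zbar F _ (hUF hx), d, e1, e2, hω, θ.form_brXY F (hUF hx), θ.h_eq F (hUF hx),
    dirC_Z, dirC_Zbar, hα2]
  set α := θ.coframe F x (brXY F x)
  push_cast
  linear_combination (dir F.X (θ.omegaZ F) x - dir F.X (θ.omegaZbar F) x) * Complex.I_mul_I -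
    θ.omegaZ F x * hα

section rep

variable {U : Set M} (hU : IsOpen U) (hUF : U ⊆ F.U) {c : M}
  (hUc : U ⊆ (extChartAt (𝓡 3) c).source)

local notation "𝔉" => frameAlg θ F hU hUF hUc

lemma rep_h : Rep (θ.h F) (𝔉).h := Rep.mk (θ.smoothOn_h F hUF)

lemma rep_hi : Rep (fun x => (θ.h F x)⁻¹) (𝔉).hi := Rep.mk (θ.smoothOn_h_inv F hUF)

lemma rep_p : Rep (θ.omegaZbar F) (𝔉).p := Rep.mk (θ.smoothOn_omegaZbar F hU hUF)

lemma rep_q : Rep (θ.omegaT F) (𝔉).q := Rep.mk (θ.smoothOn_omegaT F hU hUF)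

lemma rep_a : Rep (θ.A F) (𝔉).a := Rep.mk (θ.smoothOn_A F hU hUF)

lemma rep_i : Rep (fun _ => Complex.I) (𝔉).i := fun _ hx => (SmoothAlg.ev_algebraMap _ hx).symm

variable {t : M → ℂ} {b : SmoothAlg U}

lemma rep_T (ht : Rep t b) : Rep (dirC θ.T t) ((𝔉).T b) := fun x hx => by
  rw [dirC_congr_on hU ht hx]
  exact (CField.SmoothOn.ev_derivation (θ.smooth_T hU) b hx).symm

lemma rep_Z (ht : Rep t b) : Rep (dirC F.Z t) ((𝔉).Z b) := fun x hx => by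
  rw [dirC_congr_on hU ht hx]
  exact (CField.SmoothOn.ev_derivation (smooth_Z F hU hUF) b hx).symm

lemma rep_Zb (ht : Rep t b) : Rep (dirC F.Zbar t) ((𝔉).Zb b) := fun x hx => by
  rw [dirC_congr_on hU ht hx]
  exact (CField.SmoothOn.ev_derivation (smooth_Zbar F hU hUF) b hx).symm

lemma rep_oZ : Rep (θ.omegaZ F) (𝔉).oZ :=
  ((θ.rep_hi F hU hUF hUc).mul (θ.rep_Z F hU hUF hUc (θ.rep_h F hU hUF hUc))).sub
    (θ.rep_p F hU hUF hUc).star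

lemma rep_nabla (m n : ℕ) (ht : Rep t b) : Rep (θ.nabla F m n t) ((𝔉).nabla m n b) :=
  (θ.rep_Z F hU hUF hUc ht).sub ((((Rep.natCast m).mul (θ.rep_oZ F hU hUF hUc)).add
    ((Rep.natCast n).mul (θ.rep_p F hU hUF hUc).star)).mul ht)

lemma rep_nablaBar (m n : ℕ) (ht : Rep t b) : Rep (θ.nablaBar F m n t) ((𝔉).nablaBar m n b) :=
  (θ.rep_Zb F hU hUF hUc ht).sub ((((Rep.natCast m).mul (θ.rep_p F hU hUF hUc)).add
    ((Rep.natCast n).mul (θ.rep_oZ F hU hUF hUc).star)).mul ht)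

lemma nabla_zero (t : M → ℂ) : θ.nabla F 0 0 t = dirC F.Z t := by
  funext x
  simp [nabla]

lemma nablaBar_zero (t : M → ℂ) : θ.nablaBar F 0 0 t = dirC F.Zbar t := by
  funext x
  simp [nablaBar]

lemma rep_nabla_zero (ht : Rep t b) : Rep (θ.nabla F 0 0 t) ((𝔉).Z b) := by
  rw [nabla_zero]
  exact θ.rep_Z F hU hUF hUc ht

lemma rep_nablaBar_zero (ht : Rep t b) : Rep (θ.nablaBar F 0 0 t) ((𝔉).Zb b) := by
  rw [nablaBar_zero]
  exact θ.rep_Zb F hU hUF hUc ht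

lemma rep_gradUp (ht : Rep t b) : Rep (θ.gradUp F t) ((𝔉).hi * (𝔉).Zb b) :=
  (θ.rep_hi F hU hUF hUc).mul (θ.rep_nablaBar_zero F hU hUF hUc ht)

lemma rep_div (ht : Rep t b) : Rep (θ.div F t) ((𝔉).div b) :=
  (θ.rep_hi F hU hUF hUc).mul (θ.rep_nablaBar F hU hUF hUc 1 0 ht)

lemma rep_box (ht : Rep t b) : Rep (θ.box F t) ((𝔉).box b) :=
  (θ.rep_hi F hU hUF hUc).mul (θ.rep_nabla F hU hUF hUc 0 1
    (θ.rep_nablaBar_zero F hU hUF hUc ht))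

lemma rep_divA : Rep (θ.divA F) (𝔉).divA :=
  (θ.rep_hi F hU hUF hUc).mul (θ.rep_nablaBar F hU hUF hUc 2 0 (θ.rep_a F hU hUF hUc))

/-- `dC_omega` expands dω(Z, Z̄) into the expression that defines the abstract curvature; its
reality is `FrameAlgebra.star_R`. -/
lemma rep_R : Rep (fun x => (θ.R F x : ℂ)) (𝔉).R := by
  have hp := θ.rep_p F hU hUF hUc
  have hz := θ.rep_oZ F hU hUF hUc
  have h := (θ.rep_hi F hU hUF hUc).mul (((((θ.rep_Z F hU hUF hUc hp).sub
    (θ.rep_Zb F hU hUF hUc hz)).add (((θ.rep_i F hU hUF hUc).mul (θ.rep_h F hU hUF hUc)).mul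
    (θ.rep_q F hU hUF hUc))).add (hp.mul hz)).sub (hp.star.mul hp))
  have h2 : Rep (fun x => (θ.h F x)⁻¹ * dC (θ.omega F) F.Z F.Zbar x) (𝔉).R :=
    Rep.congr h fun x hx => by rw [θ.dC_omega F hU hUF hx hz.smooth]
  exact h2.re (𝔉).star_R

lemma rep_W : Rep (θ.W F) (𝔉).W :=
  (θ.rep_nabla_zero F hU hUF hUc (θ.rep_R F hU hUF hUc)).sub
    ((θ.rep_i F hU hUF hUc).mul (θ.rep_divA F hU hUF hUc))

variable {u : M → ℝ}

lemma rep_sublaplacian (hu : Rep (fun x => (u x : ℂ)) b) :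
    Rep (fun x => (θ.sublaplacian F u x : ℂ)) ((𝔉).lap b) := by
  have h := ((θ.rep_div F hU hUF hUc (θ.rep_nabla_zero F hU hUF hUc hu)).add
    (θ.rep_box F hU hUF hUc hu)).neg
  refine Rep.congr (h.re ((𝔉).star_lap hu.star_eq)) fun x _ => ?_
  simp [sublaplacian, boxBar]

lemma rep_PForm (hu : Rep (fun x => (u x : ℂ)) b) : Rep (θ.PForm F u) ((𝔉).PForm b) :=
  (θ.rep_nabla_zero F hU hUF hUc (θ.rep_box F hU hUF hUc hu)).add
    (((θ.rep_i F hU hUF hUc).mul (θ.rep_a F hU hUF hUc)).mul (θ.rep_gradUp F hU hUF hUc hu))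

lemma rep_divAGrad (hu : Rep (fun x => (u x : ℂ)) b) : Rep (θ.divAGrad F u) ((𝔉).divAGrad b) :=
  θ.rep_div F hU hUF hUc ((θ.rep_a F hU hUF hUc).mul (θ.rep_gradUp F hU hUF hUc hu))

lemma rep_dir_reeb (hu : Rep (fun x => (u x : ℂ)) b) :
    Rep (fun x => ((dir θ.reeb u x : ℝ) : ℂ)) ((𝔉).T b) := by
  refine (θ.rep_T F hU hUF hUc hu).congr fun x hx => ?_
  have hs : SmoothOn u U := hu.smooth.re
  rw [dirC_T, dir_ofReal _ (hs.mdifferentiableAt hU hx)]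

lemma rep_P4 (hu : Rep (fun x => (u x : ℂ)) b) :
    Rep (fun x => (θ.P4 F u x : ℂ)) ((𝔉).P4 b) := by
  have hl := θ.rep_sublaplacian F hU hUF hUc (θ.rep_sublaplacian F hU hUF hUc hu)
  have hT := θ.rep_dir_reeb F hU hUF hUc (θ.rep_dir_reeb F hU hUF hUc hu)
  have hd := θ.rep_divAGrad F hU hUF hUc hu
  have h := (hl.add hT).add (((Rep.ofNat 2).mul (θ.rep_i F hU hUF hUc)).mul (hd.sub hd.star))
  refine Rep.congr h fun x _ => ?_
  simp only [P4]
  push_cast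
  rw [im_cast]
  ring

lemma rep_Q3 : Rep (fun x => ((2 * (θ.sublaplacian F (θ.R F) x -
    2 * (θ.div F (θ.divA F) x).im) : ℝ) : ℂ)) (𝔉).Q3 := by
  have hR := θ.rep_sublaplacian F hU hUF hUc (θ.rep_R F hU hUF hUc)
  have hd := θ.rep_div F hU hUF hUc (θ.rep_divA F hU hUF hUc)
  refine Rep.congr ((Rep.ofNat 2).mul (hR.add ((θ.rep_i F hU hUF hUc).mul (hd.sub hd.star))))
    fun x _ => ?_
  push_cast
  rw [im_cast]
  ring

lemma rep_P4' (hu : Rep (fun x => (u x : ℂ)) b) :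
    Rep (fun x => ((3 * θ.P4' F u x : ℝ) : ℂ)) ((𝔉).P4' b) := by
  have hl := θ.rep_sublaplacian F hU hUF hUc (θ.rep_sublaplacian F hU hUF hUc hu)
  have hd := θ.rep_divAGrad F hU hUF hUc hu
  have hR := θ.rep_div F hU hUF hUc ((θ.rep_R F hU hUF hUc).mul (θ.rep_nabla_zero F hU hUF hUc hu))
  have hW := (θ.rep_W F hU hUF hUc).mul (θ.rep_gradUp F hU hUF hUc hu)
  have h := (((((Rep.ofNat 12).mul hl).add (((Rep.ofNat 12).mul (θ.rep_i F hU hUF hUc)).mul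
    (hd.sub hd.star))).sub ((Rep.ofNat 6).mul (hR.add hR.star))).add
    ((Rep.ofNat 4).mul (hW.add hW.star))).add ((θ.rep_Q3 F hU hUF hUc).mul hu)
  refine Rep.congr h fun x _ => ?_
  simp only [P4']
  push_cast
  rw [re_cast, re_cast, im_cast (θ.divAGrad F u x)]
  ring

/-- Only the zeroth-order coefficient survives on the constant 1. -/
lemma rep_Q : Rep (fun x => ((3 * θ.Q F x : ℝ) : ℂ)) (𝔉).Q3 := by
  have h1 : Rep (fun _ => (((1 : ℝ) : ℝ) : ℂ)) (1 : SmoothAlg U) := fun x hx => by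
    rw [SmoothAlg.ev_one hx, Complex.ofReal_one]
  have h := θ.rep_P4' F hU hUF hUc h1
  have e : (𝔉).P4' 1 = (𝔉).Q3 := by
    simp [FrameAlgebra.P4', FrameAlgebra.lap, FrameAlgebra.box, FrameAlgebra.div,
      FrameAlgebra.nabla, FrameAlgebra.nablaBar, FrameAlgebra.divAGrad]
  rwa [e] at h

lemma rep_Q4' : Rep (fun x => (θ.Q4' F x : ℂ)) (𝔉).Q4' := by
  have hR := θ.rep_sublaplacian F hU hUF hUc (θ.rep_R F hU hUF hUc)
  have ha := θ.rep_a F hU hUF hUc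
  have hA := (((θ.rep_hi F hU hUF hUc).pow 2).mul ha).mul ha.star
  have hA' : Rep (fun x => (θ.normSqA F x : ℂ)) _ := hA.re (by
    simp only [star_mul', star_pow, star_star, FrameAlgebra.star_hi]
    ring)
  refine Rep.congr ((((Rep.ofNat 2).mul hR).sub ((Rep.ofNat 4).mul hA')).add
    ((θ.rep_R F hU hUF hUc).pow 2)) fun x _ => ?_
  simp only [Q4']
  push_cast
  ring

end rep

end ContactForm

end
end CR

/-! ### Change of frame and of contact form on the manifold; the pointwise law. -/

namespace CR

open Set Filter Topology

noncomputable section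

set_option linter.unusedSectionVars false

variable {M : Type*} [TopologicalSpace M] [ChartedSpace E3 M] [IsManifold (𝓡 3) ∞ M]
  {S : CRStructure M}

lemma dir_exp (V : VField M) {σ : M → ℝ} {x : M} (hσ : MDifferentiableAt (𝓡 3) 𝓘(ℝ, ℝ) σ x) :
    dir V (fun y => Real.exp (σ y)) x = Real.exp (σ x) * dir V σ x := by
  have h1 : HasMFDerivAt 𝓘(ℝ, ℝ) 𝓘(ℝ, ℝ) Real.exp (σ x)
      (ContinuousLinearMap.toSpanSingleton ℝ (Real.exp (σ x))) :=
    (Real.hasDerivAt_exp (σ x)).hasFDerivAt.hasMFDerivAt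
  have := (h1.comp x hσ.hasMFDerivAt).mfderiv
  unfold dir
  erw [this]
  exact mul_comm _ _

lemma SmoothOn.exp {σ : M → ℝ} {U : Set M} (hσ : SmoothOn σ U) :
    SmoothOn (fun y => Real.exp (σ y)) U :=
  Real.contDiff_exp.contMDiff.comp_contMDiffOn hσ

lemma SmoothOn.sqrt {f : M → ℝ} {U : Set M} (hf : SmoothOn f U) (h : ∀ x ∈ U, f x ≠ 0) :
    SmoothOn (fun y => Real.sqrt (f y)) U := by
  intro x hx
  have h1 : ContMDiffAt 𝓘(ℝ, ℝ) 𝓘(ℝ, ℝ) ∞ Real.sqrt (f x) :=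
    (Real.contDiffAt_sqrt (h x hx)).contMDiffAt
  exact h1.comp_contMDiffWithinAt x (hf x hx)

namespace ContactForm

variable (θ : ContactForm S) (F F' : S.Frame)

/-- The function `λ` with `Z' = λ Z` for two local frames. -/
def ratio (x : M) : ℂ := θ.cX F x (F'.X x) + Complex.I * θ.cY F x (F'.X x)

variable {x : M}

lemma frame_X_eq (hx : x ∈ F.U) (hx' : x ∈ F'.U) :
    F'.X x = θ.cX F x (F'.X x) • F.X x + θ.cY F x (F'.X x) • F.Y x :=
  θ.eq_of_mem F hx (F'.X_mem x hx')

/-- Apply J to the expansion of X': complex linearity over H is what turns two real coefficients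
into one complex factor `ratio`. -/
lemma frame_Y_eq (hx : x ∈ F.U) (hx' : x ∈ F'.U) :
    F'.Y x = θ.cX F x (F'.X x) • F.Y x + (-θ.cY F x (F'.X x)) • F.X x := by
  have hX := θ.frame_X_eq F F' hx hx'
  set a := θ.cX F x (F'.X x)
  set b := θ.cY F x (F'.X x)
  have e : (⟨F'.X x, F'.X_mem x hx'⟩ : S.H x) =
      a • ⟨F.X x, F.X_mem x hx⟩ + b • S.J x ⟨F.X x, F.X_mem x hx⟩ := by
    refine Subtype.ext ?_
    refine hX.trans ?_
    rw [F.Y_eq x hx]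
    rfl
  rw [F'.Y_eq x hx', e, map_add, map_smul, map_smul, S.J_sq, F.Y_eq x hx, smul_neg, neg_smul]
  rfl

lemma ratio_ne_zero (hx : x ∈ F.U) (hx' : x ∈ F'.U) : θ.ratio F F' x ≠ 0 := by
  intro h
  have h1 := congrArg Complex.re h
  have h2 := congrArg Complex.im h
  simp [ratio] at h1 h2
  apply F'.X_ne_zero x hx'
  rw [θ.frame_X_eq F F' hx hx', h1, h2, zero_smul, zero_smul, add_zero]

lemma dirC_Z_frame (hx : x ∈ F.U) (hx' : x ∈ F'.U) (f : M → ℂ) :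
    dirC F'.Z f x = θ.ratio F F' x * dirC F.Z f x := by
  have key : ∀ (V V₁ V₂ : VField M) (a b : ℝ), V x = a • V₁ x + b • V₂ x →
      dir V f x = a * dir V₁ f x + b * dir V₂ f x := by
    intro V V₁ V₂ a b h
    unfold dir
    rw [h]
    refine (map_add (mfderiv (𝓡 3) 𝓘(ℝ, ℂ) f x) _ _).trans ?_
    exact congrArg₂ (· + ·) (map_smul (mfderiv (𝓡 3) 𝓘(ℝ, ℂ) f x) _ _)
      (map_smul (mfderiv (𝓡 3) 𝓘(ℝ, ℂ) f x) _ _)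
  rw [dirC_Z, dirC_Z, key F'.X _ _ _ _ (θ.frame_X_eq F F' hx hx'),
    key F'.Y _ _ _ _ (θ.frame_Y_eq F F' hx hx')]
  unfold ratio
  push_cast
  linear_combination (θ.cY F x (F'.X x) * dir F.Y f x : ℂ) * Complex.I_mul_I

variable {U : Set M} (hU : IsOpen U) (hUF : U ⊆ F.U) (hUF' : U ⊆ F'.U) {c : M}
  (hUc : U ⊆ (extChartAt (𝓡 3) c).source)

lemma smoothOn_ratio (hU : IsOpen U) (hUF : U ⊆ F.U) (hUF' : U ⊆ F'.U) :
    SmoothOn (θ.ratio F F') U :=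
  ContMDiffOn.add (SmoothOn.ofReal (θ.smoothOn_cX F hU hUF (smooth_X_on F' hUF')))
    (SmoothOn.mul contMDiffOn_const
      (SmoothOn.ofReal (θ.smoothOn_cY F hU hUF (smooth_X_on F' hUF'))))

lemma smoothOn_ratio_inv (hU : IsOpen U) (hUF : U ⊆ F.U) (hUF' : U ⊆ F'.U) :
    SmoothOn (fun x => (θ.ratio F F' x)⁻¹) U := by
  have h := θ.smoothOn_ratio F F' hU hUF hUF'
  have hn : SmoothOn (fun x => Complex.normSq (θ.ratio F F' x)) U := by
    refine (SmoothOn.re (SmoothOn.mul h h.star)).congr fun x _ => ?_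
    rw [Complex.star_def, Complex.mul_conj, Complex.ofReal_re]
  -- Smoothness is over ℝ, so the inverse is written as the conjugate divided by the nonvanishing
  -- squared norm.
  refine (SmoothOn.mul h.star (SmoothOn.ofReal (hn.inv₀ fun x hx => ?_))).congr fun x _ => ?_
  · exact (Complex.normSq_pos.mpr (θ.ratio_ne_zero F F' (hUF hx) (hUF' hx))).ne'
  · rw [Complex.inv_def]
    rfl

lemma frameChange : FrameAlgebra.FrameChange (θ.frameAlg F hU hUF hUc) (θ.frameAlg F' hU hUF' hUc)
    (SmoothAlg.mk (θ.ratio F F') (θ.smoothOn_ratio F F' hU hUF hUF'))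
    (SmoothAlg.mk _ (θ.smoothOn_ratio_inv F F' hU hUF hUF')) where
  l_mul_li := SmoothAlg.ext_ev fun x hx => by
    rw [SmoothAlg.ev_mul _ _ hx, SmoothAlg.ev_mk _ _ hx, SmoothAlg.ev_mk _ _ hx,
      SmoothAlg.ev_one hx, mul_inv_cancel₀ (θ.ratio_ne_zero F F' (hUF hx) (hUF' hx))]
  T_eq _ := rfl
  Z_eq f := SmoothAlg.ext_ev fun x hx => by
    rw [SmoothAlg.ev_mul _ _ hx, SmoothAlg.ev_mk _ _ hx]
    exact (CField.SmoothOn.ev_derivation (smooth_Z F' hU hUF') f hx).trans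
      ((θ.dirC_Z_frame F F' (hUF hx) (hUF' hx) _).trans (congrArg _
        (CField.SmoothOn.ev_derivation (smooth_Z F hU hUF) f hx).symm))

/-- The unitary frame proportional to a given one. -/
def unitary : S.Frame where
  U := F.U
  isOpen_U := F.isOpen_U
  X := fun x => Real.sqrt (2 * θ.levi F x)⁻¹ • F.X x
  Y := fun x => Real.sqrt (2 * θ.levi F x)⁻¹ • F.Y x
  smooth_X := SmoothFieldOn.smul F.smooth_X (SmoothOn.sqrt
    ((contMDiffOn_const.mul (θ.smoothOn_levi F)).inv₀ fun x hx =>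
      (mul_pos two_pos (θ.levi_pos' F hx)).ne') fun x hx =>
      (inv_pos.mpr (mul_pos two_pos (θ.levi_pos' F hx))).ne')
  smooth_Y := SmoothFieldOn.smul F.smooth_Y (SmoothOn.sqrt
    ((contMDiffOn_const.mul (θ.smoothOn_levi F)).inv₀ fun x hx =>
      (mul_pos two_pos (θ.levi_pos' F hx)).ne') fun x hx =>
      (inv_pos.mpr (mul_pos two_pos (θ.levi_pos' F hx))).ne')
  X_ne_zero x hx := smul_ne_zero (Real.sqrt_pos.mpr
    (inv_pos.mpr (mul_pos two_pos (θ.levi_pos' F hx)))).ne' (F.X_ne_zero x hx)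
  X_mem x hx := Submodule.smul_mem _ _ (F.X_mem x hx)
  Y_eq x hx := by
    rw [F.Y_eq x hx]
    exact (congrArg Subtype.val ((S.J x).map_smul (Real.sqrt (2 * θ.levi F x)⁻¹)
      ⟨F.X x, F.X_mem x hx⟩)).symm

/-- Since h = 2 dθ(X, Y) scales by the square of the factor, the factor is (2 dθ(X, Y))^{-1/2}. -/
lemma h_unitary (hx : x ∈ F.U) : θ.h (θ.unitary F) x = 1 := by
  have hl := θ.levi_pos' F hx
  have h1 : θ.levi (θ.unitary F) x = (2 * θ.levi F x)⁻¹ * θ.levi F x := by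
    have h2 := Real.mul_self_sqrt (inv_pos.mpr (mul_pos two_pos hl)).le
    simp only [levi, unitary, dAt_smul_left, dAt_smul_right]
    rw [← mul_assoc]
    congr 1
  rw [θ.h_eq _ (show x ∈ (θ.unitary F).U from hx), h1]
  push_cast
  have : (θ.levi F x : ℂ) ≠ 0 := by exact_mod_cast hl.ne'
  field_simp

variable {θ' : ContactForm S} {σ : M → ℝ}

/-- The frame unitary for θ serves both contact forms. Only the Reeb field changes: its θ-component
is e^{-σ}, forced by θ'(T') = 1, and `b` is its component under the coframe of θ. -/
lemma conformalChange (hσ : ContMDiff (𝓡 3) 𝓘(ℝ, ℝ) ∞ σ)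
    (hθ' : ∀ x, θ'.form x = Real.exp (σ x) • θ.form x) (hUu : U ⊆ (θ.unitary F).U) :
    FrameAlgebra.ConformalChange (θ.frameAlg (θ.unitary F) hU hUu hUc)
      (θ'.frameAlg (θ.unitary F) hU hUu hUc)
      (SmoothAlg.mk _ (SmoothOn.ofReal (hσ.contMDiffOn (s := U))))
      (SmoothAlg.mk _ (SmoothOn.ofReal (SmoothOn.exp (hσ.contMDiffOn (s := U)))))
      (SmoothAlg.mk _ (SmoothOn.ofReal (SmoothOn.exp (ContMDiffOn.neg (hσ.contMDiffOn (s := U))))))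
      (SmoothAlg.mk _ (θ.smoothOn_coframe (θ.unitary F) hU hUu (θ'.smooth_reeb U))) where
  h_eq_one := SmoothAlg.ext_ev fun x hx => by
    rw [SmoothAlg.ev_one hx]
    exact (θ.rep_h (θ.unitary F) hU hUu hUc x hx).symm.trans (θ.h_unitary F (hUu hx))
  star_s := (Rep.mk _).star_eq
  star_E := (Rep.mk _).star_eq
  E_mul_Ei := SmoothAlg.ext_ev fun x hx => by
    rw [SmoothAlg.ev_mul _ _ hx, SmoothAlg.ev_mk _ _ hx, SmoothAlg.ev_mk _ _ hx,
      SmoothAlg.ev_one hx, ← Complex.ofReal_mul, Real.exp_neg,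
      mul_inv_cancel₀ (Real.exp_pos _).ne', Complex.ofReal_one]
  Z_E := SmoothAlg.ext_ev fun x hx => by
    have hd := (hσ.contMDiffOn (s := U)).contMDiffAt (hU.mem_nhds hx) |>.mdifferentiableAt
      (by simp)
    have hd' := (SmoothOn.exp (hσ.contMDiffOn (s := U))).mdifferentiableAt hU hx
    have h1 := θ.rep_Z (θ.unitary F) hU hUu hUc
      (Rep.mk (SmoothOn.ofReal (SmoothOn.exp (hσ.contMDiffOn (s := U))))) x hx
    have h2 := θ.rep_Z (θ.unitary F) hU hUu hUc
      (Rep.mk (SmoothOn.ofReal (hσ.contMDiffOn (s := U)))) x hx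
    rw [SmoothAlg.ev_mul _ _ hx, ← h1, ← h2, SmoothAlg.ev_mk _ _ hx, dirC_Z, dirC_Z,
      dir_ofReal _ hd, dir_ofReal _ hd, dir_ofReal _ hd', dir_ofReal _ hd', dir_exp _ hd,
      dir_exp _ hd]
    push_cast
    ring
  T_eq f := SmoothAlg.ext_ev fun x hx => by
    have hf : Rep (SmoothAlg.ev f) f := fun _ _ => rfl
    have h1 := θ'.rep_T (θ.unitary F) hU hUu hUc hf x hx
    have h2 := θ.rep_T (θ.unitary F) hU hUu hUc hf x hx
    have h3 := θ.rep_Z (θ.unitary F) hU hUu hUc hf x hx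
    have h4 := θ.rep_Zb (θ.unitary F) hU hUu hUc hf x hx
    rw [SmoothAlg.ev_add _ _ hx, SmoothAlg.ev_add _ _ hx, SmoothAlg.ev_mul _ _ hx,
      SmoothAlg.ev_mul _ _ hx, SmoothAlg.ev_mul _ _ hx, SmoothAlg.ev_star _ hx,
      SmoothAlg.ev_mk _ _ hx, SmoothAlg.ev_mk _ _ hx, ← h1, ← h2, ← h3, ← h4, dirC_T, dirC_T,
      θ.dir_eq (θ.unitary F) (hUu hx) θ'.reeb]
    have h5 : θ.form x (θ'.reeb x) = Real.exp (-σ x) := by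
      have := θ'.form_reeb x
      rw [hθ' x] at this
      change Real.exp (σ x) * θ.form x (θ'.reeb x) = 1 at this
      rw [Real.exp_neg]
      exact eq_inv_of_mul_eq_one_right this
    rw [h5]
  Z_eq _ := rfl

/-- The pointwise transformation law. -/
theorem Q4'_transform (hσ : ContMDiff (𝓡 3) 𝓘(ℝ, ℝ) ∞ σ)
    (hθ' : ∀ x, θ'.form x = Real.exp (σ x) • θ.form x) (hx : x ∈ F.U) (hx' : x ∈ F'.U) :
    Real.exp (2 * σ x) * θ'.Q4' F' x
      = θ.Q4' F x + θ.P4' F σ x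
        + 16 / 3 * (θ.div F (fun y => (σ y : ℂ) * θ.W F y) x).re
        + 3 * θ.Q F x * σ x + 1 / 2 * θ.P4 F (fun y => σ y ^ 2) x - σ x * θ.P4 F σ x
        - 16 * (θ.gradUp F (fun y => (σ y : ℂ)) x * θ.PForm F σ x).re := by
  set U : Set M := F.U ∩ F'.U ∩ (extChartAt (𝓡 3) x).source with hUdef
  have hU : IsOpen U := (F.isOpen_U.inter F'.isOpen_U).inter (isOpen_source x)
  have hxU : x ∈ U := ⟨⟨hx, hx'⟩, mem_extChartAt_source x⟩
  have hUF : U ⊆ F.U := fun y hy => hy.1.1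
  have hUF' : U ⊆ F'.U := fun y hy => hy.1.2
  have hUc : U ⊆ (extChartAt (𝓡 3) x).source := fun y hy => hy.2
  have hUu : U ⊆ (θ.unitary F).U := hUF
  -- `C` holds in the frame unitary for θ, while the statement refers to `F` for θ and `F'` for θ';
  -- `D` and `D'` bridge the difference.
  have C := θ.conformalChange F hU hUc hσ hθ' hUu
  have D := θ.frameChange (θ.unitary F) F hU hUu hUF hUc
  have D' := θ'.frameChange (θ.unitary F) F' hU hUu hUF' hUc
  have hs : Rep (fun y => (σ y : ℂ)) (SmoothAlg.mk _
    (SmoothOn.ofReal (hσ.contMDiffOn (s := U)))) := Rep.mk _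
  have hE : Rep (fun y => ((Real.exp (σ y) : ℝ) : ℂ)) (SmoothAlg.mk _
    (SmoothOn.ofReal (SmoothOn.exp (hσ.contMDiffOn (s := U))))) := Rep.mk _
  set s := SmoothAlg.mk _ (SmoothOn.ofReal (hσ.contMDiffOn (s := U)))
  set E := SmoothAlg.mk _ (SmoothOn.ofReal (SmoothOn.exp (hσ.contMDiffOn (s := U))))
  have key := C.Q4'_eq
  have hss : Rep (fun y => ((σ y ^ 2 : ℝ) : ℂ)) (s * s) :=
    (hs.mul hs).congr fun y _ => by push_cast; ring
  have hdiv : (θ.frameAlg F hU hUF hUc).div (s * (θ.frameAlg F hU hUF hUc).W) =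
      (θ.frameAlg _ hU hUu hUc).div (s * (θ.frameAlg _ hU hUu hUc).W) := by
    rw [D.W_eq, mul_left_comm, D.div_eq]
  have hgrad : (θ.frameAlg F hU hUF hUc).hi * (θ.frameAlg F hU hUF hUc).Zb s *
      (θ.frameAlg F hU hUF hUc).PForm s = (θ.frameAlg _ hU hUu hUc).hi *
      (θ.frameAlg _ hU hUu hUc).Zb s * (θ.frameAlg _ hU hUu hUc).PForm s := by
    rw [D.PForm_eq, mul_comm, D.grad_mul_eq, mul_comm]
  rw [← D'.Q4'_eq, ← D.Q4'_eq, ← D.P4'_eq, ← D.Q3_eq, ← D.P4_eq, ← D.P4_eq, ← hdiv, ← hgrad]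
    at key
  have ev := congrArg (fun g => SmoothAlg.ev g x) key
  simp only [SmoothAlg.ev_add _ _ hxU, SmoothAlg.ev_sub _ _ hxU, SmoothAlg.ev_mul _ _ hxU,
    SmoothAlg.ev_star _ hxU, SmoothAlg.ev_pow _ _ hxU, SmoothAlg.ev_ofNat _ hxU] at ev
  have r1 := θ'.rep_Q4' F' hU hUF' hUc x hxU
  have r2 := θ.rep_Q4' F hU hUF hUc x hxU
  have r3 := θ.rep_P4' F hU hUF hUc hs x hxU
  have r4 := θ.rep_div F hU hUF hUc (hs.mul (θ.rep_W F hU hUF hUc)) x hxU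
  have r5 := θ.rep_Q F hU hUF hUc x hxU
  have r6 := θ.rep_P4 F hU hUF hUc hss x hxU
  have r7 := θ.rep_P4 F hU hUF hUc hs x hxU
  have r8 := θ.rep_gradUp F hU hUF hUc hs x hxU
  rw [SmoothAlg.ev_mul _ _ hxU] at r8
  have r9 := θ.rep_PForm F hU hUF hUc hs x hxU
  rw [← r1, ← r2, ← r3, ← r4, ← r5, ← r6, ← r7, ← r8, ← r9, ← hs x hxU, ← hE x hxU] at ev
  apply Complex.ofReal_injective
  rw [two_mul, Real.exp_add]
  push_cast at ev ⊢
  rw [re_cast, re_cast, star_mul']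
  rw [star_mul'] at ev
  linear_combination ev / 6

end ContactForm

end
end CR

/-! ### The volume form θ ∧ dθ and divergences of (1,0)-forms. -/

namespace CR

open Set Filter Topology

noncomputable section

set_option linter.unusedSectionVars false

variable {M : Type*} [TopologicalSpace M] [ChartedSpace E3 M] [IsManifold (𝓡 3) ∞ M]
  {S : CRStructure M}

/-- The value of the 3-form `α ∧ dβ` at a point. -/
def wedge (α β : OneForm M ℝ) (x : M) (u v w : TangentSpace (𝓡 3) x) : ℝ :=
  α x u * dAt β x v w + α x v * dAt β x w u + α x w * dAt β x u v

/-- An alternating trilinear form picks up the determinant. -/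
lemma wedge_comb (α β : OneForm M ℝ) (x : M) (e : Fin 3 → TangentSpace (𝓡 3) x)
    (a : Fin 3 → Fin 3 → ℝ) (u : Fin 3 → TangentSpace (𝓡 3) x) (hu : ∀ j, u j = ∑ k, a j k • e k) :
    wedge α β x (u 0) (u 1) (u 2) = (Matrix.of a).det * wedge α β x (e 0) (e 1) (e 2) := by
  rw [Matrix.det_fin_three]
  simp only [hu, wedge, Fin.sum_univ_three, map_add, map_smul, dAt_add_left, dAt_add_right,
    dAt_smul_left, dAt_smul_right, dAt_self, smul_eq_mul, Matrix.of_apply]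
  rw [dAt_swap β x (e 1) (e 0), dAt_swap β x (e 2) (e 1), dAt_swap β x (e 0) (e 2)]
  ring

namespace ContactForm

variable (θ : ContactForm S)

/-- The components of a one-form in a chart. -/
def comp (α : OneForm M ℝ) (c : M) (k : Fin 3) (x : M) : ℝ := α x (coordField c k x)

lemma smoothOn_comp {α : OneForm M ℝ} (hα : SmoothForm α) (c : M) (k : Fin 3) :
    SmoothOn (comp α c k) (extChartAt (𝓡 3) c).source :=
  hα (isOpen_source c) (smoothFieldOn_coordField c k)

/-- The bracket term of dα vanishes because coordinate fields commute. -/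
lemma curl_comp {α : OneForm M ℝ} (hα : SmoothForm α) {c x : M}
    (hx : x ∈ (extChartAt (𝓡 3) c).source) (j k : Fin 3) :
    dir (coordField c j) (comp α c k) x - dir (coordField c k) (comp α c j) x =
      dAt α x (coordField c j x) (coordField c k x) := by
  rw [← hα.d_eq_dAt (isOpen_source c) (smoothFieldOn_coordField c j)
    (smoothFieldOn_coordField c k) hx, d, bracket_coordField hx, map_zero, sub_zero]
  rfl

lemma coord_eq {c : M} {y : E3} (hy : y ∈ (extChartAt (𝓡 3) c).target) (k : Fin 3) :
    θ.coord c k y = comp θ.form c k ((extChartAt (𝓡 3) c).symm y) := by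
  unfold coord comp coordField
  rw [(extChartAt (𝓡 3) c).right_inv hy]

lemma dcoord_eq {c x : M} (hx : x ∈ (extChartAt (𝓡 3) c).source) (j k : Fin 3) :
    θ.dcoord c j k (extChartAt (𝓡 3) c x) = dir (coordField c j) (comp θ.form c k) x := by
  rw [dir_coordField hx ((smoothOn_comp θ.smoothForm c k).mdifferentiableAt (isOpen_source c) hx)]
  unfold dcoord
  congr 1
  refine Filter.EventuallyEq.fderiv_eq ?_
  filter_upwards [(isOpen_extChartAt_target (I := 𝓡 3) c).mem_nhds
    ((extChartAt (𝓡 3) c).map_source hx)] with y hy using θ.coord_eq hy k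

/-- The coefficient of `θ ∧ dθ` in a chart, as a function on the manifold. -/
def vol (c x : M) : ℝ :=
  wedge θ.form θ.form x (coordField c 0 x) (coordField c 1 x) (coordField c 2 x)

lemma volCoeff_eq {c x : M} (hx : x ∈ (extChartAt (𝓡 3) c).source) :
    θ.volCoeff c (extChartAt (𝓡 3) c x) = θ.vol c x := by
  have hy := (extChartAt (𝓡 3) c).map_source hx
  simp only [volCoeff, θ.dcoord_eq hx, θ.coord_eq hy, (extChartAt (𝓡 3) c).left_inv hx,
    curl_comp θ.smoothForm hx, vol, wedge]
  rfl

lemma volCoeff_eq' {c : M} {y : E3} (hy : y ∈ (extChartAt (𝓡 3) c).target) :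
    θ.volCoeff c y = θ.vol c ((extChartAt (𝓡 3) c).symm y) := by
  rw [← θ.volCoeff_eq ((extChartAt (𝓡 3) c).map_target hy), (extChartAt (𝓡 3) c).right_inv hy]

lemma smoothOn_vol (c : M) : SmoothOn (θ.vol c) (extChartAt (𝓡 3) c).source := by
  have h := fun k => smoothOn_comp θ.smoothForm c k
  have hd := fun j k => θ.smoothForm.d_smooth (isOpen_source c) (smoothFieldOn_coordField c j)
    (smoothFieldOn_coordField c k)
  refine (ContMDiffOn.add (ContMDiffOn.add (SmoothOn.mul (h 0) (hd 1 2))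
    (SmoothOn.mul (h 1) (hd 2 0))) (SmoothOn.mul (h 2) (hd 0 1))).congr fun x hx => ?_
  have e := fun j k => θ.smoothForm.d_eq_dAt (isOpen_source c) (smoothFieldOn_coordField c j)
    (smoothFieldOn_coordField c k) hx
  simp only [Pi.add_apply, e]
  rfl

variable (F : S.Frame)

/-- The matrix of the coordinate fields of a chart in the frame `(T, X, Y)`. -/
def coordMat (c x : M) (j : Fin 3) : Fin 3 → ℝ :=
  ![θ.form x (coordField c j x), θ.cX F x (coordField c j x), θ.cY F x (coordField c j x)]

/-- The frame `(T, X, Y)`. -/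
def frameVec (x : M) : Fin 3 → TangentSpace (𝓡 3) x := ![θ.reeb x, F.X x, F.Y x]

lemma coordField_eq_sum {x : M} (hx : x ∈ F.U) (c : M) (j : Fin 3) :
    coordField c j x = ∑ k, θ.coordMat F c x j k • θ.frameVec F x k := by
  rw [Fin.sum_univ_three, add_assoc]
  exact θ.decomp F hx _

lemma wedge_coord (α β : OneForm M ℝ) {x : M} (hx : x ∈ F.U) (c : M) :
    wedge α β x (coordField c 0 x) (coordField c 1 x) (coordField c 2 x) =
      (Matrix.of (θ.coordMat F c x)).det * wedge α β x (θ.reeb x) (F.X x) (F.Y x) :=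
  wedge_comb α β x (θ.frameVec F x) (θ.coordMat F c x) (fun j => coordField c j x)
    (θ.coordField_eq_sum F hx c)

lemma wedge_form {α : OneForm M ℝ} {x : M} (hx : x ∈ F.U) :
    wedge θ.form α x (θ.reeb x) (F.X x) (F.Y x) = dAt α x (F.X x) (F.Y x) := by
  rw [wedge, θ.form_reeb, θ.form_X F hx, θ.form_Y F hx]
  ring

lemma vol_eq {x : M} (hx : x ∈ F.U) (c : M) :
    θ.vol c x = (Matrix.of (θ.coordMat F c x)).det * θ.levi F x := by
  rw [vol, θ.wedge_coord F _ _ hx, θ.wedge_form F hx]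
  rfl

lemma vol_change {c c' x : M} (hx : x ∈ (extChartAt (𝓡 3) c').source) : θ.vol c x =
    (Matrix.of fun j k => chartVec c' x (coordField c j x) k).det * θ.vol c' x :=
  wedge_comb θ.form θ.form x (fun k => coordField c' k x) _ (fun j => coordField c j x)
    fun j => eq_sum_coordField hx (coordField c j x)

/-- Evaluated on (T, X, Y), the form θ ∧ dθ is the Levi form, which is positive and is also a
determinant times `vol`. -/
lemma vol_ne_zero {c x : M} (hx : x ∈ (extChartAt (𝓡 3) c).source) : θ.vol c x ≠ 0 := by
  obtain ⟨F, hF⟩ := S.exists_frame x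
  intro h
  have h1 := wedge_comb θ.form θ.form x (fun k => coordField c k x)
    (fun j k => chartVec c x (θ.frameVec F x j) k) (θ.frameVec F x)
    fun j => eq_sum_coordField hx (θ.frameVec F x j)
  have h2 : wedge θ.form θ.form x (θ.frameVec F x 0) (θ.frameVec F x 1) (θ.frameVec F x 2) =
    θ.levi F x := θ.wedge_form F hF
  rw [h2] at h1
  change _ = _ * θ.vol c x at h1
  rw [h, mul_zero] at h1
  exact (θ.levi_pos' F hF).ne' h1

/-- In d(e^σ θ) the term with dσ contains a factor θ, so it dies in the wedge with θ. -/
lemma vol_conformal {θ' : ContactForm S} {σ : M → ℝ} (hσ : ContMDiff (𝓡 3) 𝓘(ℝ, ℝ) ∞ σ)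
    (hθ' : ∀ x, θ'.form x = Real.exp (σ x) • θ.form x) {c x : M}
    (hx : x ∈ (extChartAt (𝓡 3) c).source) :
    θ'.vol c x = Real.exp (2 * σ x) * θ.vol c x := by
  have hc : ∀ k, comp θ'.form c k = fun y => Real.exp (σ y) * comp θ.form c k y := fun k =>
    funext fun y => by rw [comp, hθ' y]; rfl
  have hE : MDifferentiableAt (𝓡 3) 𝓘(ℝ, ℝ) (fun y => Real.exp (σ y)) x :=
    (SmoothOn.exp (hσ.contMDiffOn (s := univ))).mdifferentiableAt isOpen_univ (mem_univ x)
  have hd : ∀ j k, dir (coordField c j) (comp θ'.form c k) x =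
      Real.exp (σ x) * dir (coordField c j) (comp θ.form c k) x +
      comp θ.form c k x * dir (coordField c j) (fun y => Real.exp (σ y)) x := fun j k => by
    rw [hc, dir_mul _ hE ((smoothOn_comp θ.smoothForm c k).mdifferentiableAt (isOpen_source c) hx)]
  have hv : ∀ η : ContactForm S, η.vol c x =
      comp η.form c 0 x * (dir (coordField c 1) (comp η.form c 2) x -
        dir (coordField c 2) (comp η.form c 1) x) +
      comp η.form c 1 x * (dir (coordField c 2) (comp η.form c 0) x -
        dir (coordField c 0) (comp η.form c 2) x) +
      comp η.form c 2 x * (dir (coordField c 0) (comp η.form c 1) x -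
        dir (coordField c 1) (comp η.form c 0) x) := fun η => by
    simp only [curl_comp η.smoothForm hx]
    rfl
  rw [hv, hv, two_mul, Real.exp_add]
  simp only [hd]
  simp only [hc]
  ring

/-! ### Sections of the canonical bundle and their divergence -/

lemma coframe_change {x : M} (F' : S.Frame) (hx : x ∈ F.U) (hx' : x ∈ F'.U)
    (v : TangentSpace (𝓡 3) x) :
    θ.coframe F x v = θ.ratio F F' x * θ.coframe F' x v := by
  obtain ⟨h1, h2, h3⟩ := θ.coframe_spec F hx
  have hX : θ.coframe F x (F'.X x) = θ.ratio F F' x * (1 / 2) := by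
    rw [θ.frame_X_eq F F' hx hx', map_add, map_smul, map_smul, h1, h2, ratio]
    simp only [Complex.real_smul]
    ring
  have hY : θ.coframe F x (F'.Y x) = θ.ratio F F' x * (Complex.I / 2) := by
    rw [θ.frame_Y_eq F F' hx hx', map_add, map_smul, map_smul, h1, h2, ratio]
    simp only [Complex.real_smul]
    push_cast
    linear_combination (-(1 / 2) * θ.cY F x (F'.X x) : ℂ) * Complex.I_mul_I
  rw [θ.coframe_eq F' hx']
  conv_lhs => rw [θ.decomp F' hx' v]
  rw [map_add, map_add, map_smul, map_smul, map_smul, hX, hY, h3]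
  simp only [Complex.real_smul]
  ring

/-- A smooth `(1,0)`-form, given by its components in all local frames. -/
structure IsSection (τ : S.Frame → M → ℂ) : Prop where
  smooth : ∀ F : S.Frame, SmoothOn (τ F) F.U
  change : ∀ (F F' : S.Frame) (x : M), x ∈ F.U → x ∈ F'.U → τ F' x = θ.ratio F F' x * τ F x

/-- The real one-form `Im (τ θ¹)` of a `(1,0)`-form. -/
def imForm (τ : S.Frame → M → ℂ) : OneForm M ℝ := fun x =>
  Complex.imCLM.comp (τ (S.exists_frame x).choose x • θ.coframe (S.exists_frame x).choose x)

variable {θ} {τ : S.Frame → M → ℂ}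

/-- The product τ₁θ¹ does not depend on the frame, as τ₁ is multiplied by the factor by which θ¹ is
divided; the frame chosen in `imForm` is immaterial. -/
lemma IsSection.imForm_apply (hτ : θ.IsSection τ) {x : M} (hx : x ∈ F.U)
    (v : TangentSpace (𝓡 3) x) : θ.imForm τ x v = (τ F x * θ.coframe F x v).im := by
  have hx₀ := (S.exists_frame x).choose_spec
  set F₀ := (S.exists_frame x).choose with hF₀
  have h : θ.imForm τ x v = (τ F₀ x * θ.coframe F₀ x v).im := rfl
  rw [h, hτ.change F F₀ x hx hx₀, θ.coframe_change F F₀ hx hx₀]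
  ring_nf

lemma IsSection.smoothForm_imForm (hτ : θ.IsSection τ) : SmoothForm (θ.imForm τ) := by
  intro U V hU hV x hx
  obtain ⟨F, hF⟩ := S.exists_frame x
  have hO : IsOpen (U ∩ F.U) := hU.inter F.isOpen_U
  have h1 : SmoothOn (fun y => τ F y * θ.coframe F y (V y)) (U ∩ F.U) :=
    SmoothOn.mul ((hτ.smooth F).mono inter_subset_right)
      (θ.smoothOn_coframe F hO inter_subset_right (hV.mono inter_subset_left))
  have h2 : SmoothOn (fun y => θ.imForm τ y (V y)) (U ∩ F.U) :=
    (Complex.imCLM.contMDiff.comp_contMDiffOn h1).congr fun y hy =>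
      hτ.imForm_apply F hy.2 (V y)
  exact (h2.contMDiffAt (hO.mem_nhds ⟨hx, hF⟩)).contMDiffWithinAt

lemma IsSection.imForm_X (hτ : θ.IsSection τ) {x : M} (hx : x ∈ F.U) :
    θ.imForm τ x (F.X x) = (τ F x).im / 2 := by
  rw [hτ.imForm_apply F hx, (θ.coframe_spec F hx).1]
  simp
  ring

lemma IsSection.imForm_Y (hτ : θ.IsSection τ) {x : M} (hx : x ∈ F.U) :
    θ.imForm τ x (F.Y x) = (τ F x).re / 2 := by
  rw [hτ.imForm_apply F hx, (θ.coframe_spec F hx).2.1]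
  simp
  ring

lemma IsSection.imForm_reeb (hτ : θ.IsSection τ) (x : M) : θ.imForm τ x (θ.reeb x) = 0 := by
  obtain ⟨F, hx⟩ := S.exists_frame x
  rw [hτ.imForm_apply F hx, (θ.coframe_spec F hx).2.2, mul_zero, Complex.zero_im]

/-- Both α and dθ annihilate T, so α ∧ dθ = 0. -/
lemma IsSection.wedge_imForm (hτ : θ.IsSection τ) (x : M) :
    wedge (θ.imForm τ) θ.form x (θ.reeb x) (F.X x) (F.Y x) = 0 := by
  rw [wedge, hτ.imForm_reeb, dAt_reeb, dAt_swap _ _ _ (θ.reeb x), dAt_reeb]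
  ring

/-- The key to the divergence theorem: θ ∧ dα = Re(∇^α τ_α) θ ∧ dθ. The derivatives X Re τ - Y Im τ
are the real part of Z̄τ, and the bracket term α([X, Y]) contributes the connection term through
ω(Z̄) = -2i θ¹([X, Y]). -/
lemma IsSection.d_imForm (hτ : θ.IsSection τ) {x : M} (hx : x ∈ F.U) :
    dAt (θ.imForm τ) x (F.X x) (F.Y x) = θ.levi F x * (θ.div F (τ F) x).re := by
  have hd := (hτ.smooth F).mdifferentiableAt F.isOpen_U hx
  have hre : ∀ V : VField M, dir V (fun y => (τ F y).re) x = (dir V (τ F) x).re := fun V =>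
    dir_clm_comp Complex.reCLM V hd
  have him : ∀ V : VField M, dir V (fun y => (τ F y).im) x = (dir V (τ F) x).im := fun V =>
    dir_clm_comp Complex.imCLM V hd
  have hdre : MDifferentiableAt (𝓡 3) 𝓘(ℝ, ℝ) (fun y => (τ F y).re) x :=
    SmoothOn.mdifferentiableAt (Complex.reCLM.contMDiff.comp_contMDiffOn (hτ.smooth F)) F.isOpen_U hx
  have hdim : MDifferentiableAt (𝓡 3) 𝓘(ℝ, ℝ) (fun y => (τ F y).im) x :=
    SmoothOn.mdifferentiableAt (Complex.imCLM.contMDiff.comp_contMDiffOn (hτ.smooth F)) F.isOpen_U hx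
  have e1 : dir F.X (fun y => θ.imForm τ y (F.Y y)) x = 1 / 2 * (dir F.X (τ F) x).re := by
    rw [dir_congr (g := fun y => (1 / 2) * (τ F y).re) (by
      filter_upwards [F.isOpen_U.mem_nhds hx] with y hy
      rw [hτ.imForm_Y F hy]; ring), dir_mul _ mdifferentiableAt_const hdre, dir_const, hre]
    ring
  have e2 : dir F.Y (fun y => θ.imForm τ y (F.X y)) x = 1 / 2 * (dir F.Y (τ F) x).im := by
    rw [dir_congr (g := fun y => (1 / 2) * (τ F y).im) (by
      filter_upwards [F.isOpen_U.mem_nhds hx] with y hy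
      rw [hτ.imForm_X F hy]; ring), dir_mul _ mdifferentiableAt_const hdim, dir_const, him]
    ring
  rw [← hτ.smoothForm_imForm.d_eq_dAt F.isOpen_U F.smooth_X F.smooth_Y hx, d, e1, e2,
    hτ.imForm_apply F hx, div, nablaBar, θ.omegaZbar_eq F hx, dirC_Zbar, θ.h_eq F hx]
  have hl := (θ.levi_pos' F hx).ne'
  rw [show (2 * (θ.levi F x : ℂ))⁻¹ = (((2 * θ.levi F x)⁻¹ : ℝ) : ℂ) by push_cast; rfl,
    Complex.re_ofReal_mul]
  simp only [brXY]
  simp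
  field_simp
  ring

end ContactForm

end
end CR

/-! ### Integration in charts and by partition of unity. -/

namespace CR

open Set Filter Topology

noncomputable section

set_option linter.unusedSectionVars false

variable {M : Type*} [TopologicalSpace M] [T2Space M] [ChartedSpace E3 M] [IsManifold (𝓡 3) ∞ M]
  {S : CRStructure M}

/-! ### Integration in charts -/

lemma integrableOn_chart {c : M} {K : Set M} (hK : IsCompact K)
    (hKc : K ⊆ (extChartAt (𝓡 3) c).source) {G : M → ℝ}
    (hG : ContinuousOn G (extChartAt (𝓡 3) c).source)
    (h0 : ∀ x ∈ (extChartAt (𝓡 3) c).source, x ∉ K → G x = 0) :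
    IntegrableOn (fun y => G ((extChartAt (𝓡 3) c).symm y)) (extChartAt (𝓡 3) c).target := by
  have hK' : IsCompact (extChartAt (𝓡 3) c '' K) :=
    hK.image_of_continuousOn ((continuousOn_extChartAt c).mono hKc)
  have hc : ContinuousOn (fun y => G ((extChartAt (𝓡 3) c).symm y)) (extChartAt (𝓡 3) c).target :=
    hG.comp (continuousOn_extChartAt_symm c) fun y hy => (extChartAt (𝓡 3) c).map_target hy
  have hsub : extChartAt (𝓡 3) c '' K ⊆ (extChartAt (𝓡 3) c).target := by
    rintro _ ⟨x, hx, rfl⟩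
    exact (extChartAt (𝓡 3) c).map_source (hKc hx)
  refine ((hc.mono hsub).integrableOn_compact hK').of_forall_sdiff_eq_zero
    (isOpen_extChartAt_target c).measurableSet fun y hy => ?_
  refine h0 _ ((extChartAt (𝓡 3) c).map_target hy.1) fun hyK => hy.2 ⟨_, hyK, ?_⟩
  exact (extChartAt (𝓡 3) c).right_inv hy.1

/-- Integration by parts for a function with compact support in the chart. The locally constant
factor `s` will be the sign of `vol`, needed because integrals are taken against |θ ∧ dθ| while
divergences come with θ ∧ dθ. -/
lemma integral_dir_coordField {c : M} {K : Set M} (hK : IsCompact K)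
    (hKc : K ⊆ (extChartAt (𝓡 3) c).source) {B s : M → ℝ}
    (hB : SmoothOn B (extChartAt (𝓡 3) c).source)
    (h0 : ∀ x ∈ (extChartAt (𝓡 3) c).source, x ∉ K → B x = 0)
    (hs : ∀ x ∈ (extChartAt (𝓡 3) c).source, ∀ᶠ z in 𝓝 x, s z = s x) (k : Fin 3) :
    IntegrableOn (fun y => dir (coordField c k) B ((extChartAt (𝓡 3) c).symm y) *
        s ((extChartAt (𝓡 3) c).symm y)) (extChartAt (𝓡 3) c).target ∧
    ∫ y in (extChartAt (𝓡 3) c).target, dir (coordField c k) B ((extChartAt (𝓡 3) c).symm y) *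
      s ((extChartAt (𝓡 3) c).symm y) = 0 := by
  set φ := extChartAt (𝓡 3) c with hφ
  have hO : IsOpen φ.target := isOpen_extChartAt_target c
  have hsc : ContinuousOn s φ.source := fun x hx =>
    (continuousAt_const.congr (f := fun _ => s x)
      ((hs x hx).mono fun z hz => hz.symm)).continuousWithinAt
  have hdB : SmoothOn (dir (coordField c k) B) φ.source :=
    (smoothFieldOn_coordField c k).dir (isOpen_source c) hB
  have hd0 : ∀ x ∈ φ.source, x ∉ K → dir (coordField c k) B x = 0 := by
    intro x hx hxK
    rw [dir_congr (g := fun _ => 0), dir_const]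
    filter_upwards [(isOpen_source c).mem_nhds hx, hK.isClosed.isOpen_compl.mem_nhds hxK] with z hz
      hzK using h0 z hz hzK
  have hi1 : IntegrableOn (fun y => B (φ.symm y) * s (φ.symm y)) φ.target :=
    integrableOn_chart (G := fun x => B x * s x) hK hKc (hB.continuousOn.mul hsc)
      fun x hx hxK => by rw [h0 x hx hxK, zero_mul]
  have hi2 : IntegrableOn (fun y => dir (coordField c k) B (φ.symm y) * s (φ.symm y)) φ.target :=
    integrableOn_chart (G := fun x => dir (coordField c k) B x * s x) hK hKc
      (hdB.continuousOn.mul hsc) fun x hx hxK => by rw [hd0 x hx hxK, zero_mul]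
  refine ⟨hi2, ?_⟩
  -- The extension by zero is differentiable on all of E3: outside the target it vanishes near each
  -- point, since the image of K is closed.
  set H : E3 → ℝ := φ.target.indicator fun y => B (φ.symm y) * s (φ.symm y) with hH
  have hin : ∀ y ∈ φ.target, HasFDerivAt H (s (φ.symm y) • fderiv ℝ (B ∘ φ.symm) y) y := by
    intro y hy
    have hsrc := φ.map_target hy
    have hev : H =ᶠ[𝓝 y] fun z => s (φ.symm y) * (B ∘ φ.symm) z := by
      have hct : ContinuousAt φ.symm y := continuousAt_extChartAt_symm'' hy
      filter_upwards [hO.mem_nhds hy, hct.eventually (hs _ hsrc)] with z hz hz2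
      rw [hH, indicator_of_mem hz, hz2, mul_comm]
      rfl
    have hdiff : DifferentiableAt ℝ (B ∘ φ.symm) y := by
      have hO' := (continuousOn_extChartAt_symm c).isOpen_inter_preimage hO (isOpen_source c)
      exact ((hB.contDiffOn_chart c).contDiffAt (hO'.mem_nhds ⟨hy, hsrc⟩)).differentiableAt
        (by simp)
    exact (hdiff.hasFDerivAt.const_mul _).congr_of_eventuallyEq hev
  have hout : ∀ y ∉ φ.target, HasFDerivAt H (0 : E3 →L[ℝ] ℝ) y := by
    intro y hy
    have hK' : IsCompact (φ '' K) :=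
      hK.image_of_continuousOn ((continuousOn_extChartAt c).mono hKc)
    have hyK : y ∉ φ '' K := by
      rintro ⟨x, hx, rfl⟩
      exact hy (φ.map_source (hKc hx))
    have hev : H =ᶠ[𝓝 y] fun _ => 0 := by
      filter_upwards [hK'.isClosed.isOpen_compl.mem_nhds hyK] with z hz
      by_cases hzt : z ∈ φ.target
      · rw [hH, indicator_of_mem hzt, h0 _ (φ.map_target hzt) fun h => hz ⟨_, h, φ.right_inv hzt⟩,
          zero_mul]
      · rw [hH, indicator_of_notMem hzt]
    exact (hasFDerivAt_const 0 y).congr_of_eventuallyEq hev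
  have hdiff : Differentiable ℝ H := fun y => by
    by_cases hy : y ∈ φ.target
    exacts [(hin y hy).differentiableAt, (hout y hy).differentiableAt]
  have hfd : (fun y => fderiv ℝ H y (EuclideanSpace.single k (1 : ℝ))) =
      φ.target.indicator fun y => dir (coordField c k) B (φ.symm y) * s (φ.symm y) := by
    funext y
    by_cases hy : y ∈ φ.target
    · rw [indicator_of_mem hy, (hin y hy).fderiv, dir_coordField (φ.map_target hy)
        (hB.mdifferentiableAt (isOpen_source c) (φ.map_target hy)), ← hφ, φ.right_inv hy]
      exact mul_comm _ _
    · rw [indicator_of_notMem hy, (hout y hy).fderiv]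
      rfl
  have hI1 : Integrable H := (integrable_indicator_iff hO.measurableSet).mpr hi1
  have hI2 : Integrable (fun y => fderiv ℝ H y (EuclideanSpace.single k (1 : ℝ))) := by
    rw [hfd]
    exact (integrable_indicator_iff hO.measurableSet).mpr hi2
  -- Integration by parts against the constant 1.
  have key := integral_mul_fderiv_eq_neg_fderiv_mul_of_integrable (μ := volume)
    (f := fun _ : E3 => (1 : ℝ)) (g := H) (v := EuclideanSpace.single k (1 : ℝ))
    (by simp) (by simpa using hI2) (by simpa using hI1)
    (fun x _ => differentiableAt_const _) (fun x _ => hdiff x)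
  simp only [one_mul, fderiv_fun_const, Pi.zero_apply, _root_.zero_apply, zero_mul,
    integral_zero, neg_zero] at key
  rw [← integral_indicator hO.measurableSet, ← key, ← hfd]

namespace ContactForm

variable (θ : ContactForm S)

/-- The integral of a function against `|θ ∧ dθ|` in one chart. -/
def chartIntegral (c : M) (g : M → ℝ) : ℝ :=
  ∫ y in (extChartAt (𝓡 3) c).target, g ((extChartAt (𝓡 3) c).symm y) * |θ.volCoeff c y|

lemma chartIntegral_eq (c : M) (g : M → ℝ) : θ.chartIntegral c g =
    ∫ y in (extChartAt (𝓡 3) c).target, g ((extChartAt (𝓡 3) c).symm y) *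
      |θ.vol c ((extChartAt (𝓡 3) c).symm y)| :=
  setIntegral_congr_fun (isOpen_extChartAt_target c).measurableSet fun y hy => by
    simp only [θ.volCoeff_eq' hy]

lemma integrableOn_vol {c : M} {K : Set M} (hK : IsCompact K)
    (hKc : K ⊆ (extChartAt (𝓡 3) c).source) {g : M → ℝ}
    (hg : ContinuousOn g (extChartAt (𝓡 3) c).source)
    (h0 : ∀ x ∈ (extChartAt (𝓡 3) c).source, x ∉ K → g x = 0) :
    IntegrableOn (fun y => g ((extChartAt (𝓡 3) c).symm y) *
      |θ.vol c ((extChartAt (𝓡 3) c).symm y)|) (extChartAt (𝓡 3) c).target :=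
  integrableOn_chart (G := fun x => g x * |θ.vol c x|) hK hKc
    (hg.mul (θ.smoothOn_vol c).continuousOn.abs) fun x hx hxK => by rw [h0 x hx hxK, zero_mul]

lemma chartIntegral_sum {ι : Type*} (s : Finset ι) {c : M} {K : ι → Set M}
    (hK : ∀ i ∈ s, IsCompact (K i)) (hKc : ∀ i ∈ s, K i ⊆ (extChartAt (𝓡 3) c).source)
    {g : ι → M → ℝ} (hg : ∀ i ∈ s, ContinuousOn (g i) (extChartAt (𝓡 3) c).source)
    (h0 : ∀ i ∈ s, ∀ x ∈ (extChartAt (𝓡 3) c).source, x ∉ K i → g i x = 0) :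
    θ.chartIntegral c (fun x => ∑ i ∈ s, g i x) = ∑ i ∈ s, θ.chartIntegral c (g i) := by
  simp only [chartIntegral_eq, Finset.sum_mul]
  exact integral_finsetSum s fun i hi => θ.integrableOn_vol (hK i hi) (hKc i hi) (hg i hi) (h0 i hi)

/-- The Jacobian matrix of the transition map is the transpose of the matrix expanding one
coordinate frame in the other. -/
lemma det_transition {c c' x : M} (hx : x ∈ (extChartAt (𝓡 3) c).source)
    (hx' : x ∈ (extChartAt (𝓡 3) c').source) :
    (fderiv ℝ (extChartAt (𝓡 3) c' ∘ (extChartAt (𝓡 3) c).symm) (extChartAt (𝓡 3) c x)).det =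
      (Matrix.of fun j k => chartVec c' x (coordField c j x) k).det := by
  rw [ContinuousLinearMap.det, ← LinearMap.det_toMatrix (EuclideanSpace.basisFun (Fin 3) ℝ).toBasis,
    ← Matrix.det_transpose]
  congr 1
  ext j k
  have h := dir_coordField hx ((smoothOn_extChartAt c').mdifferentiableAt (isOpen_source c') hx') j
  rw [Matrix.transpose_apply, LinearMap.toMatrix_apply, Matrix.of_apply]
  have h2 : chartVec c' x (coordField c j x) =
    fderiv ℝ (extChartAt (𝓡 3) c' ∘ (extChartAt (𝓡 3) c).symm) (extChartAt (𝓡 3) c x)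
      (EuclideanSpace.single j (1 : ℝ)) := h
  rw [h2]
  simp

/-- Change of variables on the overlap: the Jacobian determinant is exactly the ratio of the two
coefficients of θ ∧ dθ. -/
lemma chartIntegral_change {c c' : M} {g : M → ℝ} (hg : tsupport g ⊆ (extChartAt (𝓡 3) c).source)
    (hg' : tsupport g ⊆ (extChartAt (𝓡 3) c').source) :
    θ.chartIntegral c' g = θ.chartIntegral c g := by
  have restr : ∀ a b : M, tsupport g ⊆ (extChartAt (𝓡 3) b).source →
      θ.chartIntegral a g = ∫ y in (extChartAt (𝓡 3) a).target ∩
        (extChartAt (𝓡 3) a).symm ⁻¹' (extChartAt (𝓡 3) b).source,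
        g ((extChartAt (𝓡 3) a).symm y) * |θ.vol a ((extChartAt (𝓡 3) a).symm y)| := by
    intro a b hb
    rw [chartIntegral_eq]
    refine setIntegral_eq_of_subset_of_forall_sdiff_eq_zero
      (isOpen_extChartAt_target a).measurableSet inter_subset_left fun y hy => ?_
    have : (extChartAt (𝓡 3) a).symm y ∉ tsupport g := fun h => hy.2 ⟨hy.1, hb h⟩
    rw [image_eq_zero_of_notMem_tsupport this, zero_mul]
  rw [restr c' c hg, restr c c' hg']
  set φ := extChartAt (𝓡 3) c with hφ
  set ψ := extChartAt (𝓡 3) c' with hψ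
  set s := φ.target ∩ φ.symm ⁻¹' ψ.source with hs
  have hO : IsOpen s := (continuousOn_extChartAt_symm c).isOpen_inter_preimage
    (isOpen_extChartAt_target c) (isOpen_source c')
  have himg : (ψ ∘ φ.symm) '' s = ψ.target ∩ ψ.symm ⁻¹' φ.source := by
    ext z
    constructor
    · rintro ⟨y, hy, rfl⟩
      refine ⟨ψ.map_source hy.2, ?_⟩
      simp only [Function.comp, mem_preimage]
      rw [ψ.left_inv hy.2]
      exact φ.map_target hy.1
    · rintro ⟨hz1, hz2⟩
      refine ⟨φ (ψ.symm z), ⟨φ.map_source hz2, ?_⟩, ?_⟩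
      · rw [mem_preimage, φ.left_inv hz2]
        exact ψ.map_target hz1
      · simp only [Function.comp]
        rw [φ.left_inv hz2, ψ.right_inv hz1]
  have hinj : InjOn (ψ ∘ φ.symm) s := by
    intro y hy z hz h
    have h1 := ψ.injOn hy.2 hz.2 h
    exact φ.symm.injOn hy.1 hz.1 h1
  have hder : ∀ y ∈ s, HasFDerivWithinAt (ψ ∘ φ.symm) (fderiv ℝ (ψ ∘ φ.symm) y) s y := by
    intro y hy
    have h1 := (smoothOn_extChartAt c').contDiffOn_chart c
    exact ((h1.contDiffAt (hO.mem_nhds hy)).differentiableAt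
      (by simp)).hasFDerivAt.hasFDerivWithinAt
  rw [← himg, integral_image_eq_integral_abs_det_fderiv_smul volume hO.measurableSet hder hinj]
  refine setIntegral_congr_fun hO.measurableSet fun y hy => ?_
  have hdet := det_transition (c := c) (c' := c') (φ.map_target hy.1) hy.2
  have hv := θ.vol_change (c := c) (c' := c') hy.2
  simp only [Function.comp, smul_eq_mul]
  rw [ψ.left_inv hy.2, hv, ← hdet, ← hφ, φ.right_inv hy.1, abs_mul]
  simp only [Function.comp_def]
  ring

/-! ### Integration over a compact manifold -/

section compact

variable [CompactSpace M]

lemma finite_partition : {c : M | (Function.support (chartPartition M c)).Nonempty}.Finite :=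
  (chartPartition M).locallyFinite.finite_nonempty_of_compact

/-- The finitely many charts whose partition function does not vanish. -/
def chartFinset (M : Type*) [TopologicalSpace M] [T2Space M] [ChartedSpace E3 M]
    [IsManifold (𝓡 3) ∞ M] [CompactSpace M] : Finset M := (finite_partition (M := M)).toFinset

lemma partition_eq_zero {c : M} (hc : c ∉ chartFinset M) (x : M) : chartPartition M c x = 0 := by
  by_contra h
  exact hc ((finite_partition (M := M)).mem_toFinset.mpr ⟨x, h⟩)

lemma sum_partition (x : M) : ∑ c ∈ chartFinset M, chartPartition M c x = 1 := by
  rw [← (chartPartition M).sum_eq_one (mem_univ x)]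
  refine (finsum_eq_sum_of_support_subset _ fun c hc => ?_).symm
  by_contra h
  exact hc (partition_eq_zero (fun h' => h (Finset.mem_coe.mpr h')) x)

lemma tsupport_partition (c : M) :
    tsupport (chartPartition M c) ⊆ (extChartAt (𝓡 3) c).source := by
  rw [extChartAt_source]
  exact (SmoothPartitionOfUnity.exists_isSubordinate_chartAt_source (𝓡 3) M).choose_spec c

lemma smooth_partition (c : M) : SmoothOn (fun x => chartPartition M c x) univ :=
  (chartPartition M c).contMDiff.contMDiffOn

lemma continuous_partition (c : M) : Continuous fun x => chartPartition M c x :=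
  (chartPartition M c).contMDiff.continuous

lemma tsupport_partition_mul (c : M) (g : M → ℝ) :
    tsupport (fun x => chartPartition M c x * g x) ⊆ tsupport (chartPartition M c) :=
  tsupport_mul_subset_left

lemma isCompact_tsupport (g : M → ℝ) : IsCompact (tsupport g) := (isClosed_tsupport g).isCompact

lemma integral_eq_sum (f : M → ℝ) : θ.integral f =
    ∑ c ∈ chartFinset M, θ.chartIntegral c fun x => chartPartition M c x * f x := by
  refine finsum_eq_sum_of_support_subset _ fun c hc => ?_
  by_contra h
  refine hc ?_
  simp [partition_eq_zero fun h' => h (Finset.mem_coe.mpr h')]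

/-- Each piece of the partition is supported in both charts, so it can be integrated in the chart at
c, where the pieces sum back to g. -/
lemma integral_eq_chartIntegral {g : M → ℝ} (hg : Continuous g) {c : M}
    (hc : tsupport g ⊆ (extChartAt (𝓡 3) c).source) : θ.integral g = θ.chartIntegral c g := by
  rw [integral_eq_sum]
  have h1 : ∀ c', tsupport (fun x => chartPartition M c' x * g x) ⊆ tsupport g := fun c' =>
    tsupport_mul_subset_right
  have h2 : ∀ c' ∈ chartFinset M, (θ.chartIntegral c' fun x => chartPartition M c' x * g x) =
      θ.chartIntegral c fun x => chartPartition M c' x * g x := fun c' _ =>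
    θ.chartIntegral_change ((h1 c').trans hc)
      ((tsupport_partition_mul c' g).trans (tsupport_partition c'))
  rw [Finset.sum_congr rfl h2, ← θ.chartIntegral_sum (chartFinset M) (K := fun _ => tsupport g)
    (g := fun c' x => chartPartition M c' x * g x)
    (fun _ _ => isCompact_tsupport g) (fun _ _ => hc)
    (fun c' _ => ((continuous_partition c').mul hg).continuousOn)
    (fun c' _ x _ hx => by rw [image_eq_zero_of_notMem_tsupport hx, mul_zero])]
  congr 1
  funext x
  rw [← Finset.sum_mul, sum_partition, one_mul]

lemma integral_sum {ι : Type*} (s : Finset ι) {g : ι → M → ℝ} (hg : ∀ i ∈ s, Continuous (g i)) :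
    θ.integral (fun x => ∑ i ∈ s, g i x) = ∑ i ∈ s, θ.integral (g i) := by
  simp only [integral_eq_sum]
  rw [Finset.sum_comm]
  refine Finset.sum_congr rfl fun c _ => ?_
  simp only [Finset.mul_sum]
  exact θ.chartIntegral_sum s (K := fun _ => tsupport (chartPartition M c))
    (fun _ _ => isCompact_tsupport _) (fun _ _ => tsupport_partition c)
    (fun i hi => ((continuous_partition c).mul (hg i hi)).continuousOn)
    (fun i _ x _ hx => by rw [image_eq_zero_of_notMem_tsupport hx, zero_mul])

lemma integral_add {f g : M → ℝ} (hf : Continuous f) (hg : Continuous g) :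
    θ.integral (fun x => f x + g x) = θ.integral f + θ.integral g := by
  have := θ.integral_sum (Finset.univ : Finset (Fin 2)) (g := ![f, g]) (by simp [hf, hg])
  simpa using this

lemma integral_const_mul (a : ℝ) (f : M → ℝ) :
    θ.integral (fun x => a * f x) = a * θ.integral f := by
  simp only [integral_eq_sum, Finset.mul_sum, chartIntegral]
  refine Finset.sum_congr rfl fun c _ => ?_
  rw [← MeasureTheory.integral_const_mul]
  congr 1
  funext y
  ring

lemma integral_conformal {θ' : ContactForm S} {σ : M → ℝ} (hσ : ContMDiff (𝓡 3) 𝓘(ℝ, ℝ) ∞ σ)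
    (hθ' : ∀ x, θ'.form x = Real.exp (σ x) • θ.form x) (f : M → ℝ) :
    θ'.integral f = θ.integral (fun x => Real.exp (2 * σ x) * f x) := by
  simp only [integral_eq_sum, chartIntegral_eq]
  refine Finset.sum_congr rfl fun c _ =>
    setIntegral_congr_fun (isOpen_extChartAt_target c).measurableSet fun y hy => ?_
  simp only [θ.vol_conformal hσ hθ' ((extChartAt (𝓡 3) c).map_target hy), abs_mul,
    abs_of_pos (Real.exp_pos _)]
  ring

end compact

end ContactForm

end
end CR

/-! ### The divergence theorem for (1,0)-forms. -/

namespace CR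

open Set Filter Topology

noncomputable section

set_option linter.unusedSectionVars false

variable {M : Type*} [TopologicalSpace M] [ChartedSpace E3 M] [IsManifold (𝓡 3) ∞ M]
  {S : CRStructure M}

namespace ContactForm

variable (θ : ContactForm S)

/-- The components of `θ ∧ α` in a chart. -/
def cross (α : OneForm M ℝ) (c : M) (i j : Fin 3) (x : M) : ℝ :=
  comp θ.form c i x * comp α c j x - comp θ.form c j x * comp α c i x

lemma smoothOn_cross {α : OneForm M ℝ} (hα : SmoothForm α) (c : M) (i j : Fin 3) :
    SmoothOn (θ.cross α c i j) (extChartAt (𝓡 3) c).source :=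
  ContMDiffOn.sub (SmoothOn.mul (smoothOn_comp θ.smoothForm c i) (smoothOn_comp hα c j))
    (SmoothOn.mul (smoothOn_comp θ.smoothForm c j) (smoothOn_comp hα c i))

lemma dir_cross {α : OneForm M ℝ} (hα : SmoothForm α) {c x : M}
    (hx : x ∈ (extChartAt (𝓡 3) c).source) (i j k : Fin 3) :
    dir (coordField c k) (θ.cross α c i j) x =
      (comp θ.form c i x * dir (coordField c k) (comp α c j) x +
        comp α c j x * dir (coordField c k) (comp θ.form c i) x) -
      (comp θ.form c j x * dir (coordField c k) (comp α c i) x +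
        comp α c i x * dir (coordField c k) (comp θ.form c j) x) := by
  have h1 := fun l => (smoothOn_comp θ.smoothForm c l).mdifferentiableAt (isOpen_source c) hx
  have h2 := fun l => (smoothOn_comp hα c l).mdifferentiableAt (isOpen_source c) hx
  have hm : ∀ l m, MDifferentiableAt (𝓡 3) 𝓘(ℝ, ℝ)
      (fun y => comp θ.form c l y * comp α c m y) x := fun l m => (h1 l).mul (h2 m)
  have hn : ∀ l m, MDifferentiableAt (𝓡 3) 𝓘(ℝ, ℝ)
      (fun y => (-1) * (comp θ.form c l y * comp α c m y)) x := fun l m =>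
    mdifferentiableAt_const.mul (hm l m)
  have e : θ.cross α c i j = fun y => comp θ.form c i y * comp α c j y +
      (-1) * (comp θ.form c j y * comp α c i y) := by
    funext y
    rw [cross]
    ring
  rw [e, dir_add _ (hm i j) (hn j i), dir_mul _ mdifferentiableAt_const (hm j i), dir_const,
    dir_mul _ (h1 i) (h2 j), dir_mul _ (h1 j) (h2 i)]
  ring

/-- The divergence of the components of `θ ∧ α`. -/
lemma div_cross {α : OneForm M ℝ} (hα : SmoothForm α) {c x : M}
    (hx : x ∈ (extChartAt (𝓡 3) c).source) :
    dir (coordField c 0) (θ.cross α c 1 2) x + dir (coordField c 1) (θ.cross α c 2 0) x +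
      dir (coordField c 2) (θ.cross α c 0 1) x =
    wedge α θ.form x (coordField c 0 x) (coordField c 1 x) (coordField c 2 x) -
      wedge θ.form α x (coordField c 0 x) (coordField c 1 x) (coordField c 2 x) := by
  simp only [θ.dir_cross hα hx, wedge, ← curl_comp θ.smoothForm hx, ← curl_comp hα hx]
  simp only [comp]
  ring

/-- The function `(df ∧ θ ∧ α) / (θ ∧ dθ)`. -/
def transport (α : OneForm M ℝ) (f : M → ℝ) (x : M) : ℝ :=
  (dir (S.exists_frame x).choose.Y f x * α x ((S.exists_frame x).choose.X x) -
    dir (S.exists_frame x).choose.X f x * α x ((S.exists_frame x).choose.Y x)) /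
      θ.levi (S.exists_frame x).choose x

lemma dir_coordField_eq (F : S.Frame) {x : M} (hx : x ∈ F.U) (c : M) (k : Fin 3) (f : M → ℝ) :
    dir (coordField c k) f x = θ.form x (coordField c k x) * dir θ.reeb f x +
      (θ.cX F x (coordField c k x) * dir F.X f x + θ.cY F x (coordField c k x) * dir F.Y f x) := by
  unfold dir
  conv_lhs => rw [θ.decomp F hx (coordField c k x)]
  refine (map_add (mfderiv (𝓡 3) 𝓘(ℝ, ℝ) f x) _ _).trans ?_
  refine congrArg₂ (· + ·) (map_smul (mfderiv (𝓡 3) 𝓘(ℝ, ℝ) f x) _ _) ?_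
  refine (map_add (mfderiv (𝓡 3) 𝓘(ℝ, ℝ) f x) _ _).trans ?_
  exact congrArg₂ (· + ·) (map_smul (mfderiv (𝓡 3) 𝓘(ℝ, ℝ) f x) _ _)
    (map_smul (mfderiv (𝓡 3) 𝓘(ℝ, ℝ) f x) _ _)

variable {α : OneForm M ℝ}

/-- Both sides are df ∧ θ ∧ α on the coordinate fields. Because α(T) = 0 the derivative Tf does not
contribute, and a determinant times the Levi form remains. -/
lemma vol_mul_transport (hα : ∀ x, α x (θ.reeb x) = 0) (f : M → ℝ) (c x : M) :
    θ.vol c x * θ.transport α f x =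
      dir (coordField c 0) f x * θ.cross α c 1 2 x + dir (coordField c 1) f x * θ.cross α c 2 0 x +
      dir (coordField c 2) f x * θ.cross α c 0 1 x := by
  have hx := (S.exists_frame x).choose_spec
  rw [transport]
  set F := (S.exists_frame x).choose
  have hl := (θ.levi_pos' F hx).ne'
  have hc : ∀ k, comp α c k x = θ.cX F x (coordField c k x) * α x (F.X x) +
      θ.cY F x (coordField c k x) * α x (F.Y x) := fun k => by
    rw [comp]
    conv_lhs => rw [θ.decomp F hx (coordField c k x)]
    rw [map_add, map_add, map_smul, map_smul, map_smul, hα, smul_zero, zero_add]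
    rfl
  rw [θ.vol_eq F hx, Matrix.det_fin_three]
  simp only [cross, hc, θ.dir_coordField_eq F hx, coordMat, Matrix.of_apply, Matrix.cons_val]
  simp only [comp]
  field_simp
  ring

lemma transport_eq_zero {f : M → ℝ} {x : M} (hx : x ∉ tsupport f) : θ.transport α f x = 0 := by
  have h : ∀ V : VField M, dir V f x = 0 := fun V => by
    rw [dir_congr (g := fun _ => 0), dir_const]
    exact notMem_tsupport_iff_eventuallyEq.mp hx
  rw [transport, h, h]
  ring

/-- The definition picks an unrelated frame at every point; continuity is visible only in the chart
formula divided by `vol`. -/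
lemma continuous_transport (hα : SmoothForm α) (hα0 : ∀ x, α x (θ.reeb x) = 0) {f : M → ℝ}
    (hf : SmoothOn f univ) : Continuous (θ.transport α f) := by
  rw [continuous_iff_continuousAt]
  intro c
  have hc : c ∈ (extChartAt (𝓡 3) c).source := mem_extChartAt_source c
  have hd := fun k => (smoothFieldOn_coordField c k).dir (isOpen_source c)
    (hf.mono (subset_univ _))
  have h1 : SmoothOn (fun x => dir (coordField c 0) f x * θ.cross α c 1 2 x +
      dir (coordField c 1) f x * θ.cross α c 2 0 x +
      dir (coordField c 2) f x * θ.cross α c 0 1 x) (extChartAt (𝓡 3) c).source :=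
    ContMDiffOn.add (ContMDiffOn.add (SmoothOn.mul (hd 0) (θ.smoothOn_cross hα c 1 2))
      (SmoothOn.mul (hd 1) (θ.smoothOn_cross hα c 2 0)))
      (SmoothOn.mul (hd 2) (θ.smoothOn_cross hα c 0 1))
  have h2 : ContinuousOn (θ.transport α f) (extChartAt (𝓡 3) c).source :=
    (h1.continuousOn.div (θ.smoothOn_vol c).continuousOn fun x hx => θ.vol_ne_zero hx).congr
      fun x hx => (eq_div_iff (θ.vol_ne_zero hx)).mpr
        ((mul_comm _ _).trans (θ.vol_mul_transport hα0 f c x))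
  exact h2.continuousAt ((isOpen_source c).mem_nhds hc)

/-- `transport` is linear in df, and the differential of the constant 1 is zero. -/
lemma sum_transport {ι : Type*} (s : Finset ι) {f : ι → M → ℝ} (hf : ∀ i, SmoothOn (f i) univ)
    (h1 : ∀ x, ∑ i ∈ s, f i x = 1) (x : M) : ∑ i ∈ s, θ.transport α (f i) x = 0 := by
  have hsum : ∀ (V : VField M) (t : Finset ι),
      ∑ i ∈ t, dir V (f i) x = dir V (fun y => ∑ i ∈ t, f i y) x := by
    intro V t
    classical
    induction t using Finset.induction_on with
    | empty => simp [dir_const]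
    | insert i t hi ih =>
      simp only [Finset.sum_insert hi]
      have hs : SmoothOn (fun y => ∑ i ∈ t, f i y) univ := contMDiffOn_finsetSum fun i _ => hf i
      rw [ih, dir_add _ ((hf i).mdifferentiableAt isOpen_univ (mem_univ x))
        (hs.mdifferentiableAt isOpen_univ (mem_univ x))]
  have hd : ∀ V : VField M, ∑ i ∈ s, dir V (f i) x = 0 := fun V => by
    rw [hsum, funext h1, dir_const]
  simp only [transport]
  rw [← Finset.sum_div, Finset.sum_sub_distrib, ← Finset.sum_mul, ← Finset.sum_mul, hd, hd]
  ring

/-- The continuous function `vol` has no zero in the chart domain, so its sign is locally constant.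
-/
lemma eventually_sign (θ : ContactForm S) {c x : M} (hx : x ∈ (extChartAt (𝓡 3) c).source) :
    ∀ᶠ z in 𝓝 x, |θ.vol c z| / θ.vol c z = |θ.vol c x| / θ.vol c x := by
  have hc : ContinuousAt (θ.vol c) x :=
    (θ.smoothOn_vol c).continuousOn.continuousAt ((isOpen_source c).mem_nhds hx)
  rcases lt_or_gt_of_ne (θ.vol_ne_zero hx) with h | h
  · filter_upwards [hc.eventually (gt_mem_nhds h)] with z hz
    rw [abs_of_neg hz, abs_of_neg h, neg_div, neg_div, div_self hz.ne, div_self h.ne]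
  · filter_upwards [hc.eventually (lt_mem_nhds h)] with z hz
    rw [abs_of_pos hz, abs_of_pos h, div_self hz.ne', div_self h.ne']

variable [T2Space M] [CompactSpace M]

/-- Integrate d(f θ ∧ α), which is exact with compact support in the chart. By the Leibniz rule it
equals df ∧ θ ∧ α + f d(θ ∧ α), that is, (transport - f g) θ ∧ dθ. -/
lemma chartIntegral_transport (hα : SmoothForm α) (hα0 : ∀ x, α x (θ.reeb x) = 0)
    {c : M} {f g : M → ℝ} (hf : SmoothOn f univ) (hfc : tsupport f ⊆ (extChartAt (𝓡 3) c).source)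
    (hg : Continuous g) (hdiv : ∀ x ∈ (extChartAt (𝓡 3) c).source,
      dir (coordField c 0) (θ.cross α c 1 2) x + dir (coordField c 1) (θ.cross α c 2 0) x +
      dir (coordField c 2) (θ.cross α c 0 1) x = -(θ.vol c x * g x)) :
    θ.chartIntegral c (fun x => f x * g x) = θ.chartIntegral c (θ.transport α f) := by
  have hK := isCompact_tsupport f
  have hf' : SmoothOn f (extChartAt (𝓡 3) c).source := hf.mono (subset_univ _)
  have hB := fun i j => SmoothOn.mul hf' (θ.smoothOn_cross hα c i j)
  have key := fun i j k => integral_dir_coordField hK hfc (s := fun x => |θ.vol c x| / θ.vol c x)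
    (hB i j) (fun x _ hx => by rw [image_eq_zero_of_notMem_tsupport hx, zero_mul])
    (fun x hx => θ.eventually_sign hx) k
  have hi1 := θ.integrableOn_vol hK hfc (g := fun x => f x * g x)
    (hf'.continuousOn.mul hg.continuousOn)
    (fun x _ hx => by rw [image_eq_zero_of_notMem_tsupport hx, zero_mul])
  have hi2 := θ.integrableOn_vol hK hfc (g := θ.transport α f)
    (θ.continuous_transport hα hα0 hf).continuousOn fun x _ hx => θ.transport_eq_zero hx
  rw [eq_comm, ← sub_eq_zero, chartIntegral_eq, chartIntegral_eq, ← integral_sub hi2 hi1]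
  have hsum := (MeasureTheory.integral_add ((key 1 2 0).1.add (key 2 0 1).1) (key 0 1 2).1).trans
    (congrArg₂ (· + ·) ((MeasureTheory.integral_add (key 1 2 0).1 (key 2 0 1).1).trans
      (congrArg₂ (· + ·) (key 1 2 0).2 (key 2 0 1).2)) (key 0 1 2).2)
  rw [add_zero, add_zero] at hsum
  rw [← hsum]
  refine setIntegral_congr_fun (isOpen_extChartAt_target c).measurableSet fun y hy => ?_
  have hx := (extChartAt (𝓡 3) c).map_target hy
  set x := (extChartAt (𝓡 3) c).symm y
  have hfd := hf'.mdifferentiableAt (isOpen_source c) hx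
  have hcd := fun i j => (θ.smoothOn_cross hα c i j).mdifferentiableAt (isOpen_source c) hx
  have ht := θ.vol_mul_transport hα0 f c x
  have hd := hdiv x hx
  have hv := θ.vol_ne_zero hx
  simp only [Pi.add_apply]
  rw [dir_mul _ hfd (hcd 1 2), dir_mul _ hfd (hcd 2 0), dir_mul _ hfd (hcd 0 1)]
  obtain ⟨s, hs⟩ : ∃ s, |θ.vol c x| / θ.vol c x = s := ⟨_, rfl⟩
  have hs' : |θ.vol c x| = s * θ.vol c x := (div_eq_iff hv).mp hs
  rw [hs, hs']
  linear_combination s * ht - s * f x * hd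

/-- The divergence theorem for `(1,0)`-forms. -/
theorem integral_div_eq_zero {τ : S.Frame → M → ℂ} (hτ : θ.IsSection τ) {g : M → ℝ}
    (hg : ∀ (F : S.Frame) (x : M), x ∈ F.U → g x = (θ.div F (τ F) x).re) : θ.integral g = 0 := by
  have hα := hτ.smoothForm_imForm
  have hα0 := hτ.imForm_reeb
  have hw : ∀ c x, wedge (θ.imForm τ) θ.form x (coordField c 0 x) (coordField c 1 x)
      (coordField c 2 x) = 0 ∧ wedge θ.form (θ.imForm τ) x (coordField c 0 x) (coordField c 1 x)
      (coordField c 2 x) = θ.vol c x * g x := by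
    intro c x
    obtain ⟨F, hF⟩ := S.exists_frame x
    rw [θ.wedge_coord F _ _ hF, θ.wedge_coord F _ _ hF, hτ.wedge_imForm, θ.wedge_form F hF,
      hτ.d_imForm F hF, hg F x hF, θ.vol_eq F hF]
    constructor <;> ring
  have hdiv : ∀ c, ∀ x ∈ (extChartAt (𝓡 3) c).source,
      dir (coordField c 0) (θ.cross (θ.imForm τ) c 1 2) x +
      dir (coordField c 1) (θ.cross (θ.imForm τ) c 2 0) x +
      dir (coordField c 2) (θ.cross (θ.imForm τ) c 0 1) x = -(θ.vol c x * g x) := by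
    intro c x hx
    rw [θ.div_cross hα hx, (hw c x).1, (hw c x).2, zero_sub]
  -- Only pointwise values of g are given; its continuity follows from the chart formula for d(θ ∧
  -- α).
  have hgc : Continuous g := by
    rw [continuous_iff_continuousAt]
    intro c
    have hc : c ∈ (extChartAt (𝓡 3) c).source := mem_extChartAt_source c
    have hd := fun i j k => (smoothFieldOn_coordField c k).dir (isOpen_source c)
      (θ.smoothOn_cross hα c i j)
    have h2 : ContinuousOn g (extChartAt (𝓡 3) c).source :=
      ((((hd 1 2 0).continuousOn.add (hd 2 0 1).continuousOn).add (hd 0 1 2).continuousOn).neg.div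
        (θ.smoothOn_vol c).continuousOn fun x hx => θ.vol_ne_zero hx).congr fun x hx =>
          (eq_div_iff (θ.vol_ne_zero hx)).mpr ((mul_comm _ _).trans
            (neg_eq_iff_eq_neg.mpr (hdiv c x hx)).symm)
    exact h2.continuousAt ((isOpen_source c).mem_nhds hc)
  rw [integral_eq_sum]
  -- Integration by parts moves the derivative onto each partition function; the resulting terms are
  -- global and sum to zero, since the partition functions sum to 1.
  have h1 : ∀ c ∈ chartFinset M, (θ.chartIntegral c fun x => chartPartition M c x * g x) =
      θ.integral (θ.transport (θ.imForm τ) (chartPartition M c)) := by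
    intro c _
    rw [θ.chartIntegral_transport hα hα0 (smooth_partition c) (tsupport_partition c) hgc (hdiv c),
      θ.integral_eq_chartIntegral (θ.continuous_transport hα hα0 (smooth_partition c))
        (c := c)]
    refine (closure_minimal (fun x hx => ?_) (isClosed_tsupport _)).trans (tsupport_partition c)
    by_contra h
    exact hx (θ.transport_eq_zero h)
  rw [Finset.sum_congr rfl h1, ← θ.integral_sum _ fun c _ =>
    θ.continuous_transport hα hα0 (smooth_partition c)]
  have h0 := fun x => θ.sum_transport (α := θ.imForm τ) (chartFinset M)
    (f := fun c x => chartPartition M c x) (fun c => smooth_partition c) sum_partition x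
  have h3 := θ.integral_const_mul 0 (fun _ => 0)
  rw [zero_mul] at h3
  simpa [h0] using h3

end ContactForm

end
end CR

/-! ### The exact part of the law and the total curvature. -/

namespace CR

namespace FrameAlgebra

variable {A : Type*} [CommRing A] [StarRing A] [Algebra ℂ A] [StarModule ℂ A]
  (F : FrameAlgebra A)

lemma div_add (t u : A) : F.div (t + u) = F.div t + F.div u := by
  simp only [div, nablaBar, map_add]
  ring

lemma div_mul (f t : A) : F.div (f * t) = f * F.div t + F.hi * F.Zb f * t := by
  simp only [div, nablaBar, Derivation.leibniz, smul_eq_mul]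
  ring

lemma div_const_mul {c : A} (hc : F.Zb c = 0) (t : A) : F.div (c * t) = c * F.div t := by
  rw [div_mul, hc]
  ring

lemma div_i_mul (t : A) : F.div (F.i * t) = F.i * F.div t := F.div_const_mul (F.deriv_i _) t

/-- The coefficients of `exactForm` are integer casts so that this one rule handles all of them. -/
lemma div_intCast_mul (n : ℤ) (t : A) : F.div (n * t) = n * F.div t :=
  F.div_const_mul (F.Zb.map_intCast n) t

lemma box_eq_star {f : A} (hf : star f = f) : F.box f = star (F.div (F.Z f)) := by
  rw [← star_star (F.box f), F.star_box, hf]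

lemma lap_eq_div {f : A} (hf : star f = f) :
    F.lap f = -(F.div (F.Z f) + star (F.div (F.Z f))) := by
  rw [lap, F.box_eq_star hf]

/-- In other words Q = -(4/3) Re ∇^α W_α. -/
lemma Q3_eq_div : F.Q3 = -(2 * (F.div F.W + star (F.div F.W))) := by
  have h : F.div F.W = F.div (F.Z F.R) - F.i * F.div F.divA := by
    have e : F.W = F.Z F.R + ((-1 : ℤ) : A) * (F.i * F.divA) := by
      rw [W]
      push_cast
      ring
    rw [e, div_add, div_intCast_mul, div_i_mul]
    push_cast
    ring
  rw [Q3, F.lap_eq_div F.star_R, h]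
  simp only [star_sub, star_mul', star_i]
  ring

/-- The `(1,0)`-form whose divergence is the exact part of the transformation law. -/
def exactForm (s : A) : A :=
  ((-8 : ℤ) : A) * F.Z (F.lap s) + ((8 : ℤ) : A) * (F.i * (F.a * (F.hi * F.Zb s)))
    + ((-4 : ℤ) : A) * (F.R * F.Z s) + ((8 : ℤ) : A) * (s * F.W)
    + ((2 : ℤ) : A) * F.PForm (s * s) + ((-16 : ℤ) : A) * (s * F.PForm s)

/-- The left side is 6 times the law without Q₄' and without 3(sP₄s + 2Qs). The fourth-order,
torsion and R-terms of P₄' and P₄(s²) are divergences already. By the product rule, -24 sP₄s joins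
the pairing of ∇s with P_α s to form the divergence of sP_α s; likewise the leftover -4·Q3·s joins
the pairing with W_α to form that of sW_α. -/
lemma div_exactForm (h1 : F.h = 1) {s : A} (hs : star s = s) :
    2 * F.P4' s + 16 * (F.div (s * F.W) + star (F.div (s * F.W))) - 6 * F.Q3 * s
      + 3 * F.P4 (s * s) - 24 * (s * F.P4 s)
      - 48 * (F.hi * F.Zb s * F.PForm s + star (F.hi * F.Zb s * F.PForm s)) =
    3 * (F.div (F.exactForm s) + star (F.div (F.exactForm s))) := by
  have hss : star (s * s) = s * s := by rw [star_mul', hs]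
  have hl : star (F.lap s) = F.lap s := F.star_lap hs
  rw [exactForm]
  simp only [div_add, div_intCast_mul, div_i_mul]
  rw [P4', F.lap_eq_div hl, F.P4_eq_div h1 hs, F.P4_eq_div h1 hss, F.Q3_eq_div, div_mul F s F.W,
    div_mul F s (F.PForm s)]
  simp only [star_add, star_mul', star_i, star_intCast, hs, divAGrad]
  push_cast
  ring

lemma FrameChange.exactForm_eq {F G : FrameAlgebra A} {l li : A} (C : FrameChange F G l li)
    (s : A) : G.exactForm s = l * F.exactForm s := by
  have : G.i = F.i := rfl
  rw [exactForm, exactForm, C.lap_eq, C.Z_eq, C.Z_eq, C.a_grad_eq, C.R_eq, C.W_eq, C.PForm_eq,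
    C.PForm_eq, this]
  ring

end FrameAlgebra

open Set Filter Topology

noncomputable section

set_option linter.unusedSectionVars false

variable {M : Type*} [TopologicalSpace M] [ChartedSpace E3 M] [IsManifold (𝓡 3) ∞ M]
  {S : CRStructure M}

namespace ContactForm

variable (θ : ContactForm S)

/-- The `(1,0)`-form whose divergence is the exact part of the transformation law. -/
def exactForm (σ : M → ℝ) (F : S.Frame) (x : M) : ℂ :=
  ((-8 : ℤ) : ℂ) * dirC F.Z (fun y => (θ.sublaplacian F σ y : ℂ)) x
    + ((8 : ℤ) : ℂ) * (Complex.I * (θ.A F x * θ.gradUp F (fun y => (σ y : ℂ)) x))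
    + ((-4 : ℤ) : ℂ) * ((θ.R F x : ℂ) * dirC F.Z (fun y => (σ y : ℂ)) x)
    + ((8 : ℤ) : ℂ) * ((σ x : ℂ) * θ.W F x)
    + ((2 : ℤ) : ℂ) * θ.PForm F (fun y => σ y ^ 2) x
    + ((-16 : ℤ) : ℂ) * ((σ x : ℂ) * θ.PForm F σ x)

section rep

variable (F : S.Frame) {U : Set M} (hU : IsOpen U) (hUF : U ⊆ F.U) {c : M}
  (hUc : U ⊆ (extChartAt (𝓡 3) c).source) {σ : M → ℝ} {s : SmoothAlg U}

lemma rep_intCast (n : ℤ) : Rep (fun _ => (n : ℂ)) (n : SmoothAlg U) := fun x hx => by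
  have := SmoothAlg.ev_algebraMap (U := U) (n : ℂ) hx
  rw [map_intCast] at this
  exact this.symm

lemma rep_sq (hs : Rep (fun y => (σ y : ℂ)) s) :
    Rep (fun y => ((σ y ^ 2 : ℝ) : ℂ)) (s * s) :=
  (hs.mul hs).congr fun y _ => by push_cast; ring

lemma rep_exactForm (hs : Rep (fun y => (σ y : ℂ)) s) :
    Rep (θ.exactForm σ F) ((θ.frameAlg F hU hUF hUc).exactForm s) :=
  ((((((rep_intCast _).mul (θ.rep_Z F hU hUF hUc (θ.rep_sublaplacian F hU hUF hUc hs))).add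
    ((rep_intCast _).mul ((θ.rep_i F hU hUF hUc).mul ((θ.rep_a F hU hUF hUc).mul
      (θ.rep_gradUp F hU hUF hUc hs))))).add
    ((rep_intCast _).mul ((θ.rep_R F hU hUF hUc).mul (θ.rep_Z F hU hUF hUc hs)))).add
    ((rep_intCast _).mul (hs.mul (θ.rep_W F hU hUF hUc)))).add
    ((rep_intCast _).mul (θ.rep_PForm F hU hUF hUc (rep_sq hs)))).add
    ((rep_intCast _).mul (hs.mul (θ.rep_PForm F hU hUF hUc hs)))

end rep

lemma exists_nhds (F F' : S.Frame) {x : M} (hx : x ∈ F.U) (hx' : x ∈ F'.U) :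
    ∃ U : Set M, IsOpen U ∧ x ∈ U ∧ U ⊆ F.U ∧ U ⊆ F'.U ∧ U ⊆ (extChartAt (𝓡 3) x).source :=
  ⟨F.U ∩ F'.U ∩ (extChartAt (𝓡 3) x).source,
    (F.isOpen_U.inter F'.isOpen_U).inter (isOpen_source x), ⟨⟨hx, hx'⟩, mem_extChartAt_source x⟩,
    fun _ hy => hy.1.1, fun _ hy => hy.1.2, fun _ hy => hy.2⟩

lemma continuousAt_of_rep {U : Set M} (hU : IsOpen U) {x : M} (hx : x ∈ U) {g : M → ℝ}
    {a : SmoothAlg U} (h : Rep (fun y => (g y : ℂ)) a) : ContinuousAt g x :=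
  (h.smooth.re).continuousOn.continuousAt (hU.mem_nhds hx)

/-- The frame may vary wildly with the point. Frame independence lets it be frozen in a
neighbourhood of x. -/
lemma continuous_of_frames {Φ : S.Frame → M → ℝ}
    (h1 : ∀ (F F' : S.Frame) (x : M), x ∈ F.U → x ∈ F'.U → Φ F' x = Φ F x)
    (h2 : ∀ (F : S.Frame) (x : M), x ∈ F.U → ContinuousAt (Φ F) x)
    {F : M → S.Frame} (hF : ∀ x, x ∈ (F x).U) : Continuous fun x => Φ (F x) x := by
  rw [continuous_iff_continuousAt]
  intro x
  refine (h2 (F x) x (hF x)).congr ?_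
  filter_upwards [(F x).isOpen_U.mem_nhds (hF x)] with y hy using (h1 _ _ y hy (hF y)).symm

variable {σ : M → ℝ}

lemma exists_rep (hσ : ContMDiff (𝓡 3) 𝓘(ℝ, ℝ) ∞ σ) (U : Set M) :
    ∃ s : SmoothAlg U, Rep (fun y => (σ y : ℂ)) s :=
  ⟨_, Rep.mk (SmoothOn.ofReal hσ.contMDiffOn)⟩

lemma isSection_exactForm (hσ : ContMDiff (𝓡 3) 𝓘(ℝ, ℝ) ∞ σ) :
    θ.IsSection (θ.exactForm σ) where
  smooth F x hx := by
    obtain ⟨U, hU, hxU, hUF, -, hUc⟩ := exists_nhds F F hx hx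
    obtain ⟨s, hs⟩ := exists_rep hσ U
    exact ((θ.rep_exactForm F hU hUF hUc hs).smooth.contMDiffAt
      (hU.mem_nhds hxU)).contMDiffWithinAt
  change F F' x hx hx' := by
    obtain ⟨U, hU, hxU, hUF, hUF', hUc⟩ := exists_nhds F F' hx hx'
    obtain ⟨s, hs⟩ := exists_rep hσ U
    rw [θ.rep_exactForm F' hU hUF' hUc hs x hxU, θ.rep_exactForm F hU hUF hUc hs x hxU,
      (θ.frameChange F F' hU hUF hUF' hUc).exactForm_eq, SmoothAlg.ev_mul _ _ hxU,
      SmoothAlg.ev_mk _ _ hxU]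

lemma div_exactForm_frame (hσ : ContMDiff (𝓡 3) 𝓘(ℝ, ℝ) ∞ σ) (F F' : S.Frame) {x : M}
    (hx : x ∈ F.U) (hx' : x ∈ F'.U) :
    θ.div F' (θ.exactForm σ F') x = θ.div F (θ.exactForm σ F) x := by
  obtain ⟨U, hU, hxU, hUF, hUF', hUc⟩ := exists_nhds F F' hx hx'
  obtain ⟨s, hs⟩ := exists_rep hσ U
  rw [θ.rep_div F' hU hUF' hUc (θ.rep_exactForm F' hU hUF' hUc hs) x hxU,
    θ.rep_div F hU hUF hUc (θ.rep_exactForm F hU hUF hUc hs) x hxU,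
    (θ.frameChange F F' hU hUF hUF' hUc).exactForm_eq,
    (θ.frameChange F F' hU hUF hUF' hUc).div_eq]

lemma continuousAt_div_exactForm (hσ : ContMDiff (𝓡 3) 𝓘(ℝ, ℝ) ∞ σ) (F : S.Frame) {x : M}
    (hx : x ∈ F.U) : ContinuousAt (fun y => (θ.div F (θ.exactForm σ F) y).re) x := by
  obtain ⟨U, hU, hxU, hUF, -, hUc⟩ := exists_nhds F F hx hx
  obtain ⟨s, hs⟩ := exists_rep hσ U
  exact (SmoothOn.re (θ.rep_div F hU hUF hUc
    (θ.rep_exactForm F hU hUF hUc hs)).smooth).continuousOn.continuousAt (hU.mem_nhds hxU)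

lemma Q4'_frame (F F' : S.Frame) {x : M} (hx : x ∈ F.U) (hx' : x ∈ F'.U) :
    θ.Q4' F' x = θ.Q4' F x := by
  obtain ⟨U, hU, hxU, hUF, hUF', hUc⟩ := exists_nhds F F' hx hx'
  apply Complex.ofReal_injective
  refine (θ.rep_Q4' F' hU hUF' hUc x hxU).trans (Eq.trans ?_ (θ.rep_Q4' F hU hUF hUc x hxU).symm)
  rw [(θ.frameChange F F' hU hUF hUF' hUc).Q4'_eq]

lemma continuousAt_Q4' (F : S.Frame) {x : M} (hx : x ∈ F.U) : ContinuousAt (θ.Q4' F) x := by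
  obtain ⟨U, hU, hxU, hUF, -, hUc⟩ := exists_nhds F F hx hx
  exact continuousAt_of_rep hU hxU (θ.rep_Q4' F hU hUF hUc)

lemma Q_frame (F F' : S.Frame) {x : M} (hx : x ∈ F.U) (hx' : x ∈ F'.U) :
    θ.Q F' x = θ.Q F x := by
  obtain ⟨U, hU, hxU, hUF, hUF', hUc⟩ := exists_nhds F F' hx hx'
  have h : 3 * θ.Q F' x = 3 * θ.Q F x := by
    apply Complex.ofReal_injective
    refine (θ.rep_Q F' hU hUF' hUc x hxU).trans (Eq.trans ?_ (θ.rep_Q F hU hUF hUc x hxU).symm)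
    rw [(θ.frameChange F F' hU hUF hUF' hUc).Q3_eq]
  linarith

lemma continuousAt_Q (F : S.Frame) {x : M} (hx : x ∈ F.U) : ContinuousAt (θ.Q F) x := by
  obtain ⟨U, hU, hxU, hUF, -, hUc⟩ := exists_nhds F F hx hx
  have h := continuousAt_of_rep hU hxU (θ.rep_Q F hU hUF hUc)
  exact (h.const_mul (1 / 3)).congr (Eventually.of_forall fun y => by ring)

lemma P4_frame (hσ : ContMDiff (𝓡 3) 𝓘(ℝ, ℝ) ∞ σ) (F F' : S.Frame) {x : M} (hx : x ∈ F.U)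
    (hx' : x ∈ F'.U) : θ.P4 F' σ x = θ.P4 F σ x := by
  obtain ⟨U, hU, hxU, hUF, hUF', hUc⟩ := exists_nhds F F' hx hx'
  obtain ⟨s, hs⟩ := exists_rep hσ U
  apply Complex.ofReal_injective
  refine (θ.rep_P4 F' hU hUF' hUc hs x hxU).trans
    (Eq.trans ?_ (θ.rep_P4 F hU hUF hUc hs x hxU).symm)
  rw [(θ.frameChange F F' hU hUF hUF' hUc).P4_eq]

lemma continuousAt_P4 (hσ : ContMDiff (𝓡 3) 𝓘(ℝ, ℝ) ∞ σ) (F : S.Frame) {x : M} (hx : x ∈ F.U) :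
    ContinuousAt (θ.P4 F σ) x := by
  obtain ⟨U, hU, hxU, hUF, -, hUc⟩ := exists_nhds F F hx hx
  obtain ⟨s, hs⟩ := exists_rep hσ U
  exact continuousAt_of_rep hU hxU (θ.rep_P4 F hU hUF hUc hs)

/-- The transformation law up to a divergence. -/
lemma transform_eq_div (hσ : ContMDiff (𝓡 3) 𝓘(ℝ, ℝ) ∞ σ) (F : S.Frame) {x : M} (hx : x ∈ F.U) :
    θ.P4' F σ x + 16 / 3 * (θ.div F (fun y => (σ y : ℂ) * θ.W F y) x).re
        + 3 * θ.Q F x * σ x + 1 / 2 * θ.P4 F (fun y => σ y ^ 2) x - σ x * θ.P4 F σ x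
        - 16 * (θ.gradUp F (fun y => (σ y : ℂ)) x * θ.PForm F σ x).re =
      3 * (σ x * θ.P4 F σ x + 2 * θ.Q F x * σ x) + (θ.div F (θ.exactForm σ F) x).re := by
  obtain ⟨U, hU, hxU, hUF, -, hUc⟩ := exists_nhds F F hx hx
  obtain ⟨s, hs⟩ := exists_rep hσ U
  have hUu : U ⊆ (θ.unitary F).U := hUF
  have D := θ.frameChange (θ.unitary F) F hU hUu hUF hUc
  have h1 : (θ.frameAlg (θ.unitary F) hU hUu hUc).h = 1 := SmoothAlg.ext_ev fun y hy => by
    rw [SmoothAlg.ev_one hy]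
    exact (θ.rep_h (θ.unitary F) hU hUu hUc y hy).symm.trans (θ.h_unitary F (hUu hy))
  have key := (θ.frameAlg (θ.unitary F) hU hUu hUc).div_exactForm h1 hs.star_eq
  have hdiv : (θ.frameAlg F hU hUF hUc).div (s * (θ.frameAlg F hU hUF hUc).W) =
      (θ.frameAlg _ hU hUu hUc).div (s * (θ.frameAlg _ hU hUu hUc).W) := by
    rw [D.W_eq, mul_left_comm, D.div_eq]
  have hdiv2 : (θ.frameAlg F hU hUF hUc).div ((θ.frameAlg F hU hUF hUc).exactForm s) =
      (θ.frameAlg _ hU hUu hUc).div ((θ.frameAlg _ hU hUu hUc).exactForm s) := by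
    rw [D.exactForm_eq, D.div_eq]
  have hgrad : (θ.frameAlg F hU hUF hUc).hi * (θ.frameAlg F hU hUF hUc).Zb s *
      (θ.frameAlg F hU hUF hUc).PForm s = (θ.frameAlg _ hU hUu hUc).hi *
      (θ.frameAlg _ hU hUu hUc).Zb s * (θ.frameAlg _ hU hUu hUc).PForm s := by
    rw [D.PForm_eq, mul_comm, D.grad_mul_eq, mul_comm]
  rw [← D.P4'_eq, ← D.Q3_eq, ← D.P4_eq, ← D.P4_eq, ← hdiv, ← hdiv2, ← hgrad] at key
  have ev := congrArg (fun g => SmoothAlg.ev g x) key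
  simp only [SmoothAlg.ev_add _ _ hxU, SmoothAlg.ev_sub _ _ hxU, SmoothAlg.ev_mul _ _ hxU,
    SmoothAlg.ev_star _ hxU, SmoothAlg.ev_ofNat _ hxU] at ev
  have r3 := θ.rep_P4' F hU hUF hUc hs x hxU
  have r4 := θ.rep_div F hU hUF hUc (hs.mul (θ.rep_W F hU hUF hUc)) x hxU
  have r5 := θ.rep_Q F hU hUF hUc x hxU
  have r6 := θ.rep_P4 F hU hUF hUc (rep_sq hs) x hxU
  have r7 := θ.rep_P4 F hU hUF hUc hs x hxU
  have r8 := θ.rep_gradUp F hU hUF hUc hs x hxU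
  rw [SmoothAlg.ev_mul _ _ hxU] at r8
  have r9 := θ.rep_PForm F hU hUF hUc hs x hxU
  have r10 := θ.rep_div F hU hUF hUc (θ.rep_exactForm F hU hUF hUc hs) x hxU
  rw [← r3, ← r4, ← r5, ← r6, ← r7, ← r8, ← r9, ← r10, ← hs x hxU] at ev
  apply Complex.ofReal_injective
  push_cast at ev ⊢
  rw [re_cast, re_cast, re_cast, star_mul']
  rw [star_mul'] at ev
  linear_combination ev / 6

/-- The transformation law of the total `Q₄'`-curvature. -/
theorem integral_Q4'_transform [T2Space M] [CompactSpace M] {θ' : ContactForm S}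
    (hσ : ContMDiff (𝓡 3) 𝓘(ℝ, ℝ) ∞ σ) (hθ' : ∀ x, θ'.form x = Real.exp (σ x) • θ.form x)
    {F F' : M → S.Frame} (hF : ∀ x, x ∈ (F x).U) (hF' : ∀ x, x ∈ (F' x).U) :
    θ'.integral (fun x => θ'.Q4' (F' x) x) = θ.integral (fun x => θ.Q4' (F x) x)
      + 3 * θ.integral (fun x => σ x * θ.P4 (F x) σ x + 2 * θ.Q (F x) x * σ x) := by
  have hQ4 : Continuous fun x => θ.Q4' (F x) x :=
    continuous_of_frames (fun F F' _ => θ.Q4'_frame F F') (fun F _ => θ.continuousAt_Q4' F) hF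
  have hQ : Continuous fun x => θ.Q (F x) x :=
    continuous_of_frames (fun F F' _ => θ.Q_frame F F') (fun F _ => θ.continuousAt_Q F) hF
  have hP4 : Continuous fun x => θ.P4 (F x) σ x :=
    continuous_of_frames (fun F F' _ => θ.P4_frame hσ F F') (fun F _ => θ.continuousAt_P4 hσ F) hF
  have hd : Continuous fun x => (θ.div (F x) (θ.exactForm σ (F x)) x).re :=
    continuous_of_frames (Φ := fun F x => (θ.div F (θ.exactForm σ F) x).re)
      (fun F F' _ hx hx' => by simp only [θ.div_exactForm_frame hσ F F' hx hx'])
      (fun F _ => θ.continuousAt_div_exactForm hσ F) hF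
  have hdiv : θ.integral (fun x => (θ.div (F x) (θ.exactForm σ (F x)) x).re) = 0 :=
    θ.integral_div_eq_zero (θ.isSection_exactForm hσ) fun F₀ x hx => by
      rw [θ.div_exactForm_frame hσ F₀ (F x) hx (hF x)]
  have hH : Continuous fun x => 3 * (σ x * θ.P4 (F x) σ x + 2 * θ.Q (F x) x * σ x) :=
    continuous_const.mul
      ((hσ.continuous.mul hP4).add ((continuous_const.mul hQ).mul hσ.continuous))
  -- The integral for θ' becomes one for θ with the factor e^{2σ}. Adding the vanishing divergence
  -- integral to the right side reduces the claim to equality of integrands.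
  rw [θ.integral_conformal hσ hθ', ← θ.integral_const_mul, ← add_zero (_ + _), ← hdiv,
    ← θ.integral_add hQ4 hH, ← θ.integral_add (f := fun x => θ.Q4' (F x) x +
      3 * (σ x * θ.P4 (F x) σ x + 2 * θ.Q (F x) x * σ x)) (hQ4.add hH) hd]
  congr 1
  funext x
  rw [θ.Q4'_transform (F x) (F' x) hσ hθ' (hF x) (hF' x)]
  have := θ.transform_eq_div hσ (F x) (hF x)
  linarith

end ContactForm

end
end CR

theorem mainTheorem10 {M : Type*} [TopologicalSpace M] [T2Space M]
    [ChartedSpace CR.E3 M] [IsManifold (𝓡 3) ∞ M]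
    (S : CR.CRStructure M) (θ θ' : CR.ContactForm S)
    (σ : M → ℝ) (hσ : ContMDiff (𝓡 3) 𝓘(ℝ, ℝ) ∞ σ)
    (hθ' : ∀ x, θ'.form x = Real.exp (σ x) • θ.form x)
    -- frames around each point, in which the scalars of `θ` and of `θ'` are computed
    (F F' : M → S.Frame) (hF : ∀ x, x ∈ (F x).U) (hF' : ∀ x, x ∈ (F' x).U) :
    (∀ x : M,
      Real.exp (2 * σ x) * θ'.Q4' (F' x) x
        = θ.Q4' (F x) x + θ.P4' (F x) σ x
          + 16 / 3 * (θ.div (F x) (fun y => (σ y : ℂ) * θ.W (F x) y) x).re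
          + 3 * θ.Q (F x) x * σ x
          + 1 / 2 * θ.P4 (F x) (fun y => σ y ^ 2) x
          - σ x * θ.P4 (F x) σ x
          - 16 * (θ.gradUp (F x) (fun y => (σ y : ℂ)) x * θ.PForm (F x) σ x).re) ∧
    (∀ [CompactSpace M],
      θ'.integral (fun x => θ'.Q4' (F' x) x)
        = θ.integral (fun x => θ.Q4' (F x) x)
          + 3 * θ.integral (fun x =>
              σ x * θ.P4 (F x) σ x + 2 * θ.Q (F x) x * σ x)) := by
  exact ⟨fun x => θ.Q4'_transform (F x) (F' x) hσ hθ' (hF x) (hF' x),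
    θ.integral_Q4'_transform hσ hθ' hF hF'⟩
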